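/- Let $P:(0,\infty)\to[0,\infty)$ (the initial power spectrum of an isotropic Gaussian velocity potential) be continuous, not identically zero, and bounded for large $k$. Put $\sigma_n^2=\frac{1}{2\pi^2}\int_0^\infty k^{2n+2}P(k)\,dk$, assume $\sigma_n^2<\infty$ for all $n\ge1$, and assume $\int_0^\infty k^2\,(k^2P(k))^2\,dk<\infty$. Let $g=g_{qp}(t,0)\neq0$, and define $$\hat C(\vec q)=\frac1{(2\pi)^3}\int_{\mathbb R^3}(\vec k\otimes\vec k)\,P(|\vec k|)\,e^{i\vec k\cdot\vec q}\,d^3k,\qquad Q=\frac{\sigma_1^2}{3}\,k^2g^2,$$ and, for $\vec k\neq0$, $k=|\vec k|$, the free power spectrum $$\mathcal P(k,t)=e^{-Q}\int_{\mathbb R^3}\Bigl(e^{g^2\,\vec k^\top\hat C(\vec q)\,\vec k}-1\Bigr)e^{i\vec k\cdot\vec q}\,d^3q ,$$ where the integral (whose kernel is square integrable, but in general not integrable) is understood as $\lim_{\varepsilon\to0^+}$ of the integral with the additional factor $e^{-\varepsilon|\vec q|^2}$. Let $$\xi(q)=\frac1{(2\pi)^3}\int_{\mathbb R^3} P(|\vec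 k|)\,\bigl(\cos(qk_z)-1\bigr)\,d^3k,\quad a_1(q)=\frac{\xi'(q)}{q},\quad a_2(q)=\xi''(q)-a_1(q),$$ $$R(x,y)=\frac{x^2/g^2}{a_2(x)}\,\frac{y}{1+y},\qquad y_0(x)=\frac{a_2(x)}{a_1(x)+\sigma_1^2/3},\qquad \Sigma=\frac{5}{2g^2\sigma_2^2}.$$ Then the limit defining $\mathcal P(k,t)$ exists and is real for every $\vec k\ne0$, the limits $$\mathcal P^{(m)}(t)=\frac{\pi^{3/2}}{(2m)!}\lim_{x\to0}\frac{d^{2m}}{dx^{2m}}\left\{\left(\frac{x^2/g^2}{a_1(x)+\sigma_1^2/3}\right)^{m+1}\left.\frac{d^m}{dy^m}\Bigl(y^m\sqrt{R(x,y)}\;e^{-R(x,y)/4}\Bigr)\right|_{y=y_0(x)}\right\}$$ exist for all $m\ge0$, and $\mathcal P(k,t)\sim\sum_{m\ge0}\mathcal P^{(m)}(t)\,k^{-3-2m}$ as $k\to\infty$, i.e. for every $N\ge0$ $$\mathcal P(k,t)-\sum_{m=0}^{N-1}\frac{\mathcal P^{(m)}(t)}{k^{3+2m}}=O\bigl(k^{-3-2N}\bigr)\qquad(k\to\infty).$$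 Moreover $$\mathcal P^{(0)}(t)=3(4\pi)^{3/2}\Sigma^{3/2}e^{-\Sigma},\qquad \mathcal P^{(1)}(t)=\frac{(4\pi)^{3/2}}{28}\,\frac{\sigma_3^2}{\sigma_2^2}\,\Sigma^{5/2}e^{-\Sigma}\bigl[123-132\,\Sigma+20\,\Sigma^2\bigr].$$ Finally, $\mathcal P^{(m+1)}(t)$ depends only on $g^2$ and on moments of order $2,\dots,m+3$, and on the highest moment $\sigma_{m+3}^2$ linearly: for each $m\ge0$ there are a nonzero real polynomial $c_m$ and a function $\Psi_m$, both independent of $P$, $g_{qp}$ and $t$, such that $$\mathcal P^{(m+1)}(t)=\frac{\sigma_{m+3}^2}{\sigma_2^2}\,\Sigma^{m+5/2}\,e^{-\Sigma}\,c_m(\Sigma)+\Psi_m\bigl(g^2,\sigma_2^2,\dots,\sigma_{m+2}^2\bigr).$$ -/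

import Mathlib

open Filter Topology Asymptotics MeasureTheory
open scoped Matrix Nat

noncomputable section

namespace FreePower

/-- Position and wave-vector space `ℝ³` with its Euclidean norm. -/
abbrev E3 : Type := EuclideanSpace ℝ (Fin 3)

/-- The moments `σₙ² = (2π²)⁻¹ ∫₀^∞ k^(2n+2) P(k) dk` of the power spectrum of the initial
velocity potential. -/
def sigmaSq (P : ℝ → ℝ) (n : ℕ) : ℝ :=
  1 / (2 * Real.pi ^ 2) * ∫ k in Set.Ioi (0 : ℝ), k ^ (2 * n + 2) * P k

/-- The linearly evolved moments `τₙ² = g² σₙ²`. -/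
def tauSq (P : ℝ → ℝ) (g : ℝ) (n : ℕ) : ℝ := g ^ 2 * sigmaSq P n

/-- `Σ = 5 / (2 τ₂²)`. -/
def bigSigma (P : ℝ → ℝ) (g : ℝ) : ℝ := 5 / (2 * tauSq P g 2)

/-- Power spectra `P` of the initial (isotropic, Gaussian) velocity potential; only the values of
`P` on `(0, ∞)` matter. `P` is continuous, nonnegative, not identically zero; its moments
`σₙ²`, `n ≥ 1`, are finite; `k² P(k)` is square integrable on `ℝ³` (so that the momentum
auto-correlation is square integrable); and `P` is bounded for large `k`. The moment `σ₀²` may be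
infinite. -/
structure IsInitialSpectrum (P : ℝ → ℝ) : Prop where
  continuousOn : ContinuousOn P (Set.Ioi 0)
  nonneg : ∀ k, 0 < k → 0 ≤ P k
  exists_pos : ∃ k, 0 < k ∧ 0 < P k
  moments : ∀ n : ℕ, 1 ≤ n → IntegrableOn (fun k : ℝ => k ^ (2 * n + 2) * P k) (Set.Ioi 0)
  sq_integrable : IntegrableOn (fun k : ℝ => k ^ 2 * (k ^ 2 * P k) ^ 2) (Set.Ioi 0)
  bounded : P =O[atTop] (fun _ => (1 : ℝ))

/-- The initial momentum auto-correlation matrix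
`Ĉ(q) = (2π)⁻³ ∫ (k ⊗ k) P(|k|) e^{i k·q} d³k`
(the sine part of the integrand is odd in `k` and integrates to zero). -/
def Cpp (P : ℝ → ℝ) (q : E3) : Matrix (Fin 3) (Fin 3) ℝ :=
  Matrix.of fun i j =>
    1 / (2 * Real.pi) ^ 3 * ∫ k : E3, k i * k j * P ‖k‖ * Real.cos (inner ℝ k q)

/-- The exponent `Q = σ₁² k² g² / 3`. -/
def Qexp (P : ℝ → ℝ) (g : ℝ) (k : E3) : ℝ := sigmaSq P 1 / 3 * ‖k‖ ^ 2 * g ^ 2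

/-- The kernel `e^{g² kᵀ Ĉ(q) k} - 1`. -/
def kernel (P : ℝ → ℝ) (g : ℝ) (k q : E3) : ℝ :=
  Real.exp (g ^ 2 * (k.ofLp ⬝ᵥ (Cpp P q *ᵥ k.ofLp))) - 1

/-- `e^{-Q} ∫ e^{-ε|q|²} (e^{g² kᵀ Ĉ(q) k} - 1) e^{i k·q} d³q`. -/
def regularizedSpectrum (P : ℝ → ℝ) (g : ℝ) (k : E3) (ε : ℝ) : ℂ :=
  (Real.exp (-Qexp P g k) : ℂ) *
    ∫ q : E3, (Real.exp (-ε * ‖q‖ ^ 2) : ℂ) * (kernel P g k q : ℂ) *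
      Complex.exp (Complex.I * (inner ℝ k q : ℝ))

/-- The free power spectrum `𝒫(k) = e^{-Q} ∫ (e^{g² kᵀ Ĉ(q) k} - 1) e^{i k·q} d³q`.
The kernel is in general square integrable but not integrable over `ℝ³`, so this Fourier integral
is understood as the limit `ε → 0⁺` of the integral with the factor `e^{-ε|q|²}`. For an integrable
kernel it is the Lebesgue integral, see `freePowerSpectrum_of_integrable`. -/
def freePowerSpectrum (P : ℝ → ℝ) (g : ℝ) (k : E3) : ℝ :=
  (limUnder (𝓝[>] (0 : ℝ)) (regularizedSpectrum P g k)).re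

theorem tendsto_regularizedSpectrum_of_integrable (P : ℝ → ℝ) (g : ℝ) (k : E3)
    (h : Integrable (kernel P g k)) :
    Tendsto (regularizedSpectrum P g k) (𝓝[>] (0 : ℝ))
      (𝓝 ((Real.exp (-Qexp P g k) : ℂ) *
        ∫ q : E3, (kernel P g k q : ℂ) * Complex.exp (Complex.I * (inner ℝ k q : ℝ)))) := by
  unfold regularizedSpectrum
  refine Tendsto.const_mul _ ?_
  have hc : Continuous fun q : E3 => Complex.exp (Complex.I * (inner ℝ k q : ℝ)) := by fun_prop
  refine tendsto_integral_filter_of_dominated_convergence (fun q => ‖kernel P g k q‖) ?_ ?_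
    h.norm ?_
  · refine Eventually.of_forall fun ε => ?_
    have he : Continuous fun q : E3 => (Real.exp (-ε * ‖q‖ ^ 2) : ℂ) := by fun_prop
    exact (he.aestronglyMeasurable.mul h.ofReal.aestronglyMeasurable).mul
      hc.aestronglyMeasurable
  · filter_upwards [self_mem_nhdsWithin] with ε hε
    refine Eventually.of_forall fun q => ?_
    have h1 : ‖Complex.exp (Complex.I * (inner ℝ k q : ℝ))‖ = 1 := by
      rw [mul_comm]; exact Complex.norm_exp_ofReal_mul_I _
    have h2 : Real.exp (-ε * ‖q‖ ^ 2) ≤ 1 := by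
      rw [Real.exp_le_one_iff]
      have : (0 : ℝ) < ε := hε
      nlinarith [sq_nonneg ‖q‖]
    rw [norm_mul, norm_mul, h1, mul_one, Complex.norm_real, Complex.norm_real,
      Real.norm_of_nonneg (Real.exp_pos _).le]
    exact mul_le_of_le_one_left (norm_nonneg _) h2
  · refine Eventually.of_forall fun q => ?_
    have hcont : Continuous fun ε : ℝ => (Real.exp (-ε * ‖q‖ ^ 2) : ℂ) * (kernel P g k q : ℂ) *
        Complex.exp (Complex.I * (inner ℝ k q : ℝ)) := by fun_prop
    have := (hcont.tendsto 0).mono_left (nhdsWithin_le_nhds (s := Set.Ioi 0))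
    simpa using this

theorem freePowerSpectrum_of_integrable (P : ℝ → ℝ) (g : ℝ) (k : E3)
    (h : Integrable (kernel P g k)) :
    freePowerSpectrum P g k = ((Real.exp (-Qexp P g k) : ℂ) *
      ∫ q : E3, (kernel P g k q : ℂ) * Complex.exp (Complex.I * (inner ℝ k q : ℝ))).re := by
  rw [freePowerSpectrum, (tendsto_regularizedSpectrum_of_integrable P g k h).limUnder_eq]

/-- The auto-correlation function `(2π)⁻³ ∫ P(|k|) e^{i k·q} d³k` of the velocity potential at
distance `q` (taken along the third axis), normalised to vanish at `q = 0` by subtracting the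
constant `σ₀²`, which may be infinite. Only its derivatives are used, so the constant plays no
role. -/
def xi (P : ℝ → ℝ) (q : ℝ) : ℝ :=
  1 / (2 * Real.pi) ^ 3 *
    ∫ k : E3, P ‖k‖ * (Real.cos (inner ℝ k (q • EuclideanSpace.single (2 : Fin 3) (1 : ℝ))) - 1)

/-- `a₁(q) = ξ'(q) / q`. -/
def a1 (P : ℝ → ℝ) (q : ℝ) : ℝ := deriv (xi P) q / q

/-- `a₂(q) = ξ''(q) - a₁(q)`. -/
def a2 (P : ℝ → ℝ) (q : ℝ) : ℝ := iteratedDeriv 2 (xi P) q - a1 P q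

/-- `R(x, y) = (x² / g²) / a₂(x) · y / (1 + y)`. -/
def Rfun (P : ℝ → ℝ) (g x y : ℝ) : ℝ := x ^ 2 / g ^ 2 / a2 P x * (y / (1 + y))

/-- `y₀(x) = a₂(x) / (a₁(x) + σ₁² / 3)`. -/
def y0 (P : ℝ → ℝ) (x : ℝ) : ℝ := a2 P x / (a1 P x + sigmaSq P 1 / 3)

/-- The function of `x` in braces whose `2m`-th derivative at `0` gives the `m`-th coefficient. -/
def coeffFun (P : ℝ → ℝ) (g : ℝ) (m : ℕ) (x : ℝ) : ℝ :=
  (x ^ 2 / g ^ 2 / (a1 P x + sigmaSq P 1 / 3)) ^ (m + 1) *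
    iteratedDeriv m
      (fun y => y ^ m * √(Rfun P g x y) / Real.exp (Rfun P g x y / 4)) (y0 P x)

/-- `𝒫⁽ᵐ⁾ = π^{3/2} / (2m)! · lim_{x → 0} (d/dx)^{2m} { … }`. -/
def coeff (P : ℝ → ℝ) (g : ℝ) (m : ℕ) : ℝ :=
  Real.pi ^ (3 / 2 : ℝ) / ((2 * m)! : ℝ) *
    limUnder (𝓝[≠] (0 : ℝ)) (iteratedDeriv (2 * m) (coeffFun P g m))

end FreePower

end

/-! The proof is Laplace's method at `q = 0`, after isotropy has reduced everything to two radial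
functions. The form `kᵀ Ĉ(q) k` is minus a second directional derivative of `ξ(|q|)`. Hence `Q - g²
kᵀ Ĉ(q) k = g² (T (k²q² - (q·k)²) + L (q·k)²)` at `|q|`, where `q² T = a₁ + σ₁²/3` and `q² L = ξ'' +
σ₁²/3` (`quadForm_sub`). Written as averages of `ξ''''`, the functions `T` and `L` are smooth, even
and positive, and their derivatives at `0` are explicit multiples of the moments.

Existence of the spectrum: split `e^u - 1 = u + (e^u - 1 - u)` with `u = g² kᵀ Ĉ k`. The linear part
is a Fourier transform, and Gaussian-regularised inversion returns `g² k⁴ P(k)`. The remainder is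
`O(u²)` for fixed `k`, and `u` is square integrable by Plancherel, so it is integrable
(`tendsto_regularizedSpectrum`). Multiplied by `e^{-Q}`, the linear part is exponentially small
because `P` is bounded at infinity. By Riemann-Lebesgue and compactness the exponent is at most `-c
k²` for `|q| ≥ 1`, so only the unit ball matters (`exists_spectrumValue_bound`).

There, rotate `k` to the third axis and put `q = x/k`. The integrand becomes `cos z · G(x, |x|/k)`
with `G(x, r) = exp(-g² (T(r) ρ² + L(r) z²))`, where `ρ² = x₀² + x₁²` and `z = x₂`. A Taylor
expansion in `r`, where odd orders vanish, has Gaussian-dominated remainders and gives the series in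
`k⁻²` with coefficients `(1/(2m)!) ∫ |x|^{2m} cos z ∂_r^{2m} G(x,0) dx`
(`exists_scaled_integral_bound`).

These are the stated coefficients: for small `r ≠ 0` the function in braces equals `π^{-3/2} ∫
|x|^{2m} cos z G(x,r) dx`, since the `y`-derivatives are derivatives in the coefficient `a` of
`|x|²` under the substitution `y = c/a` (`iteratedDeriv_yFun`, `coeffFun_eq`).

Finally, the top derivative of an exponent enters the corresponding derivative of its exponential
linearly. So `σ²_{m+3}` multiplies a Gaussian moment at `r = 0`, where the quadratic form is `a (ρ²
+ 3z²)` with `1/(12a) = Σ`. Such a moment is a power of `a` times `e^{-Σ}` and a polynomial in `Σ`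
with positive constant term, hence a nonzero one (`coeffIntegral_succ`, `hasPolyMoment_topWeight`).
-/

noncomputable section

namespace FreePower

/-! ### Smooth functions with bounded derivatives, and their superpositions -/

section BoundedSmooth

open scoped ContDiff

/-- Smooth functions on the line all of whose derivatives are bounded. -/
structure BddSmooth (f : ℝ → ℝ) : Prop where
  smooth : ContDiff ℝ ∞ f
  bdd : ∀ n : ℕ, ∃ C, ∀ q, |iteratedDeriv n f q| ≤ C

theorem BddSmooth.deriv_bddSmooth {f : ℝ → ℝ} (hf : BddSmooth f) : BddSmooth (deriv f) where
  smooth := ((contDiff_succ_iff_deriv (n := ∞)).1 hf.smooth).2.2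
  bdd n := by simpa only [iteratedDeriv_succ'] using hf.bdd (n + 1)

theorem BddSmooth.iteratedDeriv_bddSmooth {f : ℝ → ℝ} (hf : BddSmooth f) (n : ℕ) :
    BddSmooth (iteratedDeriv n f) := by
  induction n with
  | zero => simpa using hf
  | succ n ih => rw [iteratedDeriv_succ]; exact ih.deriv_bddSmooth

theorem bddSmooth_cos : BddSmooth Real.cos where
  smooth := Real.contDiff_cos
  bdd n := ⟨1, fun q => by
    obtain ⟨m, rfl | rfl⟩ := Nat.even_or_odd' n
    · simp [abs_mul, Real.abs_cos_le_one]
    · simp [abs_mul, Real.abs_sin_le_one]⟩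

section Superposition

variable {Ω : Type*} [MeasurableSpace Ω] {μ : Measure Ω} {w Y : Ω → ℝ} {f : ℝ → ℝ}

theorem BddSmooth.integrable_comp_mul (hf : BddSmooth f) (hY : AEStronglyMeasurable Y μ)
    (hw : Integrable w μ) (q : ℝ) : Integrable (fun x => w x * f (q * Y x)) μ := by
  obtain ⟨C, hC⟩ := hf.bdd 0
  refine hw.mul_bdd (c := C) ?_ (Eventually.of_forall fun x => by simpa using hC (q * Y x))
  exact hf.smooth.continuous.comp_aestronglyMeasurable (hY.const_mul q)

theorem BddSmooth.hasDerivAt_superposition (hf : BddSmooth f) (hY : AEStronglyMeasurable Y μ)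
    (hw : Integrable w μ) (hwY : Integrable (fun x => w x * Y x) μ) (q : ℝ) :
    HasDerivAt (fun q => ∫ x, w x * f (q * Y x) ∂μ)
      (∫ x, w x * Y x * deriv f (q * Y x) ∂μ) q := by
  obtain ⟨C, hC⟩ := hf.bdd 1
  refine (hasDerivAt_integral_of_dominated_loc_of_deriv_le (s := Set.univ)
    (F := fun q x => w x * f (q * Y x))
    (F' := fun q x => w x * Y x * deriv f (q * Y x))
    (bound := fun x => C * |w x * Y x|) univ_mem ?_ (hf.integrable_comp_mul hY hw q) ?_ ?_ ?_ ?_).2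
  · exact Eventually.of_forall fun q => (hf.integrable_comp_mul hY hw q).aestronglyMeasurable
  · exact (hf.deriv_bddSmooth.integrable_comp_mul hY hwY q).aestronglyMeasurable
  · refine Eventually.of_forall fun x q _ => ?_
    rw [Real.norm_eq_abs, abs_mul, mul_comm C]
    exact mul_le_mul_of_nonneg_left (by simpa using hC (q * Y x)) (abs_nonneg _)
  · exact hwY.abs.const_mul C
  · refine Eventually.of_forall fun x q _ => ?_
    have h1 : HasDerivAt f (deriv f (q * Y x)) (q * Y x) :=
      (hf.smooth.differentiable (by simp) _).hasDerivAt
    have h2 : HasDerivAt (fun q => q * Y x) (Y x) q := by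
      simpa using (hasDerivAt_id q).mul_const (Y x)
    have := (h1.comp q h2).const_mul (w x)
    refine this.congr_deriv (by ring)

/-- Each differentiation in `q` brings down one factor `Y`. Boundedness of the derivatives of `f`
leaves the integrable function `w Yʲ` as dominating function, so integrability of all moments of `w`
is all that is needed. -/
theorem BddSmooth.iteratedDeriv_superposition (hf : BddSmooth f) (hY : AEStronglyMeasurable Y μ)
    (hw : ∀ j : ℕ, Integrable (fun x => w x * Y x ^ j) μ) (n : ℕ) :
    iteratedDeriv n (fun q => ∫ x, w x * f (q * Y x) ∂μ) =
      fun q => ∫ x, w x * Y x ^ n * iteratedDeriv n f (q * Y x) ∂μ := by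
  induction n with
  | zero => simp
  | succ n ih =>
    rw [iteratedDeriv_succ, ih]
    funext q
    rw [((hf.iteratedDeriv_bddSmooth n).hasDerivAt_superposition hY (hw n) ?_ q).deriv]
    · simp only [iteratedDeriv_succ, pow_succ, mul_assoc]
    · simpa only [pow_succ, mul_assoc] using hw (n + 1)

theorem BddSmooth.superposition (hf : BddSmooth f) (hY : AEStronglyMeasurable Y μ)
    (hw : ∀ j : ℕ, Integrable (fun x => w x * Y x ^ j) μ) :
    BddSmooth (fun q => ∫ x, w x * f (q * Y x) ∂μ) where
  smooth := by
    refine contDiff_of_differentiable_iteratedDeriv fun n _ => ?_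
    rw [hf.iteratedDeriv_superposition hY hw]
    intro q
    refine ((hf.iteratedDeriv_bddSmooth n).hasDerivAt_superposition hY (hw n) ?_ q).differentiableAt
    simpa only [pow_succ, mul_assoc] using hw (n + 1)
  bdd n := by
    obtain ⟨C, hC⟩ := hf.bdd n
    refine ⟨∫ x, |w x * Y x ^ n| * C ∂μ, fun q => ?_⟩
    rw [hf.iteratedDeriv_superposition hY hw, ← Real.norm_eq_abs]
    refine norm_integral_le_of_norm_le ((hw n).abs.mul_const C) (Eventually.of_forall fun x => ?_)
    rw [Real.norm_eq_abs, abs_mul]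
    exact mul_le_mul_of_nonneg_left (hC _) (abs_nonneg _)

end Superposition

/-- The weighted average `∫₀¹ w(τ) f(τ q) dτ`. -/
theorem BddSmooth.average {f w : ℝ → ℝ} (hf : BddSmooth f) (hw : Continuous w) :
    BddSmooth (fun q => ∫ s in (0 : ℝ)..1, w s * f (q * s)) := by
  simp only [intervalIntegral.integral_of_le zero_le_one]
  refine hf.superposition (Y := fun s => s) (by fun_prop) fun j => ?_
  exact ((hw.mul (continuous_pow j)).integrableOn_Icc).mono_set Set.Ioc_subset_Icc_self

theorem BddSmooth.iteratedDeriv_average {f w : ℝ → ℝ} (hf : BddSmooth f) (hw : Continuous w)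
    (n : ℕ) : iteratedDeriv n (fun q => ∫ s in (0 : ℝ)..1, w s * f (q * s)) 0 =
      (∫ s in (0 : ℝ)..1, w s * s ^ n) * iteratedDeriv n f 0 := by
  simp only [intervalIntegral.integral_of_le zero_le_one]
  rw [hf.iteratedDeriv_superposition (Y := fun s => s) (by fun_prop) fun j => ?_]
  · simp [integral_mul_const]
  · exact ((hw.mul (continuous_pow j)).integrableOn_Icc).mono_set Set.Ioc_subset_Icc_self

end BoundedSmooth

/-! ### Derivatives of the potential correlation along lines -/

section PotentialCorrelation

open scoped ContDiff

/-- The spectral density `(2π)⁻³ P(|p|)` on wave-vector space. -/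
def dens (P : ℝ → ℝ) (p : E3) : ℝ := 1 / (2 * Real.pi) ^ 3 * P ‖p‖

section Spectrum

variable {P : ℝ → ℝ}

theorem IsInitialSpectrum.integrable_norm_pow_even (hP : IsInitialSpectrum P) {n : ℕ}
    (hn : 1 ≤ n) : Integrable (fun p : E3 => ‖p‖ ^ (2 * n) * P ‖p‖) := by
  have h := (integrable_fun_norm_addHaar (volume : Measure E3)
    (f := fun y => y ^ (2 * n) * P y)).2 ?_
  · exact h
  · refine (hP.moments n hn).congr_fun (fun y _ => ?_) measurableSet_Ioi
    simp only [finrank_euclideanSpace, Fintype.card_fin, smul_eq_mul]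
    ring

theorem IsInitialSpectrum.continuousAt_norm (hP : IsInitialSpectrum P) {p : E3} (hp : p ≠ 0) :
    ContinuousAt (fun p : E3 => P ‖p‖) p :=
  (hP.continuousOn.continuousAt (Ioi_mem_nhds (norm_pos_iff.2 hp))).comp
    (f := fun p : E3 => ‖p‖) continuous_norm.continuousAt

theorem ae_ne_zero : ∀ᵐ p : E3, p ≠ 0 := by
  simpa using Measure.ae_ne (volume : Measure E3) 0

theorem IsInitialSpectrum.dens_nonneg (hP : IsInitialSpectrum P) : ∀ᵐ p : E3, 0 ≤ dens P p := by
  filter_upwards [ae_ne_zero] with p hp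
  have := hP.nonneg _ (norm_pos_iff.2 hp)
  unfold dens
  positivity

theorem IsInitialSpectrum.aestronglyMeasurable_dens (hP : IsInitialSpectrum P) :
    AEStronglyMeasurable (dens P) (volume : Measure E3) := by
  refine AEStronglyMeasurable.const_mul (f := fun p : E3 => P ‖p‖) ?_ _
  rw [← restrict_compl_singleton (μ := (volume : Measure E3)) 0]
  refine ContinuousOn.aestronglyMeasurable (fun p hp => ?_) (measurableSet_singleton _).compl
  exact (hP.continuousAt_norm hp).continuousWithinAt

theorem IsInitialSpectrum.integrable_dens_norm_pow (hP : IsInitialSpectrum P) {n : ℕ}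
    (hn : 2 ≤ n) : Integrable (fun p : E3 => dens P p * ‖p‖ ^ n) := by
  have h1 := (hP.integrable_norm_pow_even (le_refl 1)).const_mul (1 / (2 * Real.pi) ^ 3)
  have h2 := (hP.integrable_norm_pow_even (n := n) (by omega)).const_mul (1 / (2 * Real.pi) ^ 3)
  refine (h1.add h2).mono' (hP.aestronglyMeasurable_dens.mul (by fun_prop)) ?_
  filter_upwards [hP.dens_nonneg] with p hp
  -- The hypotheses control even moments only, and not `σ₀²`; every power with `n ≥ 2` lies between
  -- the exponents `2` and `2n`.
  have h3 : ‖p‖ ^ n ≤ ‖p‖ ^ 2 + ‖p‖ ^ (2 * n) := by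
    rcases le_total ‖p‖ 1 with h | h
    · exact (pow_le_pow_of_le_one (norm_nonneg _) h hn).trans (le_add_of_nonneg_right (by positivity))
    · exact (pow_le_pow_right₀ h (by omega)).trans (le_add_of_nonneg_left (by positivity))
  rw [Real.norm_of_nonneg (by positivity)]
  refine (mul_le_mul_of_nonneg_left h3 hp).trans (le_of_eq ?_)
  simp only [dens, Pi.add_apply]
  ring

theorem IsInitialSpectrum.integrable_dens_mul (hP : IsInitialSpectrum P) {n : ℕ}
    (hn : 2 ≤ n) {h : E3 → ℝ} (hm : Continuous h) {C : ℝ}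
    (hh : ∀ p, |h p| ≤ C * ‖p‖ ^ n) : Integrable (fun p : E3 => dens P p * h p) := by
  refine ((hP.integrable_dens_norm_pow hn).const_mul C).mono'
    (hP.aestronglyMeasurable_dens.mul hm.aestronglyMeasurable) ?_
  filter_upwards [hP.dens_nonneg] with p hp
  rw [norm_mul, Real.norm_of_nonneg hp, Real.norm_eq_abs]
  nlinarith [mul_le_mul_of_nonneg_left (hh p) hp]

theorem abs_coord_le (p : E3) (i : Fin 3) : |p i| ≤ ‖p‖ := by
  simpa using PiLp.norm_apply_le p i

theorem IsInitialSpectrum.integrable_dens_coord_pow (hP : IsInitialSpectrum P) {n : ℕ}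
    (hn : 2 ≤ n) (i : Fin 3) : Integrable (fun p : E3 => dens P p * p i ^ n) := by
  refine hP.integrable_dens_mul hn (by fun_prop) (C := 1) fun p => ?_
  rw [one_mul, abs_pow]
  exact pow_le_pow_left₀ (abs_nonneg _) (abs_coord_le p i) n

theorem abs_cos_sub_one_le (x : ℝ) : |Real.cos x - 1| ≤ x ^ 2 := by
  have h1 := Real.one_sub_sq_div_two_le_cos (x := x)
  have h2 := Real.cos_le_one x
  rw [abs_le]
  constructor <;> nlinarith [sq_nonneg x]

theorem abs_inner_mul_le (p u : E3) : |inner ℝ p u| ≤ ‖p‖ * ‖u‖ := abs_real_inner_le_norm p u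

/-- The derivative of the three-dimensional auto-correlation function along a line. -/
theorem IsInitialSpectrum.hasDerivAt_correlation (hP : IsInitialSpectrum P) (v u : E3) (t : ℝ) :
    HasDerivAt (fun t : ℝ => ∫ p : E3, dens P p * (Real.cos (inner ℝ p (v + t • u)) - 1))
      (∫ p : E3, dens P p * (-(inner ℝ p u * Real.sin (inner ℝ p (v + t • u))))) t := by
  have hint : ∀ t : ℝ, Integrable fun p : E3 =>
      dens P p * (Real.cos (inner ℝ p (v + t • u)) - 1) := fun t => by
    refine hP.integrable_dens_mul le_rfl (by fun_prop) (C := ‖v + t • u‖ ^ 2) fun p => ?_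
    refine (abs_cos_sub_one_le _).trans ?_
    rw [← sq_abs, ← mul_pow, mul_comm]
    exact pow_le_pow_left₀ (abs_nonneg _) (abs_inner_mul_le _ _) 2
  -- Since `σ₀²` may be infinite, `P` is integrable only against `|p|²` or more. One factor `|p|`
  -- comes from the derivative and the other from `|sin x| ≤ |x|`, which is why the bound is local
  -- in `t`.
  have key : ∀ s ∈ Metric.ball t 1, ∀ p : E3,
      |-(inner ℝ p u * Real.sin (inner ℝ p (v + s • u)))| ≤
        (‖u‖ * (‖v‖ + (|t| + 1) * ‖u‖)) * ‖p‖ ^ 2 := by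
    intro s hs p
    rw [abs_neg, abs_mul]
    have h1 : |Real.sin (inner ℝ p (v + s • u))| ≤ ‖p‖ * (‖v‖ + (|t| + 1) * ‖u‖) := by
      refine (Real.abs_sin_le_abs).trans ((abs_inner_mul_le _ _).trans ?_)
      refine mul_le_mul_of_nonneg_left ((norm_add_le _ _).trans ?_) (norm_nonneg _)
      rw [norm_smul, Real.norm_eq_abs]
      have h2 : |s| ≤ |t| + 1 := by
        have h3 : |s - t| < 1 := hs
        have h4 := abs_sub_abs_le_abs_sub s t
        linarith
      gcongr
    calc _ ≤ (‖p‖ * ‖u‖) * (‖p‖ * (‖v‖ + (|t| + 1) * ‖u‖)) :=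
          mul_le_mul (abs_inner_mul_le _ _) h1 (abs_nonneg _) (by positivity)
      _ = _ := by ring
  refine (hasDerivAt_integral_of_dominated_loc_of_deriv_le (s := Metric.ball t 1)
    (F := fun (t : ℝ) (p : E3) => dens P p * (Real.cos (inner ℝ p (v + t • u)) - 1))
    (F' := fun (t : ℝ) (p : E3) =>
      dens P p * (-(inner ℝ p u * Real.sin (inner ℝ p (v + t • u)))))
    (bound := fun p => (‖u‖ * (‖v‖ + (|t| + 1) * ‖u‖)) * (dens P p * ‖p‖ ^ 2))
    (Metric.ball_mem_nhds t one_pos) ?_ (hint t) ?_ ?_ ?_ ?_).2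
  · exact Eventually.of_forall fun q => (hint q).aestronglyMeasurable
  · exact hP.aestronglyMeasurable_dens.mul (Continuous.aestronglyMeasurable (by fun_prop))
  · filter_upwards [hP.dens_nonneg] with p hp s hs
    rw [norm_mul, Real.norm_of_nonneg hp, Real.norm_eq_abs]
    nlinarith [mul_le_mul_of_nonneg_left (key s hs p) hp]
  · exact (hP.integrable_dens_norm_pow le_rfl).const_mul _
  · refine Eventually.of_forall fun p s _ => ?_
    have h2 : HasDerivAt (fun s : ℝ => inner ℝ p (v + s • u)) (inner ℝ p u) s := by
      simp only [inner_add_right, inner_smul_right]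
      simpa using ((hasDerivAt_id s).mul_const (inner ℝ p u)).const_add (inner ℝ p v)
    exact (((h2.cos).sub_const 1).const_mul (dens P p)).congr_deriv (by ring)

/-- The second derivative of the three-dimensional auto-correlation function along a line. -/
theorem IsInitialSpectrum.hasDerivAt_correlation_deriv (hP : IsInitialSpectrum P) (v u : E3)
    (t : ℝ) : HasDerivAt
      (fun t : ℝ => ∫ p : E3, dens P p * (-(inner ℝ p u * Real.sin (inner ℝ p (v + t • u)))))
      (∫ p : E3, dens P p * (-((inner ℝ p u) ^ 2 * Real.cos (inner ℝ p (v + t • u))))) t := by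
  have key : ∀ (s : ℝ) (p : E3),
      |-((inner ℝ p u) ^ 2 * Real.cos (inner ℝ p (v + s • u)))| ≤ ‖u‖ ^ 2 * ‖p‖ ^ 2 := by
    intro s p
    rw [abs_neg, abs_mul, abs_pow, ← mul_pow, mul_comm ‖u‖]
    calc _ ≤ |inner ℝ p u| ^ 2 * 1 :=
          mul_le_mul_of_nonneg_left (Real.abs_cos_le_one _) (by positivity)
      _ ≤ _ := by
          rw [mul_one]
          exact pow_le_pow_left₀ (abs_nonneg _) (abs_inner_mul_le _ _) 2
  have hint : ∀ t : ℝ, Integrable fun p : E3 =>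
      dens P p * (-(inner ℝ p u * Real.sin (inner ℝ p (v + t • u)))) := fun t => by
    refine hP.integrable_dens_mul le_rfl (by fun_prop) (C := ‖u‖ * ‖v + t • u‖) fun p => ?_
    rw [abs_neg, abs_mul]
    calc _ ≤ (‖p‖ * ‖u‖) * (‖p‖ * ‖v + t • u‖) :=
          mul_le_mul (abs_inner_mul_le _ _) ((Real.abs_sin_le_abs).trans (abs_inner_mul_le _ _))
            (abs_nonneg _) (by positivity)
      _ = _ := by ring
  refine (hasDerivAt_integral_of_dominated_loc_of_deriv_le (s := Set.univ)
    (F := fun (t : ℝ) (p : E3) => dens P p * (-(inner ℝ p u * Real.sin (inner ℝ p (v + t • u)))))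
    (F' := fun (t : ℝ) (p : E3) =>
      dens P p * (-((inner ℝ p u) ^ 2 * Real.cos (inner ℝ p (v + t • u)))))
    (bound := fun p => ‖u‖ ^ 2 * (dens P p * ‖p‖ ^ 2)) univ_mem ?_ (hint t) ?_ ?_ ?_ ?_).2
  · exact Eventually.of_forall fun q => (hint q).aestronglyMeasurable
  · exact hP.aestronglyMeasurable_dens.mul (Continuous.aestronglyMeasurable (by fun_prop))
  · filter_upwards [hP.dens_nonneg] with p hp s hs
    rw [norm_mul, Real.norm_of_nonneg hp, Real.norm_eq_abs]
    nlinarith [mul_le_mul_of_nonneg_left (key s p) hp]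
  · exact (hP.integrable_dens_norm_pow le_rfl).const_mul _
  · refine Eventually.of_forall fun p s _ => ?_
    have h2 : HasDerivAt (fun s : ℝ => inner ℝ p (v + s • u)) (inner ℝ p u) s := by
      simp only [inner_add_right, inner_smul_right]
      simpa using ((hasDerivAt_id s).mul_const (inner ℝ p u)).const_add (inner ℝ p v)
    exact (((h2.sin).const_mul (inner ℝ p u)).neg.const_mul (dens P p)).congr_deriv (by ring)

/-- The third unit vector. -/
def ez : E3 := EuclideanSpace.single (2 : Fin 3) (1 : ℝ)

theorem inner_ez (p : E3) : inner ℝ p ez = p 2 := by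
  simp [ez, EuclideanSpace.inner_single_right]

theorem norm_ez : ‖ez‖ = 1 := by simp [ez]

theorem xi_eq (q : ℝ) :
    xi P q = ∫ p : E3, dens P p * (Real.cos (inner ℝ p (0 + q • ez)) - 1) := by
  simp only [xi, dens, zero_add, mul_assoc, ez]
  rw [integral_const_mul]

theorem IsInitialSpectrum.hasDerivAt_xi (hP : IsInitialSpectrum P) (q : ℝ) :
    HasDerivAt (xi P) (∫ p : E3, dens P p * (-(p 2 * Real.sin (q * p 2)))) q := by
  have h := hP.hasDerivAt_correlation 0 ez q
  simp only [← xi_eq] at h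
  simpa only [zero_add, inner_smul_right, inner_ez] using h

theorem IsInitialSpectrum.hasDerivAt_deriv_xi (hP : IsInitialSpectrum P) (q : ℝ) :
    HasDerivAt (deriv (xi P)) (∫ p : E3, dens P p * (-(p 2 ^ 2 * Real.cos (q * p 2)))) q := by
  have h := hP.hasDerivAt_correlation_deriv 0 ez q
  have h2 : deriv (xi P) = fun q => ∫ p : E3, dens P p * (-(p 2 * Real.sin (q * p 2))) :=
    funext fun q => (hP.hasDerivAt_xi q).deriv
  rw [h2]
  simpa only [zero_add, inner_smul_right, inner_ez] using h

end Spectrum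

end PotentialCorrelation

/-! ### Isotropy: gradient and Hessian in radial form -/

section Isotropy

variable {P : ℝ → ℝ}

theorem exists_linearIsometryEquiv_apply_eq {v w : E3} (h : ‖v‖ = ‖w‖) :
    ∃ R : E3 ≃ₗᵢ[ℝ] E3, R v = w :=
  ⟨(Submodule.span ℝ {v - w})ᗮ.reflection, Submodule.reflection_sub h⟩

theorem integral_comp_linearIsometryEquiv {G : Type*} [NormedAddCommGroup G] [NormedSpace ℝ G]
    (R : E3 ≃ₗᵢ[ℝ] E3) (f : E3 → G) :
    ∫ p, f (R p) = ∫ p, f p :=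
  R.measurePreserving.integral_comp R.toHomeomorph.measurableEmbedding f

/-- The density is invariant under isometries, and a reflection takes `v` to `‖v‖ • ez`. -/
theorem correlation_eq_xi_norm (v : E3) :
    ∫ p : E3, dens P p * (Real.cos (inner ℝ p v) - 1) = xi P ‖v‖ := by
  obtain ⟨R, hR⟩ := exists_linearIsometryEquiv_apply_eq (v := v) (w := ‖v‖ • ez)
    (by rw [norm_smul, norm_ez]; simp)
  rw [xi_eq, zero_add, ← hR, ← integral_comp_linearIsometryEquiv R fun p =>
    dens P p * (Real.cos (inner ℝ p (R v)) - 1)]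
  simp only [LinearIsometryEquiv.inner_map_map, dens, LinearIsometryEquiv.norm_map]

theorem hasDerivAt_norm_line {v u : E3} {t : ℝ} (h : v + t • u ≠ 0) :
    HasDerivAt (fun t : ℝ => ‖v + t • u‖) (inner ℝ (v + t • u) u / ‖v + t • u‖) t := by
  have h1 : HasDerivAt (fun t : ℝ => v + t • u) u t := by
    simpa using ((hasDerivAt_id t).smul_const u).const_add v
  have h2 := h1.norm_sq.sqrt (by simpa using h)
  simp only [Real.sqrt_sq (norm_nonneg _)] at h2
  exact h2.congr_deriv (by ring)

/-- The derivative of the correlation along `v + t u` is computed twice: under the integral, and by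
the chain rule for `ξ(‖v + t u‖)`. -/
theorem IsInitialSpectrum.gradient_correlation (hP : IsInitialSpectrum P) {v : E3} (hv : v ≠ 0)
    (u : E3) : ∫ p : E3, dens P p * (-(inner ℝ p u * Real.sin (inner ℝ p v))) =
      deriv (xi P) ‖v‖ * (inner ℝ v u / ‖v‖) := by
  have h1 := hP.hasDerivAt_correlation v u 0
  simp only [correlation_eq_xi_norm] at h1
  have h2 := hasDerivAt_norm_line (v := v) (u := u) (t := 0) (by simpa using hv)
  have h3 : HasDerivAt (xi P) (deriv (xi P) ‖v + (0 : ℝ) • u‖) ‖v + (0 : ℝ) • u‖ :=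
    (hP.hasDerivAt_xi _).differentiableAt.hasDerivAt
  have h4 := h1.unique (HasDerivAt.comp (h₂ := xi P) (h := fun t : ℝ => ‖v + t • u‖) (0 : ℝ) h3 h2)
  simpa using h4

/-- The Hessian of the auto-correlation function in terms of its radial derivatives. -/
theorem IsInitialSpectrum.hessian_correlation (hP : IsInitialSpectrum P) {v : E3} (hv : v ≠ 0)
    (u : E3) : ∫ p : E3, dens P p * (inner ℝ p u ^ 2 * Real.cos (inner ℝ p v)) =
      -(a1 P ‖v‖ * ‖u‖ ^ 2 + a2 P ‖v‖ * (inner ℝ v u / ‖v‖) ^ 2) := by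
  have h1 := hP.hasDerivAt_correlation_deriv v u 0
  -- The gradient formula needs a nonzero base point; it holds along the line near `t = 0`, so it
  -- can be differentiated once more.
  have hne : ∀ᶠ t : ℝ in 𝓝 0, v + t • u ≠ 0 := by
    have hc : ContinuousAt (fun t : ℝ => v + t • u) 0 := by fun_prop
    exact hc.eventually_ne (by simpa using hv)
  have h2 := h1.congr_of_eventuallyEq
    (f₁ := fun t : ℝ => deriv (xi P) ‖v + t • u‖ * (inner ℝ (v + t • u) u / ‖v + t • u‖))
    (by filter_upwards [hne] with t ht using (hP.gradient_correlation ht u).symm)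
  have h3 := hasDerivAt_norm_line (v := v) (u := u) (t := 0) (by simpa using hv)
  have h4 : HasDerivAt (deriv (xi P)) (deriv (deriv (xi P)) ‖v + (0 : ℝ) • u‖)
      ‖v + (0 : ℝ) • u‖ := (hP.hasDerivAt_deriv_xi _).differentiableAt.hasDerivAt
  have h5 : HasDerivAt (fun t : ℝ => inner ℝ (v + t • u) u) (‖u‖ ^ 2) 0 := by
    simp only [inner_add_left, inner_smul_left, real_inner_self_eq_norm_sq]
    simpa using ((hasDerivAt_id (0 : ℝ)).mul_const (‖u‖ ^ 2)).const_add (inner ℝ v u)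
  have h7 := HasDerivAt.comp (h₂ := deriv (xi P)) (h := fun t : ℝ => ‖v + t • u‖) (0 : ℝ) h4 h3
  have h6 := h2.unique (HasDerivAt.mul (c := fun t : ℝ => deriv (xi P) ‖v + t • u‖)
    (d := fun t : ℝ => inner ℝ (v + t • u) u / ‖v + t • u‖) h7 (h5.div h3 (by simpa using hv)))
  simp only [mul_neg, integral_neg, zero_smul, add_zero] at h6
  rw [← neg_inj, h6]
  have hr : ‖v‖ ≠ 0 := norm_ne_zero_iff.2 hv
  simp only [a2, a1, iteratedDeriv_succ, iteratedDeriv_zero]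
  field_simp
  ring

end Isotropy

/-! ### Spherical and Gaussian moments -/

section Moments

variable {P : ℝ → ℝ}

theorem integral_coord_prod (f g h : ℝ → ℝ) :
    ∫ p : E3, f (p 0) * g (p 1) * h (p 2) = (∫ x, f x) * (∫ x, g x) * ∫ x, h x := by
  have h1 := integral_fintype_prod_volume_eq_prod (𝕜 := ℝ) (ι := Fin 3) (E := fun _ => ℝ) ![f, g, h]
  have h2 := (PiLp.volume_preserving_ofLp (Fin 3)).integral_comp
    (MeasurableEquiv.toLp 2 (Fin 3 → ℝ)).symm.measurableEmbedding
    (fun x : Fin 3 → ℝ => ∏ i, (![f, g, h] : Fin 3 → ℝ → ℝ) i (x i))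
  rw [h1] at h2
  simpa [Fin.prod_univ_three] using h2

theorem integrable_coord_prod {f g h : ℝ → ℝ} (hf : Integrable f) (hg : Integrable g)
    (hh : Integrable h) : Integrable fun p : E3 => f (p 0) * g (p 1) * h (p 2) := by
  have h0 : ∀ i, Integrable ((![f, g, h] : Fin 3 → ℝ → ℝ) i) := by
    intro i
    fin_cases i
    exacts [hf, hg, hh]
  have h1 := Integrable.fintype_prod (𝕜 := ℝ) h0
  have h2 := (PiLp.volume_preserving_ofLp (Fin 3)).integrable_comp_of_integrable h1
  simpa [Fin.prod_univ_three, Function.comp_def] using h2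

theorem integrable_pow_mul_gaussian {a : ℝ} (ha : 0 < a) (n : ℕ) :
    Integrable fun x : ℝ => x ^ n * Real.exp (-(a * x ^ 2)) := by
  have h := integrable_rpow_mul_exp_neg_mul_sq ha (s := n) (by linarith [n.cast_nonneg (α := ℝ)])
  simpa [Real.rpow_natCast] using h

theorem integral_Ioi_pow_mul_gaussian {a : ℝ} (ha : 0 < a) (n : ℕ) :
    ∫ x in Set.Ioi (0 : ℝ), x ^ (2 * n) * Real.exp (-(a * x ^ 2)) =
      a ^ (-(n + 1 / 2 : ℝ)) * Real.Gamma (n + 1 / 2) / 2 := by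
  have h := integral_rpow_mul_exp_neg_mul_rpow (p := 2) (q := (2 * n : ℕ)) two_pos
    (by push_cast; linarith [n.cast_nonneg (α := ℝ)]) ha
  simp only [Real.rpow_natCast, Real.rpow_two] at h
  rw [← show ((((2 * n : ℕ) : ℝ) + 1) / 2) = n + 1 / 2 by push_cast; ring, ← neg_div]
  simp only [← neg_mul]
  rw [h]
  ring

theorem integral_pow_mul_gaussian {a : ℝ} (ha : 0 < a) (n : ℕ) :
    ∫ x : ℝ, x ^ (2 * n) * Real.exp (-(a * x ^ 2)) =
      a ^ (-(n + 1 / 2 : ℝ)) * Real.Gamma (n + 1 / 2) := by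
  have h := integral_comp_abs (f := fun x => x ^ (2 * n) * Real.exp (-(a * x ^ 2)))
  simp only [pow_mul, sq_abs] at h
  simp only [pow_mul]
  rw [h]
  simp only [← pow_mul]
  rw [integral_Ioi_pow_mul_gaussian ha]
  ring

/-- Integration of a power of a coordinate against a radial function. -/
theorem integral_coord_pow_mul_radial (m : ℕ) (f : ℝ → ℝ) :
    ∫ p : E3, p 2 ^ m * f ‖p‖ = (∫ x, (x : E3) 2 ^ m ∂(volume : Measure E3).toSphere) *
      ∫ y in Set.Ioi (0 : ℝ), y ^ (m + 2) * f y := by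
  calc ∫ p : E3, p 2 ^ m * f ‖p‖
      = ∫ x : ({(0)}ᶜ : Set E3), (x : E3) 2 ^ m * f ‖x.1‖ ∂((volume : Measure E3).comap (↑)) := by
        rw [integral_subtype_comap (measurableSet_singleton _).compl
          fun p : E3 => p 2 ^ m * f ‖p‖, restrict_compl_singleton]
    _ = ∫ x, ((x.1 : E3) 2 ^ m) * ((x.2 : ℝ) ^ m * f x.2)
          ∂(volume : Measure E3).toSphere.prod (.volumeIoiPow (Module.finrank ℝ E3 - 1)) := by
        rw [← (volume : Measure E3).measurePreserving_homeomorphUnitSphereProd.integral_comp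
          (Homeomorph.measurableEmbedding _)]
        -- In polar coordinates the third coordinate is the radius times that of the unit vector, so
        -- its power splits into an angular and a radial factor.
        refine integral_congr_ae (Eventually.of_forall fun x => ?_)
        have hx : ‖(x : E3)‖ ≠ 0 := norm_ne_zero_iff.2 x.2
        simp only [homeomorphUnitSphereProd_apply_snd_coe, homeomorphUnitSphereProd_apply_fst_coe,
          PiLp.smul_apply, smul_eq_mul, mul_pow, inv_pow]
        field_simp
    _ = (∫ x, (x : E3) 2 ^ m ∂(volume : Measure E3).toSphere) *
          ∫ y : Set.Ioi (0 : ℝ), (y : ℝ) ^ m * f y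
            ∂(.volumeIoiPow (Module.finrank ℝ E3 - 1)) := by
        exact integral_prod_mul (fun x : Metric.sphere (0 : E3) 1 => (x : E3) 2 ^ m)
          (fun y : Set.Ioi (0 : ℝ) => (y : ℝ) ^ m * f y)
    _ = _ := by
        congr 1
        simp only [Measure.volumeIoiPow, ENNReal.ofReal, finrank_euclideanSpace, Fintype.card_fin]
        rw [integral_withDensity_eq_integral_smul,
          integral_subtype_comap measurableSet_Ioi
            fun a => Real.toNNReal (a ^ (3 - 1)) • (a ^ m * f a)]
        · refine setIntegral_congr_fun measurableSet_Ioi fun x hx => ?_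
          simp only [NNReal.smul_def]
          rw [Real.coe_toNNReal _ (pow_nonneg (le_of_lt hx) _), smul_eq_mul]
          ring
        · exact (measurable_subtype_coe.pow_const _).real_toNNReal

/-- The integral of `z^{2n} e^{-|p|²}` is evaluated both in Cartesian and in polar coordinates. The
quotient of `Γ(n + 1/2)` by `Γ(n + 3/2)` gives the factor `1/(2n+1)`. -/
theorem sphere_moment (n : ℕ) :
    ∫ x, (x : E3) 2 ^ (2 * n) ∂(volume : Measure E3).toSphere = 4 * Real.pi / (2 * n + 1) := by
  have h1 := integral_coord_pow_mul_radial (2 * n) fun y => Real.exp (-(1 * y ^ 2))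
  have h2 := integral_coord_prod (fun x => Real.exp (-(1 * x ^ 2)))
    (fun x => Real.exp (-(1 * x ^ 2))) (fun x => x ^ (2 * n) * Real.exp (-(1 * x ^ 2)))
  have h3 := integral_pow_mul_gaussian one_pos 0
  have h4 : ∀ p : E3, Real.exp (-(1 * p 0 ^ 2)) * Real.exp (-(1 * p 1 ^ 2)) *
      (p 2 ^ (2 * n) * Real.exp (-(1 * p 2 ^ 2))) = p 2 ^ (2 * n) * Real.exp (-(1 * ‖p‖ ^ 2)) := by
    intro p
    rw [EuclideanSpace.norm_sq_eq, Fin.sum_univ_three]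
    simp only [Real.norm_eq_abs, sq_abs, mul_add, neg_add, Real.exp_add]
    ring
  simp only [h4] at h2
  rw [h2, show 2 * n + 2 = 2 * (n + 1) by ring, integral_Ioi_pow_mul_gaussian one_pos,
    integral_pow_mul_gaussian one_pos] at h1
  simp only [mul_zero, pow_zero, one_mul, Nat.cast_zero, zero_add, Real.one_rpow] at h3 h1
  simp only [h3, Real.Gamma_one_half_eq, Real.mul_self_sqrt Real.pi_pos.le,
    Nat.cast_add, Nat.cast_one] at h1
  rw [show (n : ℝ) + 1 + 1 / 2 = (n + 1 / 2) + 1 by ring,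
    Real.Gamma_add_one (by positivity)] at h1
  have h5 : Real.Gamma (n + 1 / 2) ≠ 0 := (Real.Gamma_pos_of_pos (by positivity)).ne'
  have h6 : Real.pi * Real.Gamma (n + 1 / 2) =
      ((∫ x, (x : E3) 2 ^ (2 * n) ∂(volume : Measure E3).toSphere) * (2 * n + 1) / 4) *
        Real.Gamma (n + 1 / 2) := by rw [h1]; ring
  have h7 := mul_right_cancel₀ h5 h6
  have h8 : (2 * n + 1 : ℝ) ≠ 0 := by positivity
  rw [eq_div_iff h8]
  linarith

/-- This turns derivatives of one-dimensional correlations at `0` into the moments `σₙ²`; `1/(2n+1)`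
is the mean of `z^{2n}` over the unit sphere. -/
theorem integral_dens_coord_pow (n : ℕ) :
    ∫ p : E3, dens P p * p 2 ^ (2 * n) = sigmaSq P n / (2 * n + 1) := by
  have h := integral_coord_pow_mul_radial (2 * n) P
  rw [sphere_moment] at h
  simp only [dens, sigmaSq, mul_assoc, mul_comm (P _)]
  rw [integral_const_mul, h]
  have := Real.pi_pos.ne'
  field_simp
  ring

end Moments

/-! ### The radial profiles: regularity, positivity and derivatives at zero -/

section Profiles

variable {P : ℝ → ℝ}

/-- `-ξ''`. -/
def secondCorr (P : ℝ → ℝ) (q : ℝ) : ℝ := ∫ p : E3, dens P p * p 2 ^ 2 * Real.cos (q * p 2)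

/-- `ξ''''`. -/
def fourthCorr (P : ℝ → ℝ) (q : ℝ) : ℝ := ∫ p : E3, dens P p * p 2 ^ 4 * Real.cos (q * p 2)

/-- The smooth function `(ξ''(q) + σ₁²/3) / q²`. -/
def longProfile (P : ℝ → ℝ) (q : ℝ) : ℝ := ∫ s in (0 : ℝ)..1, (1 - s) * fourthCorr P (q * s)

/-- The smooth function `(ξ'(q) / q + σ₁²/3) / q²`. -/
def transProfile (P : ℝ → ℝ) (q : ℝ) : ℝ := ∫ s in (0 : ℝ)..1, s ^ 2 * longProfile P (q * s)

theorem aestronglyMeasurable_coord (i : Fin 3) :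
    AEStronglyMeasurable (fun p : E3 => p i) (volume : Measure E3) :=
  Continuous.aestronglyMeasurable (by fun_prop)

theorem IsInitialSpectrum.integrable_dens_coord_pow_mul (hP : IsInitialSpectrum P) {n : ℕ}
    (hn : 2 ≤ n) (j : ℕ) : Integrable fun p : E3 => dens P p * p 2 ^ n * p 2 ^ j := by
  simpa only [mul_assoc, ← pow_add] using hP.integrable_dens_coord_pow (n := n + j) (by omega) 2

theorem IsInitialSpectrum.bddSmooth_secondCorr (hP : IsInitialSpectrum P) :
    BddSmooth (secondCorr P) :=
  bddSmooth_cos.superposition (aestronglyMeasurable_coord 2)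
    (hP.integrable_dens_coord_pow_mul le_rfl)

theorem IsInitialSpectrum.bddSmooth_fourthCorr (hP : IsInitialSpectrum P) :
    BddSmooth (fourthCorr P) :=
  bddSmooth_cos.superposition (aestronglyMeasurable_coord 2)
    (hP.integrable_dens_coord_pow_mul (by norm_num))

theorem IsInitialSpectrum.bddSmooth_longProfile (hP : IsInitialSpectrum P) :
    BddSmooth (longProfile P) :=
  hP.bddSmooth_fourthCorr.average (w := fun s => 1 - s) (by fun_prop)

theorem IsInitialSpectrum.bddSmooth_transProfile (hP : IsInitialSpectrum P) :
    BddSmooth (transProfile P) :=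
  hP.bddSmooth_longProfile.average (w := fun s => s ^ 2) (by fun_prop)

theorem IsInitialSpectrum.hasDerivAt_secondCorr (hP : IsInitialSpectrum P) (q : ℝ) :
    HasDerivAt (secondCorr P) (∫ p : E3, dens P p * p 2 ^ 3 * -Real.sin (q * p 2)) q := by
  have h := bddSmooth_cos.hasDerivAt_superposition (aestronglyMeasurable_coord 2)
    (hP.integrable_dens_coord_pow le_rfl 2)
    (by simpa using hP.integrable_dens_coord_pow_mul le_rfl 1) q
  refine h.congr_deriv ?_
  simp only [Real.deriv_cos', pow_succ, mul_assoc]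

theorem IsInitialSpectrum.hasDerivAt_deriv_secondCorr (hP : IsInitialSpectrum P) (q : ℝ) :
    HasDerivAt (deriv (secondCorr P)) (-fourthCorr P q) q := by
  have h1 : deriv (secondCorr P) = iteratedDeriv 1 (secondCorr P) := by simp
  have h2 : iteratedDeriv 2 (secondCorr P) q = -fourthCorr P q := by
    unfold secondCorr fourthCorr
    rw [bddSmooth_cos.iteratedDeriv_superposition (aestronglyMeasurable_coord 2)
      (hP.integrable_dens_coord_pow_mul le_rfl), ← integral_neg]
    refine integral_congr_ae (Eventually.of_forall fun p => ?_)
    have := Real.iteratedDeriv_even_cos 1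
    simp only [mul_one] at this
    simp only [this, Pi.mul_apply, Pi.pow_apply, Pi.neg_apply, Pi.one_apply]
    ring
  have h3 := ((hP.bddSmooth_secondCorr.iteratedDeriv_bddSmooth 1).smooth.differentiable
    (by simp) q).hasDerivAt
  rwa [← iteratedDeriv_succ, h2, ← h1] at h3

theorem secondCorr_zero : secondCorr P 0 = sigmaSq P 1 / 3 := by
  have h := integral_dens_coord_pow (P := P) 1
  simp only [mul_one, Nat.cast_one] at h
  simp only [secondCorr, zero_mul, Real.cos_zero, mul_one, h]
  norm_num

/-- Second-order Taylor formula with integral remainder for `-ξ''`, whose first derivative vanishes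
at `0` and whose second derivative is `-ξ''''`. -/
theorem IsInitialSpectrum.sq_mul_longProfile (hP : IsInitialSpectrum P) (q : ℝ) :
    q ^ 2 * longProfile P q = sigmaSq P 1 / 3 - secondCorr P q := by
  have h0 : deriv (secondCorr P) 0 = 0 := by rw [(hP.hasDerivAt_secondCorr 0).deriv]; simp
  -- The antiderivative in `s` is the one produced by integrating the remainder by parts.
  have key : ∀ s ∈ Set.uIcc (0 : ℝ) 1, HasDerivAt
      (fun s => -(1 - s) * q * deriv (secondCorr P) (q * s) - secondCorr P (q * s))
      (q ^ 2 * ((1 - s) * fourthCorr P (q * s))) s := by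
    intro s _
    have hq : HasDerivAt (fun s : ℝ => q * s) q s := by
      simpa using (hasDerivAt_id s).const_mul q
    have h1 := HasDerivAt.comp (h₂ := deriv (secondCorr P)) (h := fun s : ℝ => q * s) s
      (hP.hasDerivAt_deriv_secondCorr (q * s)) hq
    have h2 := HasDerivAt.comp (h₂ := secondCorr P) (h := fun s : ℝ => q * s) s
      (hP.hasDerivAt_secondCorr (q * s)).differentiableAt.hasDerivAt hq
    have h3 : HasDerivAt (fun s : ℝ => -(1 - s) * q) q s := by
      simpa using (((hasDerivAt_id s).const_sub 1).neg.mul_const q)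
    exact ((h3.mul h1).sub h2).congr_deriv (by simp only [Function.comp]; ring)
  have hint : IntervalIntegrable (fun s => q ^ 2 * ((1 - s) * fourthCorr P (q * s)))
      volume 0 1 := by
    have := hP.bddSmooth_fourthCorr.smooth.continuous
    exact Continuous.intervalIntegrable (by fun_prop) _ _
  have h := intervalIntegral.integral_eq_sub_of_hasDerivAt key hint
  rw [intervalIntegral.integral_const_mul] at h
  rw [longProfile, h, ← secondCorr_zero]
  simp [h0]
  ring

theorem IsInitialSpectrum.deriv_deriv_xi (hP : IsInitialSpectrum P) (q : ℝ) :
    deriv (deriv (xi P)) q = -secondCorr P q := by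
  rw [(hP.hasDerivAt_deriv_xi q).deriv, secondCorr, ← integral_neg]
  simp only [mul_neg, mul_assoc]

/-- Integration of `ξ''(r) + σ₁²/3 = r² L(r)` over `[0, q]`, with `r = q s`; `L` is `longProfile`.
-/
theorem IsInitialSpectrum.cube_mul_transProfile (hP : IsInitialSpectrum P) (q : ℝ) :
    q ^ 3 * transProfile P q = deriv (xi P) q + sigmaSq P 1 / 3 * q := by
  have h0 : deriv (xi P) 0 = 0 := by rw [(hP.hasDerivAt_xi 0).deriv]; simp
  have key : ∀ s ∈ Set.uIcc (0 : ℝ) 1, HasDerivAt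
      (fun s => deriv (xi P) (q * s) + sigmaSq P 1 / 3 * (q * s))
      (q ^ 3 * (s ^ 2 * longProfile P (q * s))) s := by
    intro s _
    have hq : HasDerivAt (fun s : ℝ => q * s) q s := by
      simpa using (hasDerivAt_id s).const_mul q
    have h1 := HasDerivAt.comp (h₂ := deriv (xi P)) (h := fun s : ℝ => q * s) s
      (hP.hasDerivAt_deriv_xi (q * s)).differentiableAt.hasDerivAt hq
    refine (h1.add (hq.const_mul (sigmaSq P 1 / 3))).congr_deriv ?_
    have h2 := hP.sq_mul_longProfile (q * s)
    rw [hP.deriv_deriv_xi]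
    linear_combination (-q) * h2
  have hint : IntervalIntegrable (fun s => q ^ 3 * (s ^ 2 * longProfile P (q * s)))
      volume 0 1 := by
    have := hP.bddSmooth_longProfile.smooth.continuous
    exact Continuous.intervalIntegrable (by fun_prop) _ _
  have h := intervalIntegral.integral_eq_sub_of_hasDerivAt key hint
  rw [intervalIntegral.integral_const_mul] at h
  rw [transProfile, h]
  simp [h0]

theorem IsInitialSpectrum.a1_add (hP : IsInitialSpectrum P) {q : ℝ} (hq : q ≠ 0) :
    a1 P q + sigmaSq P 1 / 3 = q ^ 2 * transProfile P q := by
  have := hP.cube_mul_transProfile q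
  rw [a1]
  field_simp
  linear_combination (-3) * this

/-- Together with `a1_add` this removes the apparent singularities: the ratios `x²/a₂` and `x²/(a₁ +
σ₁²/3)` in the coefficient formula are `1/(L - T)` and `1/T`. -/
theorem IsInitialSpectrum.a2_eq (hP : IsInitialSpectrum P) {q : ℝ} (hq : q ≠ 0) :
    a2 P q = q ^ 2 * (longProfile P q - transProfile P q) := by
  have h1 := hP.a1_add hq
  have h2 := hP.sq_mul_longProfile q
  rw [a2, iteratedDeriv_succ, iteratedDeriv_one, hP.deriv_deriv_xi]
  linear_combination -h1 - h2

/-- The difference is the integral of `dens · z² (1 - cos (q z)) ≥ 0`. It is positive because the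
integrand is continuous and nonzero at some point; all later positivity rests on this strict
inequality. -/
theorem IsInitialSpectrum.secondCorr_lt (hP : IsInitialSpectrum P) {q : ℝ} (hq : q ≠ 0) :
    secondCorr P q < sigmaSq P 1 / 3 := by
  rw [← secondCorr_zero, ← sub_pos, secondCorr, secondCorr]
  have hi : ∀ q, Integrable fun p : E3 => dens P p * p 2 ^ 2 * Real.cos (q * p 2) :=
    bddSmooth_cos.integrable_comp_mul (aestronglyMeasurable_coord 2)
      (hP.integrable_dens_coord_pow le_rfl 2)
  have hi2 : Integrable fun p : E3 => dens P p * p 2 ^ 2 * Real.cos (0 * p 2) -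
      dens P p * p 2 ^ 2 * Real.cos (q * p 2) := (hi 0).sub (hi q)
  rw [← integral_sub (hi 0) (hi q), integral_pos_iff_support_of_nonneg_ae _ hi2]
  · obtain ⟨k, hk, hPk⟩ := hP.exists_pos
    -- A point of norm `k` with `P k > 0` is sought whose third coordinate `h > 0` satisfies `|q h|
    -- < 2π`, so that `cos (q h) ≠ 1`; the choice `h ≤ 1/|q|` gives `|q h| ≤ 1`.
    obtain ⟨h, h0, h1, h2⟩ : ∃ h : ℝ, 0 < h ∧ h ≤ k ∧ |q * h| < 2 * Real.pi := by
      refine ⟨min k (1 / |q|), by positivity, min_le_left _ _, ?_⟩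
      rw [abs_mul, abs_of_pos (by positivity : (0 : ℝ) < min k (1 / |q|))]
      have h3 : |q| * min k (1 / |q|) ≤ |q| * (1 / |q|) :=
        mul_le_mul_of_nonneg_left (min_le_right _ _) (abs_nonneg _)
      rw [mul_one_div_cancel (abs_ne_zero.2 hq)] at h3
      linarith [Real.pi_gt_three]
    set p : E3 := !₂[√(k ^ 2 - h ^ 2), 0, h] with hp
    have hnorm : ‖p‖ = k := by
      rw [EuclideanSpace.norm_eq, Fin.sum_univ_three]
      simp only [hp]
      simp only [Real.norm_eq_abs, sq_abs]
      simp
      rw [Real.sq_sqrt (by nlinarith), sub_add_cancel, Real.sqrt_sq hk.le]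
    have hp0 : p ≠ 0 := norm_pos_iff.1 (hnorm ▸ hk)
    have hp2 : p 2 = h := by simp [hp]
    have hcont : ContinuousAt (fun p : E3 => dens P p * p 2 ^ 2 * Real.cos (0 * p 2) -
        dens P p * p 2 ^ 2 * Real.cos (q * p 2)) p := by
      have h1 : ContinuousAt (dens P) p := (hP.continuousAt_norm hp0).const_mul _
      have h2 : ∀ q : ℝ, ContinuousAt (fun p : E3 => p 2 ^ 2 * Real.cos (q * p 2)) p := fun q =>
        Continuous.continuousAt (by fun_prop)
      simp only [mul_assoc]
      exact (h1.mul (h2 0)).sub (h1.mul (h2 q))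
    have hpos : dens P p * p 2 ^ 2 * Real.cos (0 * p 2) -
        dens P p * p 2 ^ 2 * Real.cos (q * p 2) ≠ 0 := by
      rw [hp2, zero_mul, Real.cos_zero, ← mul_sub]
      have h3 : Real.cos (q * h) ≠ 1 := by
        intro h4
        rw [Real.cos_eq_one_iff_of_lt_of_lt (by linarith [neg_abs_le (q * h)])
          (by linarith [le_abs_self (q * h)])] at h4
        exact mul_ne_zero hq h0.ne' h4
      have h4 : dens P p ≠ 0 := by rw [dens, hnorm]; positivity
      exact mul_ne_zero (mul_ne_zero h4 (by positivity)) (sub_ne_zero.2 h3.symm)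
    exact Measure.measure_pos_of_mem_nhds _ (hcont.eventually_ne hpos)
  · filter_upwards [hP.dens_nonneg] with p hp
    simp only [zero_mul, Real.cos_zero, mul_one, Pi.zero_apply]
    nlinarith [Real.cos_le_one (q * p 2), mul_nonneg hp (sq_nonneg (p 2))]

theorem IsInitialSpectrum.iteratedDeriv_fourthCorr (hP : IsInitialSpectrum P) (j : ℕ) :
    iteratedDeriv (2 * j) (fourthCorr P) 0 = (-1) ^ j * sigmaSq P (j + 2) / (2 * j + 5) := by
  unfold fourthCorr
  rw [bddSmooth_cos.iteratedDeriv_superposition (aestronglyMeasurable_coord 2)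
      (hP.integrable_dens_coord_pow_mul (by norm_num))]
  simp only [zero_mul, Real.iteratedDeriv_even_cos, Pi.mul_apply, Pi.pow_apply, Pi.neg_apply,
    Pi.one_apply, Real.cos_zero, mul_one, mul_assoc, ← pow_add]
  simp only [← mul_assoc]
  rw [integral_mul_const, show 4 + 2 * j = 2 * (j + 2) by ring, integral_dens_coord_pow]
  push_cast
  ring

theorem longProfile_neg (q : ℝ) : longProfile P (-q) = longProfile P q := by
  simp only [longProfile, fourthCorr, neg_mul, Real.cos_neg]

theorem transProfile_neg (q : ℝ) : transProfile P (-q) = transProfile P q := by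
  simp only [transProfile, neg_mul, longProfile_neg]

theorem iteratedDeriv_odd_of_even {f : ℝ → ℝ} (hf : ∀ q, f (-q) = f q) (j : ℕ) :
    iteratedDeriv (2 * j + 1) f 0 = 0 := by
  have h := iteratedDeriv_comp_neg (2 * j + 1) f 0
  simp only [hf, neg_zero, smul_eq_mul, pow_succ, pow_mul] at h
  norm_num at h
  linarith

theorem integral_one_sub_mul_pow (n : ℕ) :
    ∫ s in (0 : ℝ)..1, (1 - s) * s ^ n = 1 / ((n + 1) * (n + 2)) := by
  have : ∀ s : ℝ, (1 - s) * s ^ n = s ^ n - s ^ (n + 1) := fun s => by ring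
  simp only [this]
  rw [intervalIntegral.integral_sub (by simp) (by simp), integral_pow, integral_pow]
  push_cast
  field_simp
  ring

theorem IsInitialSpectrum.iteratedDeriv_longProfile (hP : IsInitialSpectrum P) (j : ℕ) :
    iteratedDeriv (2 * j) (longProfile P) 0 =
      (-1) ^ j * sigmaSq P (j + 2) / ((2 * j + 1) * (2 * j + 2) * (2 * j + 5)) := by
  unfold longProfile
  rw [hP.bddSmooth_fourthCorr.iteratedDeriv_average (w := fun s => 1 - s) (by fun_prop),
    integral_one_sub_mul_pow, hP.iteratedDeriv_fourthCorr]
  push_cast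
  field_simp

/-- The factor `1/(2j+3)` is `∫₀¹ s² s^{2j} ds`. At `j = 0` it makes the longitudinal curvature
three times the transverse one. -/
theorem IsInitialSpectrum.iteratedDeriv_transProfile (hP : IsInitialSpectrum P) (j : ℕ) :
    iteratedDeriv (2 * j) (transProfile P) 0 =
      iteratedDeriv (2 * j) (longProfile P) 0 / (2 * j + 3) := by
  unfold transProfile
  rw [hP.bddSmooth_longProfile.iteratedDeriv_average (w := fun s => s ^ 2) (by fun_prop)]
  simp only [← pow_add, integral_pow]
  push_cast
  simp
  ring

theorem IsInitialSpectrum.longProfile_zero (hP : IsInitialSpectrum P) :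
    longProfile P 0 = sigmaSq P 2 / 10 := by
  have := hP.iteratedDeriv_longProfile 0
  simp at this
  rw [this]
  norm_num

theorem IsInitialSpectrum.transProfile_zero (hP : IsInitialSpectrum P) :
    transProfile P 0 = sigmaSq P 2 / 30 := by
  have := hP.iteratedDeriv_transProfile 0
  simp [hP.longProfile_zero] at this
  rw [this]
  ring

end Profiles

/-! ### Lower bounds for the exponent near and far from the origin -/

section ProfileBounds

variable {P : ℝ → ℝ}

/-- If the fourth moment vanished, `dens · z⁴` would vanish almost everywhere and so would
`secondCorr`, against the strict inequality at `q = 1`. -/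
theorem IsInitialSpectrum.sigmaSq_two_pos (hP : IsInitialSpectrum P) : 0 < sigmaSq P 2 := by
  have h := integral_dens_coord_pow (P := P) 2
  have hnn : 0 ≤ᵐ[volume] fun p : E3 => dens P p * p 2 ^ (2 * 2) := by
    filter_upwards [hP.dens_nonneg] with p hp
    exact mul_nonneg hp (Even.pow_nonneg (by decide) _)
  have h0 := integral_nonneg_of_ae hnn
  rcases h0.lt_or_eq with h1 | h1
  · rw [h] at h1
    push_cast at h1
    linarith
  · rw [eq_comm, integral_eq_zero_iff_of_nonneg_ae hnn
      (hP.integrable_dens_coord_pow (by norm_num) 2)] at h1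
    have h2 : ∀ q, secondCorr P q = 0 := fun q => by
      unfold secondCorr
      rw [← integral_zero E3 ℝ]
      refine integral_congr_ae ?_
      filter_upwards [h1] with p hp
      rcases mul_eq_zero.1 hp with h3 | h3
      · simp [h3]
      · simp at h3
        simp [h3]
    have h3 := hP.secondCorr_lt one_ne_zero
    rw [← secondCorr_zero, h2, h2] at h3
    exact absurd h3 (lt_irrefl _)

theorem IsInitialSpectrum.longProfile_pos (hP : IsInitialSpectrum P) (q : ℝ) :
    0 < longProfile P q := by
  rcases eq_or_ne q 0 with rfl | hq
  · rw [hP.longProfile_zero]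
    linarith [hP.sigmaSq_two_pos]
  · have h1 := hP.sq_mul_longProfile q
    have h2 := hP.secondCorr_lt hq
    exact pos_of_mul_pos_right (by linarith : 0 < q ^ 2 * longProfile P q) (sq_nonneg q)

theorem IsInitialSpectrum.transProfile_pos (hP : IsInitialSpectrum P) (q : ℝ) :
    0 < transProfile P q := by
  have := hP.bddSmooth_longProfile.smooth.continuous
  refine intervalIntegral.intervalIntegral_pos_of_pos_on
    (Continuous.intervalIntegrable (by fun_prop) _ _) (fun s hs => ?_) one_pos
  exact mul_pos (pow_pos hs.1 2) (hP.longProfile_pos _)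

theorem IsInitialSpectrum.exists_profile_lower_bound (hP : IsInitialSpectrum P) :
    ∃ c, 0 < c ∧ ∀ q, |q| ≤ 1 → c ≤ longProfile P q ∧ c ≤ transProfile P q := by
  have hc : Continuous fun q => min (longProfile P q) (transProfile P q) :=
    hP.bddSmooth_longProfile.smooth.continuous.min hP.bddSmooth_transProfile.smooth.continuous
  obtain ⟨q0, -, h⟩ := (isCompact_Icc (a := (-1 : ℝ)) (b := 1)).exists_isMinOn ⟨0, by simp⟩
    hc.continuousOn
  refine ⟨_, lt_min (hP.longProfile_pos q0) (hP.transProfile_pos q0), fun q hq => ?_⟩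
  exact le_min_iff.1 (h (abs_le.1 hq))

/-- The Riemann-Lebesgue lemma along the third axis, with the frequency rescaled by `2π`. -/
theorem tendsto_integral_mul_cos {f : E3 → ℝ} (hf : Integrable f) :
  Tendsto (fun q : ℝ => ∫ p : E3, f p * Real.cos (q * p 2)) atTop (𝓝 0) := by
  have h1 := tendsto_integral_exp_inner_smul_cocompact fun p : E3 => (f p : ℂ)
  have h2 : Tendsto (fun q : ℝ => (q / (2 * Real.pi)) • ez) atTop (cocompact E3) := by
    rw [← Metric.cobounded_eq_cocompact, ← tendsto_norm_atTop_iff_cobounded]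
    simp only [norm_smul, norm_ez, mul_one]
    exact tendsto_norm_atTop_atTop.comp (tendsto_id.atTop_div_const (by positivity))
  have h3 := (Complex.continuous_re.tendsto _).comp (h1.comp h2)
  simp only [Complex.zero_re] at h3
  refine h3.congr fun q => ?_
  simp only [Function.comp]
  rw [← RCLike.re_eq_complex_re, ← integral_re ((Real.fourierIntegral_convergent_iff _).2
    hf.ofReal)]
  refine integral_congr_ae (Eventually.of_forall fun p => ?_)
  simp only [inner_smul_right, inner_ez, Circle.smul_def, Real.fourierChar_apply, smul_eq_mul,
    RCLike.re_eq_complex_re, Complex.re_mul_ofReal, Complex.exp_ofReal_mul_I_re]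
  rw [mul_comm, show 2 * Real.pi * -(q / (2 * Real.pi) * p 2) = -(q * p 2) by
    field_simp, Real.cos_neg]

theorem IsInitialSpectrum.sigmaSq_one_pos (hP : IsInitialSpectrum P) : 0 < sigmaSq P 1 := by
  suffices hs : 0 < sigmaSq P 1 / 3 by linarith
  have h1 := hP.secondCorr_lt one_ne_zero
  have h2 : 0 ≤ sigmaSq P 1 / 3 := by
    rw [← secondCorr_zero, secondCorr]
    refine integral_nonneg_of_ae ?_
    filter_upwards [hP.dens_nonneg] with p hp
    simp only [zero_mul, Real.cos_zero, mul_one]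
    exact mul_nonneg hp (sq_nonneg _)
  rcases h2.lt_or_eq with h3 | h3
  · exact h3
  · have h4 : ∀ᵐ p : E3, dens P p * p 2 ^ 2 = 0 := by
      have h5 : 0 ≤ᵐ[volume] fun p : E3 => dens P p * p 2 ^ 2 := by
        filter_upwards [hP.dens_nonneg] with p hp using mul_nonneg hp (sq_nonneg _)
      refine (integral_eq_zero_iff_of_nonneg_ae h5 (hP.integrable_dens_coord_pow le_rfl 2)).1 ?_
      rw [h3, ← secondCorr_zero, secondCorr]
      simp
    have h5 : secondCorr P 1 = 0 := by
      rw [secondCorr, ← integral_zero E3 ℝ]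
      refine integral_congr_ae ?_
      filter_upwards [h4] with p hp
      rw [hp, zero_mul]
    linarith

/-- Away from the origin the quadratic form of the structure function is bounded below. -/
theorem IsInitialSpectrum.exists_far_lower_bound (hP : IsInitialSpectrum P) :
    ∃ η, 0 < η ∧ ∀ q, 1 ≤ q → η ≤ q ^ 2 * longProfile P q ∧ η ≤ q ^ 2 * transProfile P q := by
  have hpos : ∀ q, 0 < q → 0 < q ^ 2 * longProfile P q := fun q hq =>
    mul_pos (pow_pos hq 2) (hP.longProfile_pos q)
  have hs : 0 < sigmaSq P 1 / 3 := by linarith [hP.sigmaSq_one_pos]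
  -- As `secondCorr` tends to `0`, `q² L = σ₁²/3 - secondCorr` eventually exceeds half of `σ₁²/3`;
  -- compactness covers the bounded range that remains.
  obtain ⟨R, hR⟩ := eventually_atTop.1 ((tendsto_integral_mul_cos
    (hP.integrable_dens_coord_pow le_rfl 2)).eventually (gt_mem_nhds (half_pos hs)))
  have hc : Continuous fun q => q ^ 2 * longProfile P q :=
    (continuous_pow 2).mul hP.bddSmooth_longProfile.smooth.continuous
  obtain ⟨q0, hq0, h⟩ := (isCompact_Icc (a := (1 / 2 : ℝ)) (b := max R (1 / 2))).exists_isMinOn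
    ⟨1 / 2, by simp⟩ hc.continuousOn
  set η := min (sigmaSq P 1 / 3 / 2) (q0 ^ 2 * longProfile P q0) with hη
  have hη0 : 0 < η := lt_min (half_pos hs) (hpos q0 (by linarith [hq0.1]))
  -- The range starts at `1/2` because the transverse profile averages `L(q s)`: for `q ≥ 1` the
  -- half `s ∈ [1/2, 1]` keeps `q s ≥ 1/2` and contributes `η/2`.
  have hlong : ∀ q, 1 / 2 ≤ q → η ≤ q ^ 2 * longProfile P q := by
    intro q hq
    rcases le_total q (max R (1 / 2)) with h1 | h1
    · exact (min_le_right _ _).trans (h ⟨hq, h1⟩)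
    · have h2 : secondCorr P q < _ := hR q ((le_max_left _ _).trans h1)
      rw [hP.sq_mul_longProfile]
      refine (min_le_left _ _).trans ?_
      linarith
  refine ⟨η / 2, half_pos hη0, fun q hq => ⟨?_, ?_⟩⟩
  · linarith [hlong q (by linarith)]
  · have hcont := hP.bddSmooth_longProfile.smooth.continuous
    have hi : ∀ a b : ℝ, IntervalIntegrable (fun s => q ^ 2 * (s ^ 2 * longProfile P (q * s)))
        volume a b := fun a b => Continuous.intervalIntegrable (by fun_prop) _ _
    rw [transProfile, ← intervalIntegral.integral_const_mul,
      ← intervalIntegral.integral_add_adjacent_intervals (hi 0 (1 / 2)) (hi (1 / 2) 1)]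
    have h1 : 0 ≤ ∫ s in (0 : ℝ)..(1 / 2), q ^ 2 * (s ^ 2 * longProfile P (q * s)) :=
      intervalIntegral.integral_nonneg (by norm_num) fun s _ => by
        have := hP.longProfile_pos (q * s)
        positivity
    have h2 : ∫ _ in (1 / 2 : ℝ)..1, η ≤
        ∫ s in (1 / 2 : ℝ)..1, q ^ 2 * (s ^ 2 * longProfile P (q * s)) := by
      refine intervalIntegral.integral_mono_on (by norm_num) (by simp) (hi _ _) fun s hs => ?_
      have h3 := hlong (q * s) (by nlinarith [hs.1, hs.2])
      rw [← mul_assoc, ← mul_pow]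
      exact h3
    rw [intervalIntegral.integral_const, smul_eq_mul] at h2
    linarith

end ProfileBounds

/-! ### Plancherel and regularised Fourier inversion -/

section Plancherel

open scoped FourierTransform ContDiff SchwartzMap

/-- The Fourier integral of a function in `L¹ ∩ L²` is in `L²`. -/
theorem memLp_two_fourier {f : E3 → ℂ} (hf : Integrable f) (hf2 : MemLp f 2 volume) :
    MemLp (𝓕 f) 2 volume := by
  have hcont : Continuous (𝓕 f) := 
    VectorFourier.fourierIntegral_continuous Real.continuous_fourierChar continuous_inner hf
  set G : Lp ℂ 2 (volume : Measure E3) := 𝓕 (hf2.toLp f) with hG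
  have hae : ∀ᵐ x, (G : E3 → ℂ) x = 𝓕 f x := by
    -- The `L²` transform and the Fourier integral are compared by pairing with test functions `g`.
    -- Both pairings equal `∫ 𝓕g · f`: one by the distributional definition, the other by Fubini.
    refine ae_eq_of_integral_contDiff_smul_eq ((Lp.memLp G).locallyIntegrable (by norm_num))
      hcont.locallyIntegrable fun g hg1 hg2 => ?_
    have hg3 : HasCompactSupport (Complex.ofRealCLM ∘ g) := hg2.comp_left rfl
    have hg4 : ContDiff ℝ ∞ (Complex.ofRealCLM ∘ g) := by fun_prop
    set G' : 𝓢(E3, ℂ) := hg3.toSchwartzMap hg4 with hG'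
    have h1 : ∀ x, G' x = (g x : ℂ) := fun x => rfl
    have h2 := congrArg (fun T => T G') (Lp.fourier_toTemperedDistribution_eq (hf2.toLp f))
    simp only [TemperedDistribution.fourier_apply, Lp.toTemperedDistribution_apply, h1] at h2
    have h3 := VectorFourier.integral_fourierIntegral_smul_eq_flip (L := innerₗ E3)
      Real.continuous_fourierChar continuous_inner (G'.integrable (μ := volume)) hf
    have h4 : ∫ x, (𝓕 G') x • (hf2.toLp f : E3 → ℂ) x = ∫ x, (𝓕 G') x • f x := by
      refine integral_congr_ae ?_
      filter_upwards [hf2.coeFn_toLp] with x hx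
      rw [hx]
    rw [h4] at h2
    rw [flip_innerₗ] at h3
    calc ∫ x, g x • (G : E3 → ℂ) x = ∫ x, (g x : ℂ) • (G : E3 → ℂ) x := by simp
      _ = ∫ x, (𝓕 G') x • f x := h2.symm
      _ = ∫ x, G' x • 𝓕 f x := h3
      _ = _ := by simp [h1]
  exact (memLp_congr_ae hae).1 (Lp.memLp G)

theorem integral_mul_cexp_of_even {f : E3 → ℝ} (hf : Integrable f) (heven : ∀ q, f (-q) = f q)
    (k : E3) : ∫ q, (f q : ℂ) * Complex.exp (Complex.I * (inner ℝ k q : ℝ)) =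
      ((∫ q, f q * Real.cos (inner ℝ k q) : ℝ) : ℂ) := by
  have hc : Integrable fun q => f q * Real.cos (inner ℝ k q) :=
    hf.mul_bdd (c := 1) (Continuous.aestronglyMeasurable (by fun_prop))
      (Eventually.of_forall fun q => Real.abs_cos_le_one _)
  have hs : Integrable fun q => f q * Real.sin (inner ℝ k q) :=
    hf.mul_bdd (c := 1) (Continuous.aestronglyMeasurable (by fun_prop))
      (Eventually.of_forall fun q => Real.abs_sin_le_one _)
  have hodd : ∫ q, f q * Real.sin (inner ℝ k q) = 0 := by
    have h := integral_neg_eq_self (fun q : E3 => f q * Real.sin (inner ℝ k q)) volume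
    simp only [heven, inner_neg_right, Real.sin_neg, mul_neg, integral_neg] at h
    linarith
  have h1 : ∀ q : E3, (f q : ℂ) * Complex.exp (Complex.I * (inner ℝ k q : ℝ)) =
      ((f q * Real.cos (inner ℝ k q) : ℝ) : ℂ) +
        ((f q * Real.sin (inner ℝ k q) : ℝ) : ℂ) * Complex.I := by
    intro q
    rw [mul_comm Complex.I, Complex.exp_mul_I, ← Complex.ofReal_cos, ← Complex.ofReal_sin]
    push_cast
    ring
  simp only [h1]
  rw [integral_add hc.ofReal (hs.ofReal.mul_const _), integral_mul_const, integral_complex_ofReal,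
    integral_complex_ofReal, hodd]
  simp

theorem fourier_eq_integral_cos {f : E3 → ℝ} (hf : Integrable f) (heven : ∀ p, f (-p) = f p)
    (q : E3) : 𝓕 (fun p => (f p : ℂ)) ((2 * Real.pi)⁻¹ • q) =
      ((∫ p, f p * Real.cos (inner ℝ p q) : ℝ) : ℂ) := by
  have h := integral_mul_cexp_of_even hf heven (-q)
  simp only [inner_neg_left, Real.cos_neg] at h
  simp only [real_inner_comm q]
  rw [← h, Real.fourier_eq]
  refine integral_congr_ae (Eventually.of_forall fun p => ?_)
  have := Real.pi_pos.ne'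
  simp only [Circle.smul_def, Real.fourierChar_apply, inner_smul_right, smul_eq_mul]
  rw [show 2 * Real.pi * -((2 * Real.pi)⁻¹ * inner ℝ p q) = -inner ℝ p q by field_simp,
    mul_comm, mul_comm Complex.I, real_inner_comm]

theorem integrable_sq_integral_cos {f : E3 → ℝ} (hf : Integrable f)
    (hf2 : Integrable fun p => f p ^ 2) (heven : ∀ p, f (-p) = f p) :
    Integrable fun q : E3 => (∫ p, f p * Real.cos (inner ℝ p q)) ^ 2 := by
  have h1 : MemLp (fun p => (f p : ℂ)) 2 volume := by
    rw [memLp_two_iff_integrable_sq_norm hf.ofReal.aestronglyMeasurable]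
    simpa using hf2
  have h2 := memLp_two_fourier hf.ofReal h1
  rw [memLp_two_iff_integrable_sq_norm h2.aestronglyMeasurable] at h2
  have h3 := h2.comp_smul (R := (2 * Real.pi)⁻¹) (by have := Real.pi_pos; positivity)
  refine h3.congr (Eventually.of_forall fun q => ?_)
  have := fourier_eq_integral_cos hf heven q
  simp only [RCLike.ofReal_eq_complex_ofReal] at *
  simp only [this, Complex.norm_real, Real.norm_eq_abs, sq_abs]

/-- The Fourier transform is moved from `f` onto the Gaussian, which becomes an approximate identity
centred at `v`. Integrability of `𝓕 f` is therefore not needed. -/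
theorem tendsto_integral_gaussian_mul_fourier {f : E3 → ℂ} (hf : Integrable f) {v : E3}
    (hv : ContinuousAt f v) :
    Tendsto (fun c : ℝ => ∫ w : E3,
      Complex.exp (-(c : ℂ)⁻¹ * ‖w‖ ^ 2 + 2 * Real.pi * Complex.I * inner ℝ v w) * 𝓕 f w)
      atTop (𝓝 (f v)) := by
  refine (Real.tendsto_integral_gaussian_smul' hf hv).congr' ?_
  filter_upwards [Ioi_mem_atTop 0] with c hc
  have hc : 0 < c := hc
  have J : Integrable (fun w : E3 =>
      Complex.exp (-(c : ℂ)⁻¹ * ‖w‖ ^ 2 + 2 * Real.pi * Complex.I * inner ℝ v w)) :=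
    GaussianFourier.integrable_cexp_neg_mul_sq_norm_add (by simpa using hc) _ _
  have h := VectorFourier.integral_fourierIntegral_smul_eq_flip (L := innerₗ E3)
      Real.continuous_fourierChar continuous_inner J hf
  rw [flip_innerₗ] at h
  simp only [smul_eq_mul] at h
  refine Eq.trans ?_ h
  congr with w
  have h2 := fourier_gaussian_innerProductSpace' (V := E3) (b := (c : ℂ)⁻¹) (by simpa using hc) v w
  rw [smul_eq_mul]
  congr 1
  refine Eq.trans ?_ h2.symm
  rw [div_inv_eq_mul, div_inv_eq_mul]
  congr 2
  ring

/-- Fourier inversion at a point of continuity, with Gaussian regularisation. -/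
theorem tendsto_integral_gaussian_mul_integral_cos {f : E3 → ℝ} (hf : Integrable f)
    (heven : ∀ p, f (-p) = f p) {k : E3} (hk : ContinuousAt f k) :
    Tendsto (fun ε : ℝ => ∫ q : E3, (Real.exp (-ε * ‖q‖ ^ 2) : ℂ) *
      ((∫ p, f p * Real.cos (inner ℝ p q) : ℝ) : ℂ) * Complex.exp (Complex.I * (inner ℝ k q : ℝ)))
      (𝓝[>] 0) (𝓝 (((2 * Real.pi) ^ 3 * f k : ℝ) : ℂ)) := by
  have hpi := Real.pi_pos
  have h1 := tendsto_integral_gaussian_mul_fourier hf.ofReal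
    (Complex.continuous_ofReal.continuousAt.comp hk)
  -- With `w = q/(2π)` the weight `e^{-|w|²/c}` becomes `e^{-ε|q|²}` exactly for `c = 1/(4π² ε)`.
  have h2 : Tendsto (fun ε : ℝ => (4 * Real.pi ^ 2)⁻¹ * ε⁻¹) (𝓝[>] 0) atTop :=
    tendsto_inv_nhdsGT_zero.const_mul_atTop (by positivity)
  have h3 := (h1.comp h2).const_mul (((2 * Real.pi) ^ 3 : ℝ) : ℂ)
  simp only [RCLike.ofReal_eq_complex_ofReal] at h3
  rw [← Complex.ofReal_mul] at h3
  refine h3.congr fun ε => ?_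
  have h4 := Measure.integral_comp_smul (volume : Measure E3) (fun w : E3 =>
    Complex.exp (-(((4 * Real.pi ^ 2)⁻¹ * ε⁻¹ : ℝ) : ℂ)⁻¹ * ‖w‖ ^ 2 +
      2 * Real.pi * Complex.I * inner ℝ k w) * 𝓕 (fun p => (f p : ℂ)) w) (2 * Real.pi)⁻¹
  simp only [finrank_euclideanSpace, Fintype.card_fin, fourier_eq_integral_cos hf heven] at h4
  rw [abs_of_pos (by positivity), inv_pow, inv_inv, Complex.real_smul] at h4
  simp only [Function.comp]
  refine h4.symm.trans (integral_congr_ae (Eventually.of_forall fun q => ?_))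
  have h5 : Complex.exp (-(((4 * Real.pi ^ 2)⁻¹ * ε⁻¹ : ℝ) : ℂ)⁻¹ * ‖(2 * Real.pi)⁻¹ • q‖ ^ 2 +
      2 * Real.pi * Complex.I * inner ℝ k ((2 * Real.pi)⁻¹ • q)) =
      (Real.exp (-ε * ‖q‖ ^ 2) : ℂ) * Complex.exp (Complex.I * (inner ℝ k q : ℝ)) := by
    rw [Complex.ofReal_exp, ← Complex.exp_add, norm_smul, inner_smul_right, Real.norm_eq_abs,
      abs_of_pos (by positivity)]
    congr 1
    push_cast
    have : (Real.pi : ℂ) ≠ 0 := by exact_mod_cast hpi.ne'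
    rw [mul_inv, inv_inv, inv_inv]
    field_simp
    ring
  simp only [h5]
  ring

end Plancherel

/-! ### Convergence of the integral defining the spectrum -/

section Convergence

variable {P : ℝ → ℝ}

/-- The quadratic form `kᵀ Ĉ(q) k`. -/
def quadForm (P : ℝ → ℝ) (k q : E3) : ℝ := k.ofLp ⬝ᵥ (Cpp P q *ᵥ k.ofLp)

theorem abs_inner_sq_le (p k : E3) : |(inner ℝ p k) ^ 2| ≤ ‖k‖ ^ 2 * ‖p‖ ^ 2 := by
  rw [abs_pow, ← mul_pow, mul_comm ‖k‖]
  exact pow_le_pow_left₀ (abs_nonneg _) (abs_real_inner_le_norm p k) 2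

theorem IsInitialSpectrum.integrable_dens_inner_sq (hP : IsInitialSpectrum P) (k : E3) :
    Integrable fun p : E3 => dens P p * (inner ℝ p k) ^ 2 :=
  hP.integrable_dens_mul le_rfl (by fun_prop) fun p => abs_inner_sq_le p k

theorem IsInitialSpectrum.quadForm_eq (hP : IsInitialSpectrum P) (k q : E3) :
    quadForm P k q = ∫ p : E3, dens P p * (inner ℝ p k) ^ 2 * Real.cos (inner ℝ p q) := by
  have hint : ∀ i j : Fin 3, Integrable fun p : E3 =>
      k i * (k j * (1 / (2 * Real.pi) ^ 3 * (p i * p j * P ‖p‖ * Real.cos (inner ℝ p q)))) := by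
    intro i j
    have h1 : Integrable fun p : E3 => dens P p * (p i * p j * Real.cos (inner ℝ p q)) := by
      refine hP.integrable_dens_mul le_rfl (by fun_prop) (C := 1) fun p => ?_
      rw [abs_mul, abs_mul, one_mul, sq]
      refine (mul_le_of_le_one_right (by positivity) (Real.abs_cos_le_one _)).trans ?_
      exact mul_le_mul (abs_coord_le p i) (abs_coord_le p j) (abs_nonneg _) (norm_nonneg _)
    refine (h1.const_mul (k i * k j)).congr (Eventually.of_forall fun p => ?_)
    simp only [dens]
    ring
  have h : ∀ p : E3, dens P p * (inner ℝ p k) ^ 2 * Real.cos (inner ℝ p q) =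
      ∑ i, ∑ j, k i * (k j * (1 / (2 * Real.pi) ^ 3 *
        (p i * p j * P ‖p‖ * Real.cos (inner ℝ p q)))) := by
    intro p
    have h1 : inner ℝ p k = ∑ i, p i * k i := by
      simp [PiLp.inner_apply, mul_comm]
    rw [h1]
    simp only [dens, Fin.sum_univ_three]
    ring
  simp only [h]
  rw [integral_finsetSum _ fun i _ => integrable_finsetSum _ fun j _ => hint i j]
  simp only [quadForm, dotProduct, Matrix.mulVec, Cpp, Matrix.of_apply, Finset.mul_sum]
  refine Finset.sum_congr rfl fun i _ => ?_
  rw [integral_finsetSum _ fun j _ => hint i j]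
  refine Finset.sum_congr rfl fun j _ => ?_
  rw [integral_const_mul, integral_const_mul, integral_const_mul]
  ring

theorem IsInitialSpectrum.quadForm_neg (hP : IsInitialSpectrum P) (k q : E3) :
    quadForm P k (-q) = quadForm P k q := by
  simp only [hP.quadForm_eq, inner_neg_right, Real.cos_neg]

theorem IsInitialSpectrum.quadForm_isometry (hP : IsInitialSpectrum P) (R : E3 ≃ₗᵢ[ℝ] E3)
    (k q : E3) : quadForm P (R k) (R q) = quadForm P k q := by
  rw [hP.quadForm_eq, hP.quadForm_eq, ← integral_comp_linearIsometryEquiv R]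
  simp only [LinearIsometryEquiv.inner_map_map, dens, LinearIsometryEquiv.norm_map]

theorem IsInitialSpectrum.quadForm_smul (hP : IsInitialSpectrum P) (c : ℝ) (k q : E3) :
    quadForm P (c • k) q = c ^ 2 * quadForm P k q := by
  rw [hP.quadForm_eq, hP.quadForm_eq, ← integral_const_mul]
  simp only [inner_smul_right]
  congr with p
  ring

theorem IsInitialSpectrum.continuous_quadForm (hP : IsInitialSpectrum P) (k : E3) :
    Continuous (quadForm P k) := by
  rw [show quadForm P k = _ from funext (hP.quadForm_eq k)]
  refine continuous_of_dominated
    (bound := fun p => |dens P p * (inner ℝ p k) ^ 2|) ?_ ?_ (hP.integrable_dens_inner_sq k).abs ?_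
  · exact fun q => (hP.integrable_dens_inner_sq k).aestronglyMeasurable.mul
      (Continuous.aestronglyMeasurable (by fun_prop))
  · refine fun q => Eventually.of_forall fun p => ?_
    rw [norm_mul]
    exact mul_le_of_le_one_right (norm_nonneg _) (Real.abs_cos_le_one _)
  · exact Eventually.of_forall fun p => by fun_prop

/-- The exponent of the free power spectrum in terms of the smooth radial profiles. -/
theorem IsInitialSpectrum.quadForm_sub (hP : IsInitialSpectrum P) (k : E3) {q : E3} (hq : q ≠ 0) :
    quadForm P k q - sigmaSq P 1 / 3 * ‖k‖ ^ 2 =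
      -(transProfile P ‖q‖ * (‖k‖ ^ 2 * ‖q‖ ^ 2 - (inner ℝ q k) ^ 2) +
        longProfile P ‖q‖ * (inner ℝ q k) ^ 2) := by
  have hr : ‖q‖ ≠ 0 := norm_ne_zero_iff.2 hq
  have h1 := hP.hessian_correlation hq k
  have h2 := hP.a1_add hr
  simp only [← mul_assoc] at h1
  rw [hP.quadForm_eq, h1, hP.a2_eq hr, eq_sub_of_add_eq h2]
  field_simp
  ring

theorem inner_sq_le (q k : E3) : (inner ℝ q k) ^ 2 ≤ ‖k‖ ^ 2 * ‖q‖ ^ 2 :=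
  (le_abs_self _).trans (abs_inner_sq_le q k)

theorem IsInitialSpectrum.quadForm_le (hP : IsInitialSpectrum P) (k : E3) {q : E3} (hq : q ≠ 0) :
    quadForm P k q ≤ sigmaSq P 1 / 3 * ‖k‖ ^ 2 := by
  have h1 := hP.quadForm_sub k hq
  have h2 := mul_nonneg (hP.transProfile_pos ‖q‖).le (sub_nonneg.2 (inner_sq_le q k))
  have h3 := mul_nonneg (hP.longProfile_pos ‖q‖).le (sq_nonneg (inner ℝ q k))
  linarith

/-- By Plancherel it suffices that `dens · (p·k)²` is square integrable, which is what the
hypothesis on `k² P` provides. -/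
theorem IsInitialSpectrum.integrable_quadForm_sq (hP : IsInitialSpectrum P) (k : E3) :
    Integrable fun q => quadForm P k q ^ 2 := by
  simp only [hP.quadForm_eq]
  refine integrable_sq_integral_cos (hP.integrable_dens_inner_sq k) ?_ fun p => by
    simp [dens, inner_neg_left]
  have h1 : Integrable fun p : E3 => (‖p‖ ^ 2 * P ‖p‖) ^ 2 := by
    refine (integrable_fun_norm_addHaar (volume : Measure E3)
      (f := fun y => (y ^ 2 * P y) ^ 2)).2 ?_
    refine hP.sq_integrable.congr_fun (fun y _ => ?_) measurableSet_Ioi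
    simp only [finrank_euclideanSpace, Fintype.card_fin, smul_eq_mul]
  refine (h1.const_mul ((1 / (2 * Real.pi) ^ 3) ^ 2 * ‖k‖ ^ 4)).mono'
    ((hP.integrable_dens_inner_sq k).aestronglyMeasurable.pow 2)
    (Eventually.of_forall fun p => ?_)
  rw [Real.norm_of_nonneg (by positivity), mul_pow]
  have h2 := pow_le_pow_left₀ (abs_nonneg _) (abs_inner_sq_le p k) 2
  rw [sq_abs] at h2
  calc dens P p ^ 2 * (inner ℝ p k ^ 2) ^ 2 ≤ dens P p ^ 2 * (‖k‖ ^ 2 * ‖p‖ ^ 2) ^ 2 :=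
        mul_le_mul_of_nonneg_left h2 (sq_nonneg _)
    _ = _ := by
        simp only [dens]
        ring

/-- Makes the dependence on `k` explicit, so that the tail of the kernel is bounded by `k⁴` times a
constant and an exponential. -/
theorem IsInitialSpectrum.integral_quadForm_sq (hP : IsInitialSpectrum P) (k : E3) :
    ∫ q, quadForm P k q ^ 2 = ‖k‖ ^ 4 * ∫ q, quadForm P ez q ^ 2 := by
  obtain ⟨R, hR⟩ := exists_linearIsometryEquiv_apply_eq (v := ‖k‖ • ez) (w := k)
    (by rw [norm_smul, norm_ez]; simp)
  rw [← integral_comp_linearIsometryEquiv R, ← integral_const_mul]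
  nth_rewrite 1 [← hR]
  simp only [hP.quadForm_isometry, hP.quadForm_smul]
  congr with q
  ring

/-- Valid for both signs of `u`. The factor `1 + e^u` is chosen so that, after multiplication by
`e^{-Q}`, both of its terms are exponentially small away from the origin. -/
theorem exp_sub_one_sub_le (u : ℝ) : Real.exp u - 1 - u ≤ u ^ 2 * (1 + Real.exp u) := by
  have h1 : Real.exp u - 1 ≤ u * Real.exp u := by
    have h2 := mul_le_mul_of_nonneg_left (Real.one_sub_le_exp_neg u) (Real.exp_pos u).le
    rw [← Real.exp_add, add_neg_cancel, Real.exp_zero] at h2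
    linarith
  have h3 := Real.add_one_le_exp u
  have h4 := Real.exp_pos u
  rcases le_total 0 u with hu | hu
  · nlinarith [mul_le_mul_of_nonneg_left h1 hu, sq_nonneg u]
  · nlinarith [mul_le_mul_of_nonneg_left h3 (neg_nonneg.2 hu), mul_nonneg (sq_nonneg u) h4.le]

/-- The part of the kernel that is of higher order in the correlation matrix. -/
def kernelRem (P : ℝ → ℝ) (g : ℝ) (k q : E3) : ℝ :=
  Real.exp (g ^ 2 * quadForm P k q) - 1 - g ^ 2 * quadForm P k q

theorem kernelRem_nonneg (g : ℝ) (k q : E3) : 0 ≤ kernelRem P g k q := by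
  have := Real.add_one_le_exp (g ^ 2 * quadForm P k q)
  unfold kernelRem
  linarith

theorem kernelRem_le (g : ℝ) (k q : E3) : kernelRem P g k q ≤
    g ^ 4 * quadForm P k q ^ 2 * (1 + Real.exp (g ^ 2 * quadForm P k q)) := by
  refine (exp_sub_one_sub_le _).trans (le_of_eq ?_)
  ring

theorem IsInitialSpectrum.continuous_kernelRem (hP : IsInitialSpectrum P) (g : ℝ) (k : E3) :
    Continuous (kernelRem P g k) := by
  have := hP.continuous_quadForm k
  unfold kernelRem
  fun_prop

theorem IsInitialSpectrum.integrable_kernelRem (hP : IsInitialSpectrum P) (g : ℝ) (k : E3) :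
    Integrable (kernelRem P g k) := by
  refine ((hP.integrable_quadForm_sq k).const_mul (g ^ 4 *
    (1 + Real.exp (g ^ 2 * (sigmaSq P 1 / 3 * ‖k‖ ^ 2))))).mono'
    (hP.continuous_kernelRem g k).aestronglyMeasurable ?_
  filter_upwards [ae_ne_zero] with q hq
  rw [Real.norm_of_nonneg (kernelRem_nonneg _ _ _)]
  refine (kernelRem_le g k q).trans ?_
  have h1 := Real.exp_le_exp.2 (mul_le_mul_of_nonneg_left (hP.quadForm_le k hq) (sq_nonneg g))
  have h2 : 0 ≤ g ^ 4 * quadForm P k q ^ 2 := by positivity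
  nlinarith [mul_le_mul_of_nonneg_left h1 h2]

theorem tendsto_integral_gaussian_mul {f : E3 → ℂ} (hf : Integrable f) :
    Tendsto (fun ε : ℝ => ∫ q : E3, (Real.exp (-ε * ‖q‖ ^ 2) : ℂ) * f q) (𝓝[>] 0)
      (𝓝 (∫ q, f q)) := by
  refine tendsto_integral_filter_of_dominated_convergence (fun q => ‖f q‖) ?_ ?_ hf.norm ?_
  · refine Eventually.of_forall fun ε => ?_
    exact (Continuous.aestronglyMeasurable (by fun_prop)).mul hf.aestronglyMeasurable
  · filter_upwards [self_mem_nhdsWithin] with ε hε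
    refine Eventually.of_forall fun q => ?_
    have h2 : Real.exp (-ε * ‖q‖ ^ 2) ≤ 1 := by
      rw [Real.exp_le_one_iff]
      have : (0 : ℝ) < ε := hε
      nlinarith [sq_nonneg ‖q‖]
    rw [norm_mul, Complex.norm_real, Real.norm_of_nonneg (Real.exp_pos _).le]
    exact mul_le_of_le_one_left (norm_nonneg _) h2
  · refine Eventually.of_forall fun q => ?_
    have hcont : Continuous fun ε : ℝ => (Real.exp (-ε * ‖q‖ ^ 2) : ℂ) * f q := by fun_prop
    have := (hcont.tendsto 0).mono_left (nhdsWithin_le_nhds (s := Set.Ioi 0))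
    simpa using this

theorem integrable_gaussian_E3 {ε : ℝ} (hε : 0 < ε) :
    Integrable fun q : E3 => Real.exp (-ε * ‖q‖ ^ 2) := by
  have h := (GaussianFourier.integrable_cexp_neg_mul_sq_norm_add (V := E3) (b := (ε : ℂ))
    (by simpa using hε) 0 0).norm
  refine h.congr (Eventually.of_forall fun q => ?_)
  simp only [zero_mul, add_zero, Complex.norm_exp]
  norm_cast

theorem IsInitialSpectrum.abs_quadForm_le (hP : IsInitialSpectrum P) (k q : E3) :
    |quadForm P k q| ≤ ∫ p : E3, |dens P p * (inner ℝ p k) ^ 2| := by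
  rw [hP.quadForm_eq, ← Real.norm_eq_abs]
  refine norm_integral_le_of_norm_le (hP.integrable_dens_inner_sq k).abs
    (Eventually.of_forall fun p => ?_)
  rw [norm_mul]
  exact mul_le_of_le_one_right (norm_nonneg _) (Real.abs_cos_le_one _)

/-- The value of the free power spectrum: the linear part of the kernel gives `g² k⁴ P(k)`. -/
def spectrumValue (P : ℝ → ℝ) (g : ℝ) (k : E3) : ℝ :=
  Real.exp (-Qexp P g k) * (g ^ 2 * (‖k‖ ^ 4 * P ‖k‖) +
    ∫ q : E3, kernelRem P g k q * Real.cos (inner ℝ k q))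

/-- The linear part of the kernel converges by Fourier inversion at `k`, a point of continuity since
`k ≠ 0`. The remainder is integrable, so dominated convergence applies. -/
theorem IsInitialSpectrum.tendsto_regularizedSpectrum (hP : IsInitialSpectrum P) (g : ℝ) {k : E3}
    (hk : k ≠ 0) : Tendsto (regularizedSpectrum P g k) (𝓝[>] 0)
      (𝓝 (spectrumValue P g k : ℂ)) := by
  have hpi := Real.pi_pos.ne'
  have heven : ∀ p : E3, dens P (-p) * (inner ℝ (-p) k) ^ 2 = dens P p * (inner ℝ p k) ^ 2 :=
    fun p => by simp [dens, inner_neg_left]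
  have h1 := tendsto_integral_gaussian_mul_integral_cos (hP.integrable_dens_inner_sq k) heven
    (k := k) (((hP.continuousAt_norm hk).const_mul _).mul
      (Continuous.continuousAt (by fun_prop)))
  have hrem : Integrable fun q : E3 =>
      (kernelRem P g k q : ℂ) * Complex.exp (Complex.I * (inner ℝ k q : ℝ)) :=
    (hP.integrable_kernelRem g k).ofReal.mul_bdd (c := 1)
      (Continuous.aestronglyMeasurable (by fun_prop))
      (Eventually.of_forall fun q => by rw [mul_comm, Complex.norm_exp_ofReal_mul_I])
  have h2 := tendsto_integral_gaussian_mul hrem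
  rw [integral_mul_cexp_of_even (hP.integrable_kernelRem g k)
    fun q => by simp only [kernelRem, hP.quadForm_neg]] at h2
  have h3 := ((h1.const_mul ((g ^ 2 : ℝ) : ℂ)).add h2).const_mul (Real.exp (-Qexp P g k) : ℂ)
  have h4 : (Real.exp (-Qexp P g k) : ℂ) * (((g ^ 2 : ℝ) : ℂ) *
      (((2 * Real.pi) ^ 3 * (dens P k * (inner ℝ k k) ^ 2) : ℝ) : ℂ) +
      ((∫ q, kernelRem P g k q * Real.cos (inner ℝ k q) : ℝ) : ℂ)) =
      (spectrumValue P g k : ℂ) := by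
    rw [real_inner_self_eq_norm_sq, dens, spectrumValue]
    rw [← Complex.ofReal_mul, ← Complex.ofReal_add, ← Complex.ofReal_mul]
    congr 3
    field_simp
  rw [h4] at h3
  refine h3.congr' ?_
  filter_upwards [self_mem_nhdsWithin] with ε hε
  have hε : (0 : ℝ) < ε := hε
  rw [regularizedSpectrum]
  congr 1
  simp only [← hP.quadForm_eq]
  have hgauss : ∀ f : E3 → ℂ, Continuous f → ∀ C, (∀ q, ‖f q‖ ≤ C) →
      Integrable fun q => (Real.exp (-ε * ‖q‖ ^ 2) : ℂ) * f q := fun f hf C hC =>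
    (integrable_gaussian_E3 hε).ofReal.mul_bdd (c := C) hf.aestronglyMeasurable
      (Eventually.of_forall hC)
  have hq := hP.continuous_quadForm k
  have hi1 : Integrable fun q : E3 => (Real.exp (-ε * ‖q‖ ^ 2) : ℂ) * (quadForm P k q : ℂ) *
      Complex.exp (Complex.I * (inner ℝ k q : ℝ)) := by
    simp only [mul_assoc]
    refine hgauss (fun q => (quadForm P k q : ℂ) * Complex.exp (Complex.I * (inner ℝ k q : ℝ)))
      (by fun_prop) (∫ p : E3, |dens P p * (inner ℝ p k) ^ 2|) fun q => ?_
    rw [norm_mul, mul_comm Complex.I, Complex.norm_exp_ofReal_mul_I, mul_one, Complex.norm_real]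
    exact hP.abs_quadForm_le k q
  have hi2 : Integrable fun q : E3 => (Real.exp (-ε * ‖q‖ ^ 2) : ℂ) *
      ((kernelRem P g k q : ℂ) * Complex.exp (Complex.I * (inner ℝ k q : ℝ))) := by
    refine hrem.bdd_mul (c := 1) (Continuous.aestronglyMeasurable (by fun_prop))
      (Eventually.of_forall fun q => ?_)
    rw [Complex.norm_real, Real.norm_of_nonneg (Real.exp_pos _).le, Real.exp_le_one_iff]
    nlinarith [sq_nonneg ‖q‖]
  rw [← integral_const_mul, ← integral_add (hi1.const_mul _) hi2]
  refine integral_congr_ae (Eventually.of_forall fun q => ?_)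
  simp only [kernel, kernelRem, quadForm]
  push_cast
  ring

theorem IsInitialSpectrum.freePowerSpectrum_eq (hP : IsInitialSpectrum P) (g : ℝ) {k : E3}
    (hk : k ≠ 0) : freePowerSpectrum P g k = spectrumValue P g k := by
  rw [freePowerSpectrum, (hP.tendsto_regularizedSpectrum g hk).limUnder_eq, Complex.ofReal_re]

end Convergence

/-! ### A Gaussian family with radially varying coefficients -/

section GaussianFamily

open scoped ContDiff

/-- The derivatives of `exp ∘ F` at a point in terms of those of `F`. -/
def expCoeff (d : ℕ → ℝ) : ℕ → ℝ
  | 0 => Real.exp (d 0)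
  | n + 1 => ∑ i : Fin (n + 1), (n.choose i : ℝ) * d (i + 1) * expCoeff d (n - i)
  termination_by n => n
  decreasing_by omega

theorem expCoeff_zero (d : ℕ → ℝ) : expCoeff d 0 = Real.exp (d 0) := by
  rw [expCoeff]

theorem expCoeff_succ (d : ℕ → ℝ) (n : ℕ) : expCoeff d (n + 1) =
    ∑ i ∈ Finset.range (n + 1), (n.choose i : ℝ) * d (i + 1) * expCoeff d (n - i) := by
  rw [expCoeff, Finset.sum_range]

/-- Leibniz' rule applied to `(e^F)' = F' e^F` is the recursion that defines `expCoeff`. -/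
theorem iteratedDeriv_exp_comp {F : ℝ → ℝ} (hF : ContDiff ℝ ∞ F) (n : ℕ) (q : ℝ) :
    iteratedDeriv n (fun q => Real.exp (F q)) q = expCoeff (fun j => iteratedDeriv j F q) n := by
  induction n using Nat.strong_induction_on with
  | _ n ih =>
    cases n with
    | zero => simp [expCoeff_zero]
    | succ n =>
      have h1 : deriv (fun q => Real.exp (F q)) = deriv F * fun q => Real.exp (F q) := by
        funext q
        rw [deriv_exp (hF.differentiable (by simp) q), Pi.mul_apply, mul_comm]
      have hF' : ContDiff ℝ ∞ (deriv F) := ((contDiff_succ_iff_deriv (n := ∞)).1 hF).2.2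
      rw [iteratedDeriv_succ', h1, iteratedDeriv_mul (hF'.contDiffAt.of_le (by exact_mod_cast le_top))
        (hF.exp.contDiffAt.of_le (by exact_mod_cast le_top)), expCoeff_succ]
      refine Finset.sum_congr rfl fun i _ => ?_
      rw [ih (n - i) (by omega), ← iteratedDeriv_succ']

theorem expCoeff_congr {d e : ℕ → ℝ} {n : ℕ} (h : ∀ j ≤ n, d j = e j) :
    expCoeff d n = expCoeff e n := by
  induction n using Nat.strong_induction_on with
  | _ n ih =>
    cases n with
    | zero => simp [expCoeff_zero, h 0 le_rfl]
    | succ n =>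
      rw [expCoeff_succ, expCoeff_succ]
      refine Finset.sum_congr rfl fun i hi => ?_
      have := Finset.mem_range.1 hi
      rw [h (i + 1) (by omega), ih (n - i) (by omega) fun j hj => h j (by omega)]

/-- `expCoeff` is affine in the derivative of highest order. -/
theorem expCoeff_sub {d e : ℕ → ℝ} {n : ℕ} (h : ∀ j ≤ n, d j = e j) :
    expCoeff d (n + 1) - expCoeff e (n + 1) = (d (n + 1) - e (n + 1)) * Real.exp (d 0) := by
  -- Only the last summand, `i = n`, contains the derivative of order `n + 1`; its cofactor is
  -- `expCoeff d 0`.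
  rw [expCoeff_succ, expCoeff_succ, Finset.sum_range_succ, Finset.sum_range_succ,
    Finset.sum_congr rfl fun i hi => ?_]
  · simp only [Nat.choose_self, Nat.sub_self, expCoeff_zero, h 0 (Nat.zero_le n)]
    push_cast
    ring
  · have := Finset.mem_range.1 hi
    rw [h (i + 1) (by omega), expCoeff_congr fun j hj => h j (by omega)]

theorem continuous_expCoeff {X : Type*} [TopologicalSpace X] {d : X → ℕ → ℝ}
    (hd : ∀ j, Continuous fun x => d x j) (n : ℕ) : Continuous fun x => expCoeff (d x) n := by
  induction n using Nat.strong_induction_on with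
  | _ n ih =>
    cases n with
    | zero =>
      simp only [expCoeff_zero]
      exact (hd 0).rexp
    | succ n =>
      simp only [expCoeff_succ]
      refine continuous_finsetSum _ fun i _ => ?_
      exact (continuous_const.mul (hd (i + 1))).mul (ih (n - i) (by omega))

/-- The exponent of an axially symmetric Gaussian family. -/
def phase (A B : ℝ → ℝ) (x : E3) (q : ℝ) : ℝ :=
  -(A q * (x 0 ^ 2 + x 1 ^ 2) + B q * x 2 ^ 2)

/-- An axially symmetric Gaussian family. -/
def gaussFam (A B : ℝ → ℝ) (x : E3) (q : ℝ) : ℝ := Real.exp (phase A B x q)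

variable {A B : ℝ → ℝ}

theorem norm_sq_E3 (x : E3) : ‖x‖ ^ 2 = x 0 ^ 2 + x 1 ^ 2 + x 2 ^ 2 := by
  rw [EuclideanSpace.norm_sq_eq, Fin.sum_univ_three]
  simp only [Real.norm_eq_abs, sq_abs]

theorem contDiff_phase (hA : BddSmooth A) (hB : BddSmooth B) (x : E3) :
    ContDiff ℝ ∞ (phase A B x) :=
  ((hA.smooth.mul contDiff_const).add (hB.smooth.mul contDiff_const)).neg

theorem contDiff_gaussFam (hA : BddSmooth A) (hB : BddSmooth B) (x : E3) :
    ContDiff ℝ ∞ (gaussFam A B x) :=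
  (contDiff_phase hA hB x).exp

theorem iteratedDeriv_phase (hA : BddSmooth A) (hB : BddSmooth B) (x : E3) (n : ℕ) (q : ℝ) :
    iteratedDeriv n (phase A B x) q =
      -(iteratedDeriv n A q * (x 0 ^ 2 + x 1 ^ 2) + iteratedDeriv n B q * x 2 ^ 2) := by
  have hA' : ContDiffAt ℝ n A q := hA.smooth.contDiffAt.of_le (by exact_mod_cast le_top)
  have hB' : ContDiffAt ℝ n B q := hB.smooth.contDiffAt.of_le (by exact_mod_cast le_top)
  unfold phase
  rw [iteratedDeriv_fun_neg, iteratedDeriv_fun_add (hA'.mul contDiffAt_const)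
    (hB'.mul contDiffAt_const), iteratedDeriv_mul_const_field, iteratedDeriv_mul_const_field]

theorem iteratedDeriv_gaussFam (hA : BddSmooth A) (hB : BddSmooth B) (x : E3) (n : ℕ) (q : ℝ) :
    iteratedDeriv n (gaussFam A B x) q =
      expCoeff (fun j => -(iteratedDeriv j A q * (x 0 ^ 2 + x 1 ^ 2) +
        iteratedDeriv j B q * x 2 ^ 2)) n := by
  unfold gaussFam
  rw [iteratedDeriv_exp_comp (contDiff_phase hA hB x)]
  simp only [iteratedDeriv_phase hA hB]

theorem continuous_iteratedDeriv_gaussFam (hA : BddSmooth A) (hB : BddSmooth B) (n : ℕ) (q : ℝ) :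
    Continuous fun x => iteratedDeriv n (gaussFam A B x) q := by
  simp only [iteratedDeriv_gaussFam hA hB]
  exact continuous_expCoeff (fun j => by fun_prop) n

/-- A polynomially weighted Gaussian. -/
def envelope (c : ℝ) (n : ℕ) (x : E3) : ℝ := (1 + ‖x‖ ^ 2) ^ n * Real.exp (-(c * ‖x‖ ^ 2))

theorem envelope_nonneg (c : ℝ) (n : ℕ) (x : E3) : 0 ≤ envelope c n x := by
  unfold envelope
  positivity

theorem integrable_envelope {c : ℝ} (hc : 0 < c) (n : ℕ) : Integrable (envelope c n) := by
  refine (integrable_fun_norm_addHaar (volume : Measure E3)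
    (f := fun y => (1 + y ^ 2) ^ n * Real.exp (-(c * y ^ 2)))).2 (Integrable.integrableOn ?_)
  have h : ∀ y : ℝ, y ^ (Module.finrank ℝ E3 - 1) • ((1 + y ^ 2) ^ n * Real.exp (-(c * y ^ 2))) =
      ∑ k ∈ Finset.range (n + 1),
        (n.choose k : ℝ) * (y ^ (2 * (n - k) + 2) * Real.exp (-(c * y ^ 2))) := by
    intro y
    rw [add_pow, Finset.sum_mul, smul_eq_mul, Finset.mul_sum]
    refine Finset.sum_congr rfl fun k _ => ?_
    simp only [finrank_euclideanSpace, Fintype.card_fin, one_pow, ← pow_mul]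
    ring
  simp only [h]
  exact integrable_finsetSum _ fun k _ => (integrable_pow_mul_gaussian hc _).const_mul _

/-- Every derivative of the phase is at most quadratic in `x`, so by Faà di Bruno `n` derivatives
cost a factor `(1 + ‖x‖²)ⁿ`; the lower bound `c` on `A` and `B` supplies the Gaussian. -/
theorem exists_iteratedDeriv_gaussFam_bound (hA : BddSmooth A) (hB : BddSmooth B) {c : ℝ}
    (hc : ∀ q, |q| ≤ 1 → c ≤ A q ∧ c ≤ B q) (n : ℕ) :
    ∃ C, 0 ≤ C ∧ ∀ (x : E3) (q : ℝ), |q| ≤ 1 →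
      |iteratedDeriv n (gaussFam A B x) q| ≤ C * envelope c n x := by
  choose a ha using hA.bdd
  choose b hb using hB.bdd
  -- The summand `1` makes `M (1 + ‖x‖²) ≥ 1`, so that a bound on the `i`-th derivative by this
  -- quantity is also one by its `i`-th power, as the Faà di Bruno estimate requires.
  set M : ℝ := 1 + ∑ i ∈ Finset.range (n + 1), (|a i| + |b i|) with hM
  have hMi : ∀ i ≤ n, |a i| + |b i| ≤ M := by
    intro i hi
    have := Finset.single_le_sum (f := fun i => |a i| + |b i|)
      (fun i _ => by positivity) (Finset.mem_range.2 (Nat.lt_succ_of_le hi))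
    linarith
  have hM1 : 1 ≤ M := by
    have : 0 ≤ ∑ i ∈ Finset.range (n + 1), (|a i| + |b i|) :=
      Finset.sum_nonneg fun i _ => by positivity
    linarith
  refine ⟨n ! * M ^ n, by positivity, fun x q hq => ?_⟩
  have h := norm_iteratedFDeriv_comp_le (𝕜 := ℝ) (N := ∞) (n := n) Real.contDiff_exp
    (contDiff_phase hA hB x) (by exact_mod_cast le_top) q
    (C := Real.exp (phase A B x q)) (D := M * (1 + ‖x‖ ^ 2)) ?_ ?_
  · rw [norm_iteratedFDeriv_eq_norm_iteratedDeriv] at h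
    have h2 : Real.exp (phase A B x q) ≤ Real.exp (-(c * ‖x‖ ^ 2)) := by
      rw [Real.exp_le_exp, phase, neg_le_neg_iff, norm_sq_E3]
      obtain ⟨h3, h4⟩ := hc q hq
      nlinarith [mul_le_mul_of_nonneg_right h3 (by positivity : 0 ≤ x 0 ^ 2 + x 1 ^ 2),
        mul_le_mul_of_nonneg_right h4 (sq_nonneg (x 2))]
    refine h.trans ?_
    rw [mul_pow, envelope]
    calc (n ! : ℝ) * Real.exp (phase A B x q) * (M ^ n * (1 + ‖x‖ ^ 2) ^ n)
        ≤ (n ! : ℝ) * Real.exp (-(c * ‖x‖ ^ 2)) * (M ^ n * (1 + ‖x‖ ^ 2) ^ n) := by gcongr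
      _ = _ := by ring
  · intro i _
    rw [norm_iteratedFDeriv_eq_norm_iteratedDeriv, iteratedDeriv_eq_iterate, Real.iter_deriv_exp,
      Real.norm_of_nonneg (Real.exp_pos _).le]
  · intro i hi1 hi2
    rw [norm_iteratedFDeriv_eq_norm_iteratedDeriv, iteratedDeriv_phase hA hB, Real.norm_eq_abs,
      abs_neg]
    have h1 : |iteratedDeriv i A q * (x 0 ^ 2 + x 1 ^ 2) + iteratedDeriv i B q * x 2 ^ 2| ≤
        M * (1 + ‖x‖ ^ 2) := by
      refine (abs_add_le _ _).trans ?_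
      rw [abs_mul, abs_mul, abs_of_nonneg (by positivity : 0 ≤ x 0 ^ 2 + x 1 ^ 2),
        abs_of_nonneg (sq_nonneg (x 2))]
      have h2 := (ha i q).trans (le_abs_self _)
      have h3 := (hb i q).trans (le_abs_self _)
      have h4 := hMi i hi2
      have h5 := norm_sq_E3 x
      nlinarith [mul_le_mul_of_nonneg_right (h2.trans (by linarith [abs_nonneg (b i)] : _ ≤ M))
          (by positivity : 0 ≤ x 0 ^ 2 + x 1 ^ 2),
        mul_le_mul_of_nonneg_right (h3.trans (by linarith [abs_nonneg (a i)] : _ ≤ M))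
          (sq_nonneg (x 2))]
    refine h1.trans (le_self_pow₀ ?_ (by omega))
    nlinarith [sq_nonneg ‖x‖]

/-- Taylor expansion of the Gaussian family, uniformly dominated. -/
theorem exists_gaussFam_taylor_bound (hA : BddSmooth A) (hB : BddSmooth B) {c : ℝ}
    (hc : ∀ q, |q| ≤ 1 → c ≤ A q ∧ c ≤ B q) (n : ℕ) :
    ∃ C, 0 ≤ C ∧ ∀ (x : E3) (q : ℝ), 0 ≤ q → q ≤ 1 →
      |gaussFam A B x q - ∑ j ∈ Finset.range n,
        q ^ j / j ! * iteratedDeriv j (gaussFam A B x) 0| ≤ C * q ^ n * envelope c n x := by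
  obtain ⟨C, hC0, hC⟩ := exists_iteratedDeriv_gaussFam_bound hA hB hc n
  refine ⟨C, hC0, fun x q hq0 hq1 => ?_⟩
  cases n with
  | zero => simpa using hC x q (abs_le.2 ⟨by linarith, hq1⟩)
  | succ n =>
    -- Lagrange's remainder needs a nondegenerate interval; at `q = 0` the Taylor polynomial is
    -- exact.
    rcases hq0.eq_or_lt with rfl | hq
    · have h0 : ∑ j ∈ Finset.range (n + 1),
          (0 : ℝ) ^ j / j ! * iteratedDeriv j (gaussFam A B x) 0 = gaussFam A B x 0 := by
        rw [Finset.sum_range_succ']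
        simp
      rw [h0]
      simp
    · have hsm := contDiff_gaussFam hA hB x
      obtain ⟨y, hy, h⟩ := taylor_mean_remainder_lagrange_iteratedDeriv (n := n) hq.ne
        (hsm.contDiffOn.of_le (by exact_mod_cast le_top))
      rw [taylor_within_apply] at h
      have hsum : ∑ k ∈ Finset.range (n + 1), ((k ! : ℝ)⁻¹ * (q - 0) ^ k) •
          iteratedDerivWithin k (gaussFam A B x) (Set.uIcc 0 q) 0 =
          ∑ j ∈ Finset.range (n + 1), q ^ j / j ! * iteratedDeriv j (gaussFam A B x) 0 := by
        refine Finset.sum_congr rfl fun k _ => ?_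
        rw [iteratedDerivWithin_eq_iteratedDeriv (uniqueDiffOn_uIcc hq.ne)
          (hsm.contDiffAt.of_le (by exact_mod_cast le_top)) Set.left_mem_uIcc, smul_eq_mul, sub_zero]
        ring
      rw [hsum] at h
      rw [h, abs_div, abs_mul, sub_zero, abs_of_nonneg (by positivity : 0 ≤ q ^ (n + 1)),
        Nat.abs_cast]
      rw [Set.uIoo_of_lt hq] at hy
      have h1 := hC x y (abs_le.2 ⟨by linarith [hy.1], by linarith [hy.2]⟩)
      have h2 : (1 : ℝ) ≤ ((n + 1)! : ℕ) := by exact_mod_cast Nat.one_le_iff_ne_zero.2 (Nat.factorial_ne_zero _)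
      calc |iteratedDeriv (n + 1) (gaussFam A B x) y| * q ^ (n + 1) / ((n + 1)! : ℕ)
          ≤ |iteratedDeriv (n + 1) (gaussFam A B x) y| * q ^ (n + 1) :=
            div_le_self (by positivity) h2
        _ ≤ C * envelope c (n + 1) x * q ^ (n + 1) := by gcongr
        _ = _ := by ring

theorem integrable_mul_iteratedDeriv_gaussFam (hA : BddSmooth A) (hB : BddSmooth B) {c : ℝ}
    (hc0 : 0 < c) (hc : ∀ q, |q| ≤ 1 → c ≤ A q ∧ c ≤ B q) {W : E3 → ℝ} (hW : Continuous W) {m : ℕ}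
    (hWm : ∀ x, |W x| ≤ (1 + ‖x‖ ^ 2) ^ m) (n : ℕ) {q : ℝ} (hq : |q| ≤ 1) :
    Integrable fun x => W x * iteratedDeriv n (gaussFam A B x) q := by
  obtain ⟨C, hC0, hC⟩ := exists_iteratedDeriv_gaussFam_bound hA hB hc n
  refine ((integrable_envelope hc0 (m + n)).const_mul C).mono'
    (hW.mul (continuous_iteratedDeriv_gaussFam hA hB n q)).aestronglyMeasurable
    (Eventually.of_forall fun x => ?_)
  rw [norm_mul, Real.norm_eq_abs, Real.norm_eq_abs]
  refine (mul_le_mul (hWm x) (hC x q hq) (abs_nonneg _) (by positivity)).trans (le_of_eq ?_)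
  simp only [envelope]
  ring

theorem hasDerivAt_integral_gaussFam (hA : BddSmooth A) (hB : BddSmooth B) {c : ℝ}
    (hc0 : 0 < c) (hc : ∀ q, |q| ≤ 1 → c ≤ A q ∧ c ≤ B q) {W : E3 → ℝ} (hW : Continuous W) {m : ℕ}
    (hWm : ∀ x, |W x| ≤ (1 + ‖x‖ ^ 2) ^ m) (n : ℕ) {q : ℝ} (hq : q ∈ Set.Ioo (-1 : ℝ) 1) :
    HasDerivAt (fun q => ∫ x, W x * iteratedDeriv n (gaussFam A B x) q)
      (∫ x, W x * iteratedDeriv (n + 1) (gaussFam A B x) q) q := by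
  obtain ⟨C, hC0, hC⟩ := exists_iteratedDeriv_gaussFam_bound hA hB hc (n + 1)
  refine (hasDerivAt_integral_of_dominated_loc_of_deriv_le (s := Set.Ioo (-1 : ℝ) 1)
    (F := fun q x => W x * iteratedDeriv n (gaussFam A B x) q)
    (F' := fun q x => W x * iteratedDeriv (n + 1) (gaussFam A B x) q)
    (bound := fun x => C * envelope c (m + (n + 1)) x) (isOpen_Ioo.mem_nhds hq) ?_ ?_ ?_ ?_ ?_ ?_).2
  · exact Eventually.of_forall fun q =>
      (hW.mul (continuous_iteratedDeriv_gaussFam hA hB n q)).aestronglyMeasurable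
  · exact integrable_mul_iteratedDeriv_gaussFam hA hB hc0 hc hW hWm n (abs_le.2 ⟨hq.1.le, hq.2.le⟩)
  · exact (hW.mul (continuous_iteratedDeriv_gaussFam hA hB (n + 1) q)).aestronglyMeasurable
  · refine Eventually.of_forall fun x s hs => ?_
    rw [norm_mul, Real.norm_eq_abs, Real.norm_eq_abs]
    refine (mul_le_mul (hWm x) (hC x s (abs_le.2 ⟨hs.1.le, hs.2.le⟩)) (abs_nonneg _)
      (by positivity)).trans (le_of_eq ?_)
    simp only [envelope]
    ring
  · exact (integrable_envelope hc0 _).const_mul C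
  · refine Eventually.of_forall fun x s _ => ?_
    have h := ((contDiff_gaussFam hA hB x).differentiable_iteratedDeriv n
      (by exact_mod_cast ENat.natCast_lt_top n) s).hasDerivAt
    rw [← iteratedDeriv_succ] at h
    exact h.const_mul (W x)

theorem iteratedDeriv_integral_gaussFam (hA : BddSmooth A) (hB : BddSmooth B) {c : ℝ}
    (hc0 : 0 < c) (hc : ∀ q, |q| ≤ 1 → c ≤ A q ∧ c ≤ B q) {W : E3 → ℝ} (hW : Continuous W) {m : ℕ}
    (hWm : ∀ x, |W x| ≤ (1 + ‖x‖ ^ 2) ^ m) (n : ℕ) {q : ℝ} (hq : q ∈ Set.Ioo (-1 : ℝ) 1) :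
    iteratedDeriv n (fun q => ∫ x, W x * gaussFam A B x q) q =
      ∫ x, W x * iteratedDeriv n (gaussFam A B x) q := by
  induction n generalizing q with
  | zero => simp
  | succ n ih =>
    rw [iteratedDeriv_succ]
    refine ((hasDerivAt_integral_gaussFam hA hB hc0 hc hW hWm n hq).congr_of_eventuallyEq ?_).deriv
    filter_upwards [isOpen_Ioo.mem_nhds hq] with s hs using ih hs

end GaussianFamily

/-! ### Asymptotic expansion of the rescaled local integral -/

section LocalExpansion

theorem BddSmooth.const_mul {f : ℝ → ℝ} (hf : BddSmooth f) (c : ℝ) :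
    BddSmooth (fun q => c * f q) where
  smooth := contDiff_const.mul hf.smooth
  bdd n := by
    obtain ⟨C, hC⟩ := hf.bdd n
    refine ⟨|c| * C, fun q => ?_⟩
    rw [iteratedDeriv_const_mul_field, abs_mul]
    exact mul_le_mul_of_nonneg_left (hC q) (abs_nonneg c)

theorem sum_range_two_mul (f : ℕ → ℝ) (N : ℕ) :
    ∑ j ∈ Finset.range (2 * N), f j = ∑ m ∈ Finset.range N, (f (2 * m) + f (2 * m + 1)) := by
  induction N with
  | zero => simp
  | succ N ih =>
    rw [show 2 * (N + 1) = 2 * N + 1 + 1 by ring, Finset.sum_range_succ, Finset.sum_range_succ, ih,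
      Finset.sum_range_succ, add_assoc]

variable {A B : ℝ → ℝ}

/-- The coefficients of the asymptotic series as Gaussian integrals. -/
def coeffIntegral (A B : ℝ → ℝ) (m : ℕ) : ℝ :=
  1 / ((2 * m)! : ℝ) *
    ∫ x : E3, ‖x‖ ^ (2 * m) * Real.cos (x 2) * iteratedDeriv (2 * m) (gaussFam A B x) 0

theorem abs_norm_pow_mul_cos_le (m : ℕ) (x : E3) :
    |‖x‖ ^ (2 * m) * Real.cos (x 2)| ≤ (1 + ‖x‖ ^ 2) ^ m := by
  rw [abs_mul, abs_of_nonneg (by positivity), pow_mul]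
  calc _ ≤ (‖x‖ ^ 2) ^ m := mul_le_of_le_one_right (by positivity) (Real.abs_cos_le_one _)
    _ ≤ _ := pow_le_pow_left₀ (sq_nonneg _) (by linarith) m

theorem continuous_norm_pow_mul_cos (m : ℕ) :
    Continuous fun x : E3 => ‖x‖ ^ (2 * m) * Real.cos (x 2) := by fun_prop

theorem envelope_mono (c : ℝ) {m n : ℕ} (h : m ≤ n) (x : E3) : envelope c m x ≤ envelope c n x := by
  unfold envelope
  gcongr
  nlinarith [sq_nonneg ‖x‖]

/-- Where `s‖x‖ < 1` this is Taylor's formula to order `2N`. Elsewhere the integrand is cut off and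
the polynomial itself is small, since `(s‖x‖)ʲ ≤ (s‖x‖)^{2N}` for `j ≤ 2N`. In the exponent `3N` of
the envelope, `N` pays for `‖x‖^{2N}` and `2N` for the derivatives. -/
theorem exists_truncated_expansion_bound (hA : BddSmooth A) (hB : BddSmooth B)
    (hAe : ∀ q, A (-q) = A q) (hBe : ∀ q, B (-q) = B q) {c : ℝ}
    (hc : ∀ q, |q| ≤ 1 → c ≤ A q ∧ c ≤ B q) (N : ℕ) :
    ∃ C, 0 ≤ C ∧ ∀ (x : E3) (s : ℝ), 0 ≤ s →
      |(if s * ‖x‖ < 1 then gaussFam A B x (s * ‖x‖) * Real.cos (x 2) else 0) -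
        ∑ m ∈ Finset.range N, s ^ (2 * m) * (1 / ((2 * m)! : ℝ) * (‖x‖ ^ (2 * m) * Real.cos (x 2) *
          iteratedDeriv (2 * m) (gaussFam A B x) 0))| ≤ s ^ (2 * N) * (C * envelope c (3 * N) x) := by
  obtain ⟨C₁, hC₁, h₁⟩ := exists_gaussFam_taylor_bound hA hB hc (2 * N)
  choose D hD₀ hD using exists_iteratedDeriv_gaussFam_bound hA hB hc
  refine ⟨C₁ + ∑ j ∈ Finset.range (2 * N), D j, by
    have := Finset.sum_nonneg fun j (_ : j ∈ Finset.range (2 * N)) => hD₀ j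
    linarith, fun x s hs => ?_⟩
  have hodd : ∀ m, iteratedDeriv (2 * m + 1) (gaussFam A B x) 0 = 0 :=
    iteratedDeriv_odd_of_even fun q => by simp only [gaussFam, phase, hAe, hBe]
  have hsum : ∑ m ∈ Finset.range N, s ^ (2 * m) * (1 / ((2 * m)! : ℝ) *
      (‖x‖ ^ (2 * m) * Real.cos (x 2) * iteratedDeriv (2 * m) (gaussFam A B x) 0)) =
      (∑ j ∈ Finset.range (2 * N), (s * ‖x‖) ^ j / j ! *
        iteratedDeriv j (gaussFam A B x) 0) * Real.cos (x 2) := by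
    rw [sum_range_two_mul, Finset.sum_mul]
    refine Finset.sum_congr rfl fun m _ => ?_
    rw [hodd, mul_zero, add_zero, mul_pow]
    ring
  have henv : ∀ j ≤ 2 * N, (s * ‖x‖) ^ (2 * N) * envelope c j x ≤
      s ^ (2 * N) * envelope c (3 * N) x := by
    intro j hj
    have h2 : ‖x‖ ^ (2 * N) ≤ (1 + ‖x‖ ^ 2) ^ N := by
      rw [pow_mul]
      exact pow_le_pow_left₀ (sq_nonneg _) (by linarith) N
    rw [mul_pow, mul_assoc]
    refine mul_le_mul_of_nonneg_left ?_ (by positivity)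
    calc ‖x‖ ^ (2 * N) * envelope c j x ≤ (1 + ‖x‖ ^ 2) ^ N * envelope c (2 * N) x :=
          mul_le_mul h2 (envelope_mono c hj x) (envelope_nonneg _ _ _) (by positivity)
      _ = _ := by
          simp only [envelope]
          ring
  have henv0 := envelope_nonneg c (3 * N) x
  have hDsum := Finset.sum_nonneg fun j (_ : j ∈ Finset.range (2 * N)) => hD₀ j
  have hcos := Real.abs_cos_le_one (x 2)
  rw [hsum]
  split_ifs with h
  · rw [← sub_mul, abs_mul]
    have h3 := h₁ x (s * ‖x‖) (by positivity) h.le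
    calc _ ≤ (C₁ * (s * ‖x‖) ^ (2 * N) * envelope c (2 * N) x) * 1 :=
          mul_le_mul h3 hcos (abs_nonneg _)
            (mul_nonneg (by positivity) (envelope_nonneg _ _ _))
      _ = C₁ * ((s * ‖x‖) ^ (2 * N) * envelope c (2 * N) x) := by ring
      _ ≤ C₁ * (s ^ (2 * N) * envelope c (3 * N) x) :=
          mul_le_mul_of_nonneg_left (henv _ le_rfl) hC₁
      _ = s ^ (2 * N) * (C₁ * envelope c (3 * N) x) := by ring
      _ ≤ _ := by gcongr; linarith
  · have hone : 1 ≤ s * ‖x‖ := not_lt.1 h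
    rw [zero_sub, abs_neg, abs_mul]
    calc _ ≤ |∑ j ∈ Finset.range (2 * N), (s * ‖x‖) ^ j / j ! *
          iteratedDeriv j (gaussFam A B x) 0| * 1 :=
          mul_le_mul_of_nonneg_left hcos (abs_nonneg _)
      _ ≤ ∑ j ∈ Finset.range (2 * N), |(s * ‖x‖) ^ j / j ! *
          iteratedDeriv j (gaussFam A B x) 0| := by
          rw [mul_one]
          exact Finset.abs_sum_le_sum_abs _ _
      _ ≤ ∑ j ∈ Finset.range (2 * N), D j * (s ^ (2 * N) * envelope c (3 * N) x) := by
          refine Finset.sum_le_sum fun j hj => ?_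
          have hj' := (Finset.mem_range.1 hj).le
          rw [abs_mul, abs_of_nonneg (by positivity)]
          have hfac : (1 : ℝ) ≤ (j ! : ℕ) := by exact_mod_cast Nat.succ_le_of_lt j.factorial_pos
          have h4 : (s * ‖x‖) ^ j / j ! ≤ (s * ‖x‖) ^ (2 * N) :=
            (div_le_self (by positivity) hfac).trans (pow_le_pow_right₀ hone hj')
          calc _ ≤ (s * ‖x‖) ^ (2 * N) * (D j * envelope c j x) :=
                mul_le_mul h4 (hD j x 0 (by simp)) (abs_nonneg _) (by positivity)
            _ = D j * ((s * ‖x‖) ^ (2 * N) * envelope c j x) := by ring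
            _ ≤ _ := mul_le_mul_of_nonneg_left (henv j hj') (hD₀ j)
      _ = s ^ (2 * N) * ((∑ j ∈ Finset.range (2 * N), D j) * envelope c (3 * N) x) := by
          rw [← Finset.sum_mul]
          ring
      _ ≤ _ := by gcongr; linarith

/-- Asymptotic expansion of the rescaled local integral. -/
theorem exists_scaled_integral_bound (hA : BddSmooth A) (hB : BddSmooth B)
    (hAe : ∀ q, A (-q) = A q) (hBe : ∀ q, B (-q) = B q) {c : ℝ} (hc0 : 0 < c)
    (hc : ∀ q, |q| ≤ 1 → c ≤ A q ∧ c ≤ B q) (N : ℕ) :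
    ∃ C, ∀ s : ℝ, 0 ≤ s →
      |(∫ x : E3, if s * ‖x‖ < 1 then gaussFam A B x (s * ‖x‖) * Real.cos (x 2) else 0) -
        ∑ m ∈ Finset.range N, s ^ (2 * m) * coeffIntegral A B m| ≤ C * s ^ (2 * N) := by
  obtain ⟨C, hC0, hC⟩ := exists_truncated_expansion_bound hA hB hAe hBe hc N
  refine ⟨∫ x, C * envelope c (3 * N) x, fun s hs => ?_⟩
  have hint : ∀ m, Integrable fun x : E3 => s ^ (2 * m) * (1 / ((2 * m)! : ℝ) *
      (‖x‖ ^ (2 * m) * Real.cos (x 2) * iteratedDeriv (2 * m) (gaussFam A B x) 0)) := fun m =>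
    ((integrable_mul_iteratedDeriv_gaussFam hA hB hc0 hc (continuous_norm_pow_mul_cos m)
      (abs_norm_pow_mul_cos_le m) (2 * m) (by simp)).const_mul _).const_mul _
  have hmeas : AEStronglyMeasurable (fun x : E3 =>
      if s * ‖x‖ < 1 then gaussFam A B x (s * ‖x‖) * Real.cos (x 2) else 0) := by
    have hA' := hA.smooth.continuous
    have hB' := hB.smooth.continuous
    refine Measurable.aestronglyMeasurable (Measurable.ite ?_ ?_ measurable_const)
    · exact (isOpen_lt (by fun_prop) continuous_const).measurableSet
    · refine Continuous.measurable ?_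
      unfold gaussFam phase
      fun_prop
  have hsumint := integrable_finsetSum (Finset.range N) fun m _ => hint m
  have henv := (integrable_envelope hc0 (3 * N)).const_mul C
  have hmain : Integrable fun x : E3 =>
      if s * ‖x‖ < 1 then gaussFam A B x (s * ‖x‖) * Real.cos (x 2) else 0 := by
    have h1 := (henv.const_mul (s ^ (2 * N))).mono' (hmeas.sub hsumint.aestronglyMeasurable)
      (Eventually.of_forall fun x => hC x s hs)
    refine (h1.add hsumint).congr (Eventually.of_forall fun x => ?_)
    simp
  have heq : (∑ m ∈ Finset.range N, s ^ (2 * m) * coeffIntegral A B m) =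
      ∫ x : E3, ∑ m ∈ Finset.range N, s ^ (2 * m) * (1 / ((2 * m)! : ℝ) *
        (‖x‖ ^ (2 * m) * Real.cos (x 2) * iteratedDeriv (2 * m) (gaussFam A B x) 0)) := by
    rw [integral_finsetSum _ fun m _ => hint m]
    simp only [integral_const_mul, coeffIntegral]
  rw [heq, ← integral_sub hmain hsumint, mul_comm, ← integral_const_mul, ← Real.norm_eq_abs]
  exact norm_integral_le_of_norm_le (henv.const_mul _) (Eventually.of_forall fun x => hC x s hs)

end LocalExpansion

/-! ### The asymptotic series of the spectrum -/

section Asymptotics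

variable {P : ℝ → ℝ}

/-- The coefficient of `ρ²` in the exponent. -/
def transCoeff (P : ℝ → ℝ) (g q : ℝ) : ℝ := g ^ 2 * transProfile P q

/-- The coefficient of `z²` in the exponent. -/
def longCoeff (P : ℝ → ℝ) (g q : ℝ) : ℝ := g ^ 2 * longProfile P q

theorem IsInitialSpectrum.bddSmooth_transCoeff (hP : IsInitialSpectrum P) (g : ℝ) :
    BddSmooth (transCoeff P g) := hP.bddSmooth_transProfile.const_mul _

theorem IsInitialSpectrum.bddSmooth_longCoeff (hP : IsInitialSpectrum P) (g : ℝ) :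
    BddSmooth (longCoeff P g) := hP.bddSmooth_longProfile.const_mul _

theorem transCoeff_neg (g q : ℝ) : transCoeff P g (-q) = transCoeff P g q := by
  rw [transCoeff, transProfile_neg, transCoeff]

theorem longCoeff_neg (g q : ℝ) : longCoeff P g (-q) = longCoeff P g q := by
  rw [longCoeff, longProfile_neg, longCoeff]

theorem IsInitialSpectrum.exists_coeff_lower_bound (hP : IsInitialSpectrum P) {g : ℝ}
    (hg : g ≠ 0) : ∃ c, 0 < c ∧ ∀ q, |q| ≤ 1 → c ≤ transCoeff P g q ∧ c ≤ longCoeff P g q := by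
  obtain ⟨c, hc0, hc⟩ := hP.exists_profile_lower_bound
  refine ⟨g ^ 2 * c, by positivity, fun q hq => ⟨?_, ?_⟩⟩
  · exact mul_le_mul_of_nonneg_left (hc q hq).2 (sq_nonneg g)
  · exact mul_le_mul_of_nonneg_left (hc q hq).1 (sq_nonneg g)

/-- Rotation of `k` to the third axis followed by `q = x/‖k‖`. Then `q·k` becomes `x 2`, and `k²q² -
(q·k)²` becomes `x 0 ^ 2 + x 1 ^ 2`, so that `k` survives only in the argument of the profiles. -/
theorem IsInitialSpectrum.local_integral_eq (hP : IsInitialSpectrum P) (g : ℝ) {k : E3}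
    (hk : k ≠ 0) : (∫ q : E3, if ‖q‖ < 1 then
        Real.exp (g ^ 2 * quadForm P k q - Qexp P g k) * Real.cos (inner ℝ k q) else 0) =
      ‖k‖⁻¹ ^ 3 * ∫ x : E3, if ‖k‖⁻¹ * ‖x‖ < 1 then
        gaussFam (transCoeff P g) (longCoeff P g) x (‖k‖⁻¹ * ‖x‖) * Real.cos (x 2) else 0 := by
  have hk0 : 0 < ‖k‖ := norm_pos_iff.2 hk
  obtain ⟨R, hR⟩ := exists_linearIsometryEquiv_apply_eq (v := ‖k‖ • ez) (w := k)
    (by rw [norm_smul, norm_ez]; simp)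
  rw [← integral_comp_linearIsometryEquiv R]
  have h := Measure.integral_comp_smul (volume : Measure E3) (fun q : E3 => if ‖R q‖ < 1 then
        Real.exp (g ^ 2 * quadForm P k (R q) - Qexp P g k) * Real.cos (inner ℝ k (R q)) else 0)
        ‖k‖⁻¹
  simp only [finrank_euclideanSpace, Fintype.card_fin, smul_eq_mul] at h
  rw [abs_of_pos (by positivity), inv_pow, inv_inv] at h
  rw [inv_pow, eq_inv_mul_iff_mul_eq₀ (by positivity), ← h]
  refine integral_congr_ae ?_
  filter_upwards [ae_ne_zero] with x hx
  have hnorm : ‖R (‖k‖⁻¹ • x)‖ = ‖k‖⁻¹ * ‖x‖ := by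
    rw [LinearIsometryEquiv.norm_map, norm_smul, norm_inv, norm_norm]
  have hinner : inner ℝ (R (‖k‖⁻¹ • x)) k = x 2 := by
    nth_rewrite 2 [← hR]
    rw [LinearIsometryEquiv.inner_map_map, inner_smul_left, inner_smul_right, inner_ez]
    simp only [conj_trivial]
    field_simp
  have hne : R (‖k‖⁻¹ • x) ≠ 0 := by
    rw [← norm_pos_iff, hnorm]
    have := norm_pos_iff.2 hx
    positivity
  have hphase : g ^ 2 * quadForm P k (R (‖k‖⁻¹ • x)) - Qexp P g k =
      phase (transCoeff P g) (longCoeff P g) x (‖k‖⁻¹ * ‖x‖) := by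
    have h1 := hP.quadForm_sub k hne
    rw [hinner, hnorm] at h1
    have h2 : ‖k‖ ^ 2 * (‖k‖⁻¹ * ‖x‖) ^ 2 - x 2 ^ 2 = x 0 ^ 2 + x 1 ^ 2 := by
      rw [mul_pow, inv_pow, mul_inv_cancel_left₀ (by positivity), norm_sq_E3]
      ring
    rw [h2] at h1
    rw [Qexp, phase, transCoeff, longCoeff]
    linear_combination g ^ 2 * h1
  rw [real_inner_comm] at hinner
  simp only [hnorm, hphase, hinner, gaussFam]

theorem IsInitialSpectrum.exists_local_bound (hP : IsInitialSpectrum P) {g : ℝ} (hg : g ≠ 0)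
    (N : ℕ) : ∃ C, ∀ k : E3, k ≠ 0 → |(∫ q : E3, if ‖q‖ < 1 then
        Real.exp (g ^ 2 * quadForm P k q - Qexp P g k) * Real.cos (inner ℝ k q) else 0) -
      ∑ m ∈ Finset.range N, coeffIntegral (transCoeff P g) (longCoeff P g) m / ‖k‖ ^ (3 + 2 * m)| ≤
        C * (1 / ‖k‖ ^ (3 + 2 * N)) := by
  obtain ⟨c, hc0, hc⟩ := hP.exists_coeff_lower_bound hg
  obtain ⟨C, hC⟩ := exists_scaled_integral_bound (hP.bddSmooth_transCoeff g)
    (hP.bddSmooth_longCoeff g) (transCoeff_neg g) (longCoeff_neg g) hc0 hc N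
  refine ⟨C, fun k hk => ?_⟩
  have hk0 : 0 < ‖k‖ := norm_pos_iff.2 hk
  have h := hC ‖k‖⁻¹ (by positivity)
  have hsum : ∑ m ∈ Finset.range N,
      coeffIntegral (transCoeff P g) (longCoeff P g) m / ‖k‖ ^ (3 + 2 * m) =
      ‖k‖⁻¹ ^ 3 * ∑ m ∈ Finset.range N,
        ‖k‖⁻¹ ^ (2 * m) * coeffIntegral (transCoeff P g) (longCoeff P g) m := by
    rw [Finset.mul_sum]
    refine Finset.sum_congr rfl fun m _ => ?_
    rw [pow_add, inv_pow, inv_pow]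
    field_simp
  rw [hP.local_integral_eq g hk, hsum, ← mul_sub, abs_mul, abs_of_pos (by positivity)]
  refine (mul_le_mul_of_nonneg_left h (by positivity)).trans (le_of_eq ?_)
  rw [pow_add, inv_pow, inv_pow]
  field_simp

theorem isBigO_pow_mul_exp_neg_norm_sq {c : ℝ} (hc : 0 < c) (n M : ℕ) :
    (fun k : E3 => ‖k‖ ^ n * Real.exp (-(c * ‖k‖ ^ 2))) =O[Bornology.cobounded E3]
      fun k => 1 / ‖k‖ ^ M := by
  have h1 : (fun x : ℝ => x ^ n * Real.exp (-(c * x ^ 2))) =O[atTop] fun x : ℝ => 1 / x ^ M := by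
    have h2 := (isLittleO_pow_exp_pos_mul_atTop (n + M) hc).isBigO
    obtain ⟨C, hC⟩ := h2.bound
    refine IsBigO.of_bound C ?_
    filter_upwards [hC, eventually_ge_atTop 1] with x hx hx1
    have hx0 : 0 < x := by linarith
    rw [Real.norm_of_nonneg (by positivity), Real.norm_of_nonneg (by positivity)] at hx ⊢
    have h3 : Real.exp (-(c * x ^ 2)) ≤ Real.exp (-(c * x)) := by
      rw [Real.exp_le_exp, neg_le_neg_iff]
      exact mul_le_mul_of_nonneg_left (le_self_pow₀ hx1 two_ne_zero) hc.le
    rw [mul_one_div, le_div_iff₀ (by positivity)]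
    calc x ^ n * Real.exp (-(c * x ^ 2)) * x ^ M
        ≤ x ^ n * Real.exp (-(c * x)) * x ^ M := by gcongr
      _ = x ^ (n + M) * Real.exp (-(c * x)) := by ring
      _ ≤ C * Real.exp (c * x) * Real.exp (-(c * x)) := by gcongr
      _ = C := by rw [mul_assoc, ← Real.exp_add, add_neg_cancel, Real.exp_zero, mul_one]
  exact h1.comp_tendsto tendsto_norm_cobounded_atTop

theorem IsInitialSpectrum.exists_abs_quadForm_le (hP : IsInitialSpectrum P) :
    ∃ D, 0 ≤ D ∧ ∀ k q, |quadForm P k q| ≤ D * ‖k‖ ^ 2 := by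
  refine ⟨∫ p : E3, |dens P p * (inner ℝ p ez) ^ 2|,
    integral_nonneg fun _ => abs_nonneg _, fun k q => ?_⟩
  obtain ⟨R, hR⟩ := exists_linearIsometryEquiv_apply_eq (v := ‖k‖ • ez) (w := k)
    (by rw [norm_smul, norm_ez]; simp)
  have h := hP.abs_quadForm_le ez (R.symm q)
  rw [← hR, ← R.apply_symm_apply q, hP.quadForm_isometry, hP.quadForm_smul, R.norm_map, norm_smul,
    norm_ez, mul_one, norm_norm, abs_mul, abs_of_nonneg (sq_nonneg ‖k‖), mul_comm]
  exact mul_le_mul_of_nonneg_right h (sq_nonneg _)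

/-- The spectrum up to exponentially small corrections. -/
theorem IsInitialSpectrum.exists_spectrumValue_bound (hP : IsInitialSpectrum P) {g : ℝ}
    (hg : g ≠ 0) : ∃ c C₁ C₂ C₃ : ℝ, 0 < c ∧ ∀ k : E3, k ≠ 0 →
      |spectrumValue P g k - ∫ q : E3, if ‖q‖ < 1 then
        Real.exp (g ^ 2 * quadForm P k q - Qexp P g k) * Real.cos (inner ℝ k q) else 0| ≤
      g ^ 2 * (‖k‖ ^ 4 * Real.exp (-(c * ‖k‖ ^ 2))) * |P ‖k‖| + (C₁ * Real.exp (-(c * ‖k‖ ^ 2)) +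
        C₂ * (‖k‖ ^ 2 * Real.exp (-(c * ‖k‖ ^ 2))) +
        C₃ * (‖k‖ ^ 4 * Real.exp (-(c * ‖k‖ ^ 2)))) := by
  obtain ⟨η, hη0, hη⟩ := hP.exists_far_lower_bound
  obtain ⟨D, hD0, hD⟩ := hP.exists_abs_quadForm_le
  have hs1 := hP.sigmaSq_one_pos
  set V : ℝ := (volume : Measure E3).real (Metric.ball 0 1) with hV
  -- The rate must serve both `e^{-Q}`, where `Q = g² (σ₁²/3) k²`, and the full exponential for `|q|
  -- ≥ 1`, whose exponent is at most `-g² η k²`.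
  refine ⟨g ^ 2 * min η (sigmaSq P 1 / 3), V, g ^ 2 * D * V, 2 * g ^ 4 * ∫ q, quadForm P ez q ^ 2,
    by positivity, fun k hk => ?_⟩
  set e : ℝ := Real.exp (-(g ^ 2 * min η (sigmaSq P 1 / 3) * ‖k‖ ^ 2)) with he
  have hQ : Real.exp (-Qexp P g k) ≤ e := by
    rw [he, Real.exp_le_exp, neg_le_neg_iff, Qexp]
    nlinarith [mul_le_mul_of_nonneg_left (min_le_right η (sigmaSq P 1 / 3))
      (by positivity : 0 ≤ g ^ 2 * ‖k‖ ^ 2)]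
  have hfar : ∀ q : E3, 1 ≤ ‖q‖ → Real.exp (g ^ 2 * quadForm P k q - Qexp P g k) ≤ e := by
    intro q hq
    have hq0 : q ≠ 0 := norm_pos_iff.1 (by linarith)
    have h1 := hP.quadForm_sub k hq0
    obtain ⟨h2, h3⟩ := hη _ hq
    have hr : 0 < ‖q‖ ^ 2 := by positivity
    have h4 : η * ‖k‖ ^ 2 ≤ transProfile P ‖q‖ * (‖k‖ ^ 2 * ‖q‖ ^ 2 - (inner ℝ q k) ^ 2) +
        longProfile P ‖q‖ * (inner ℝ q k) ^ 2 := by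
      have h5 := mul_le_mul_of_nonneg_right h3 (sub_nonneg.2 (inner_sq_le q k))
      have h6 := mul_le_mul_of_nonneg_right h2 (sq_nonneg (inner ℝ q k))
      refine le_of_mul_le_mul_left ?_ hr
      linarith
    rw [he, Real.exp_le_exp, Qexp]
    have h7 := mul_le_mul_of_nonneg_left (min_le_left η (sigmaSq P 1 / 3))
      (by positivity : 0 ≤ g ^ 2 * ‖k‖ ^ 2)
    nlinarith [mul_le_mul_of_nonneg_left h4 (sq_nonneg g)]
  have hq := hP.continuous_quadForm k
  have hball : MeasurableSet {q : E3 | ‖q‖ < 1} :=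
    (isOpen_lt continuous_norm continuous_const).measurableSet
  have hball' : {q : E3 | ‖q‖ < 1} = Metric.ball 0 1 := by
    ext q
    simp
  have hite : ∀ f : E3 → ℝ, Continuous f →
      Integrable fun q : E3 => if ‖q‖ < 1 then f q else 0 := by
    intro f hf
    have h1 : IntegrableOn f (Metric.ball 0 1) :=
      (hf.continuousOn.integrableOn_compact (isCompact_closedBall (0 : E3) 1)).mono_set
        Metric.ball_subset_closedBall
    rw [← hball', ← integrable_indicator_iff hball] at h1
    exact h1
  have hF := hite (fun q => Real.exp (g ^ 2 * quadForm P k q - Qexp P g k) *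
    Real.cos (inner ℝ k q)) (by fun_prop)
  have hG := hite (fun q => Real.exp (-Qexp P g k) * (1 + g ^ 2 * quadForm P k q) *
    Real.cos (inner ℝ k q)) (by fun_prop)
  have hK : Integrable fun q => Real.exp (-Qexp P g k) *
      (kernelRem P g k q * Real.cos (inner ℝ k q)) :=
    ((hP.integrable_kernelRem g k).mul_bdd (c := 1)
      (Continuous.aestronglyMeasurable (by fun_prop))
      (Eventually.of_forall fun q => Real.abs_cos_le_one _)).const_mul _
  -- Inside the ball, `e^{-Q}` times the remainder is the full exponential minus `e^{-Q} (1 + g² kᵀ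
  -- Ĉ k)`. Hence the spectrum differs from the local integral only by the linear term, a tail and
  -- an integral carrying `e^{-Q}`.
  have hH : ∫ q : E3, (if ‖q‖ < 1 then 0 else Real.exp (-Qexp P g k) *
      (kernelRem P g k q * Real.cos (inner ℝ k q))) =
      (∫ q, Real.exp (-Qexp P g k) * (kernelRem P g k q * Real.cos (inner ℝ k q))) -
      (∫ q : E3, if ‖q‖ < 1 then Real.exp (g ^ 2 * quadForm P k q - Qexp P g k) *
        Real.cos (inner ℝ k q) else 0) +
      ∫ q : E3, if ‖q‖ < 1 then Real.exp (-Qexp P g k) * (1 + g ^ 2 * quadForm P k q) *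
        Real.cos (inner ℝ k q) else 0 := by
    rw [← integral_sub hK hF]
    refine Eq.trans ?_ (integral_add (hK.sub hF) hG)
    refine integral_congr_ae (Eventually.of_forall fun q => ?_)
    simp only
    split_ifs
    · rw [sub_eq_add_neg _ (Qexp P g k), Real.exp_add, kernelRem]
      ring
    · ring
  have hGb : |∫ q : E3, if ‖q‖ < 1 then Real.exp (-Qexp P g k) * (1 + g ^ 2 * quadForm P k q) *
        Real.cos (inner ℝ k q) else 0| ≤ e * (1 + g ^ 2 * (D * ‖k‖ ^ 2)) * V := by
    have h1 : ∫ q : E3, (if ‖q‖ < 1 then e * (1 + g ^ 2 * (D * ‖k‖ ^ 2)) else 0) =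
        e * (1 + g ^ 2 * (D * ‖k‖ ^ 2)) * V := by
      have h2 := integral_indicator_const (μ := (volume : Measure E3))
        (e * (1 + g ^ 2 * (D * ‖k‖ ^ 2))) hball
      rw [smul_eq_mul, mul_comm (volume.real _), hball', ← hV, ← hball'] at h2
      exact h2
    rw [← h1, ← Real.norm_eq_abs]
    refine norm_integral_le_of_norm_le (hite _ continuous_const) (Eventually.of_forall fun q => ?_)
    split_ifs
    · rw [norm_mul, norm_mul, Real.norm_of_nonneg (Real.exp_pos _).le]
      refine (mul_le_of_le_one_right (by positivity) (Real.abs_cos_le_one _)).trans ?_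
      refine mul_le_mul hQ ((norm_add_le _ _).trans ?_) (norm_nonneg _) (Real.exp_pos _).le
      rw [norm_one, norm_mul, Real.norm_of_nonneg (sq_nonneg g)]
      exact add_le_add le_rfl (mul_le_mul_of_nonneg_left (hD k q) (sq_nonneg g))
    · simp
  have hHb : |∫ q : E3, (if ‖q‖ < 1 then 0 else Real.exp (-Qexp P g k) *
      (kernelRem P g k q * Real.cos (inner ℝ k q)))| ≤
      2 * g ^ 4 * e * (‖k‖ ^ 4 * ∫ q, quadForm P ez q ^ 2) := by
    rw [← hP.integral_quadForm_sq, ← integral_const_mul, ← Real.norm_eq_abs]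
    refine norm_integral_le_of_norm_le ((hP.integrable_quadForm_sq k).const_mul _)
      (Eventually.of_forall fun q => ?_)
    split_ifs with h
    · rw [norm_zero]
      positivity
    · have h1 := hfar q (not_lt.1 h)
      have h2 := kernelRem_nonneg (P := P) g k q
      rw [← mul_assoc, norm_mul, Real.norm_of_nonneg (by positivity)]
      refine (mul_le_of_le_one_right (by positivity) (Real.abs_cos_le_one _)).trans ?_
      refine (mul_le_mul_of_nonneg_left (kernelRem_le g k q) (Real.exp_pos _).le).trans ?_
      rw [sub_eq_add_neg, Real.exp_add] at h1
      calc _ = g ^ 4 * quadForm P k q ^ 2 * (Real.exp (-Qexp P g k) +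
            Real.exp (g ^ 2 * quadForm P k q) * Real.exp (-Qexp P g k)) := by ring
        _ ≤ g ^ 4 * quadForm P k q ^ 2 * (e + e) := by gcongr
        _ = _ := by ring
  have hval : spectrumValue P g k - (∫ q : E3, if ‖q‖ < 1 then
        Real.exp (g ^ 2 * quadForm P k q - Qexp P g k) * Real.cos (inner ℝ k q) else 0) =
      g ^ 2 * (‖k‖ ^ 4 * Real.exp (-Qexp P g k)) * P ‖k‖ +
      ((∫ q : E3, (if ‖q‖ < 1 then 0 else Real.exp (-Qexp P g k) *
        (kernelRem P g k q * Real.cos (inner ℝ k q)))) -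
      ∫ q : E3, if ‖q‖ < 1 then Real.exp (-Qexp P g k) * (1 + g ^ 2 * quadForm P k q) *
        Real.cos (inner ℝ k q) else 0) := by
    rw [hH, spectrumValue, integral_const_mul]
    ring
  rw [hval]
  refine (abs_add_le _ _).trans (add_le_add ?_ ((abs_sub _ _).trans ?_))
  · rw [abs_mul, abs_of_nonneg (by positivity)]
    gcongr
  · refine (add_le_add hHb hGb).trans (le_of_eq ?_)
    ring

/-- The asymptotic series of the free power spectrum, with coefficients given by Gaussian
integrals. -/
theorem IsInitialSpectrum.freePowerSpectrum_isBigO (hP : IsInitialSpectrum P) {g : ℝ}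
    (hg : g ≠ 0) (N : ℕ) :
    (fun k : E3 => freePowerSpectrum P g k - ∑ m ∈ Finset.range N,
      coeffIntegral (transCoeff P g) (longCoeff P g) m / ‖k‖ ^ (3 + 2 * m))
      =O[Bornology.cobounded E3] fun k => 1 / ‖k‖ ^ (3 + 2 * N) := by
  obtain ⟨c, C₁, C₂, C₃, hc, h⟩ := hP.exists_spectrumValue_bound hg
  obtain ⟨C, hC⟩ := hP.exists_local_bound hg N
  have hne : ∀ᶠ k : E3 in Bornology.cobounded E3, k ≠ 0 := by
    filter_upwards [tendsto_norm_cobounded_atTop.eventually (eventually_gt_atTop 0)] with k hk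
    exact norm_pos_iff.1 hk
  have hPb : (fun k : E3 => |P ‖k‖|) =O[Bornology.cobounded E3] fun _ => (1 : ℝ) :=
    (hP.bounded.comp_tendsto tendsto_norm_cobounded_atTop).norm_left
  have hO := fun n => isBigO_pow_mul_exp_neg_norm_sq hc n (3 + 2 * N)
  have h0 := hO 0
  simp only [pow_zero, one_mul] at h0
  have hPO := ((hO 4).const_mul_left (g ^ 2)).mul hPb
  simp only [mul_one] at hPO
  have hsum := hPO.add (((h0.const_mul_left C₁).add ((hO 2).const_mul_left C₂)).add ((hO 4).const_mul_left C₃))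
  have h1 : (fun k : E3 => spectrumValue P g k - ∫ q : E3, if ‖q‖ < 1 then
        Real.exp (g ^ 2 * quadForm P k q - Qexp P g k) * Real.cos (inner ℝ k q) else 0)
      =O[Bornology.cobounded E3] fun k => 1 / ‖k‖ ^ (3 + 2 * N) := by
    refine IsBigO.trans (IsBigO.of_bound 1 ?_) hsum
    filter_upwards [hne] with k hk
    rw [one_mul]
    exact (h k hk).trans (le_abs_self _)
  have h2 : (fun k : E3 => (∫ q : E3, if ‖q‖ < 1 then
        Real.exp (g ^ 2 * quadForm P k q - Qexp P g k) * Real.cos (inner ℝ k q) else 0) -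
      ∑ m ∈ Finset.range N, coeffIntegral (transCoeff P g) (longCoeff P g) m / ‖k‖ ^ (3 + 2 * m))
      =O[Bornology.cobounded E3] fun k => 1 / ‖k‖ ^ (3 + 2 * N) := by
    refine IsBigO.of_bound C ?_
    filter_upwards [hne] with k hk
    rw [Real.norm_of_nonneg (by positivity : 0 ≤ 1 / ‖k‖ ^ (3 + 2 * N))]
    exact hC k hk
  refine (h1.add h2).congr' ?_ EventuallyEq.rfl
  filter_upwards [hne] with k hk
  rw [hP.freePowerSpectrum_eq g hk]
  ring

end Asymptotics

/-! ### Gaussian integrals differentiated in their parameter -/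

section LaplaceDerivative

/-- Since `s ≥ 0`, the integrand at parameter `a/2` dominates the derivative for all parameters
above `a/2`. -/
theorem hasDerivAt_integral_mul_exp_neg {Ω : Type*} [MeasurableSpace Ω] {μ : Measure Ω}
    {w s : Ω → ℝ} (hs : ∀ x, 0 ≤ s x)
    (hint : ∀ a, 0 < a → Integrable (fun x => w x * Real.exp (-(a * s x))) μ)
    (hint' : ∀ a, 0 < a → Integrable (fun x => w x * s x * Real.exp (-(a * s x))) μ)
    {a : ℝ} (ha : 0 < a) :
    HasDerivAt (fun a => ∫ x, w x * Real.exp (-(a * s x)) ∂μ)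
      (-∫ x, w x * s x * Real.exp (-(a * s x)) ∂μ) a := by
  rw [← integral_neg]
  refine (hasDerivAt_integral_of_dominated_loc_of_deriv_le (s := Set.Ioi (a / 2))
    (F := fun a x => w x * Real.exp (-(a * s x)))
    (F' := fun a x => -(w x * s x * Real.exp (-(a * s x))))
    (bound := fun x => |w x * s x * Real.exp (-(a / 2 * s x))|)
    (Ioi_mem_nhds (by linarith)) ?_ (hint a ha) (hint' a ha).neg.aestronglyMeasurable ?_
    (hint' (a / 2) (by linarith)).abs ?_).2
  · filter_upwards [Ioi_mem_nhds ha] with b hb using (hint b hb).aestronglyMeasurable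
  · refine Eventually.of_forall fun x b hb => ?_
    have hb : a / 2 < b := hb
    rw [norm_neg, Real.norm_eq_abs, abs_mul, abs_mul _ (Real.exp _), Real.abs_exp, Real.abs_exp]
    refine mul_le_mul_of_nonneg_left ?_ (abs_nonneg _)
    rw [Real.exp_le_exp, neg_le_neg_iff]
    exact mul_le_mul_of_nonneg_right hb.le (hs x)
  · refine Eventually.of_forall fun x b _ => ?_
    have h1 : HasDerivAt (fun b => -(b * s x)) (-s x) b := by
      exact ((hasDerivAt_id b).mul_const (s x)).fun_neg.congr_deriv (by rw [one_mul])
    exact (h1.exp.const_mul (w x)).congr_deriv (by ring)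

/-- `∫ z^{2l} cos z e^{-b z²} dz`. -/
def cosMoment (l : ℕ) (b : ℝ) : ℝ :=
  ∫ z : ℝ, z ^ (2 * l) * Real.cos z * Real.exp (-(b * z ^ 2))

theorem integrable_cosMoment (l : ℕ) {b : ℝ} (hb : 0 < b) :
    Integrable fun z : ℝ => z ^ (2 * l) * Real.cos z * Real.exp (-(b * z ^ 2)) := by
  refine ((integrable_pow_mul_gaussian hb (2 * l)).mul_bdd (c := 1)
    (g := Real.cos) Real.continuous_cos.aestronglyMeasurable
    (Eventually.of_forall fun z => Real.abs_cos_le_one z)).congr (Eventually.of_forall fun z => ?_)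
  ring

theorem hasDerivAt_cosMoment (l : ℕ) {b : ℝ} (hb : 0 < b) :
    HasDerivAt (cosMoment l) (-cosMoment (l + 1) b) b := by
  have h : ∀ z : ℝ, z ^ (2 * (l + 1)) * Real.cos z = z ^ (2 * l) * Real.cos z * z ^ 2 :=
    fun z => by ring
  have h2 := hasDerivAt_integral_mul_exp_neg (μ := volume) (w := fun z : ℝ => z ^ (2 * l) * Real.cos z)
    (s := fun z => z ^ 2) (fun z => sq_nonneg z) (fun a ha => integrable_cosMoment l ha)
    (fun a ha => by simpa only [h] using integrable_cosMoment (l + 1) ha) hb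
  simp only [← h] at h2
  exact h2

theorem cosMoment_zero {b : ℝ} (hb : 0 < b) :
    cosMoment 0 b = √(Real.pi / b) * Real.exp (-(1 / (4 * b))) := by
  have h := fourierIntegral_gaussian (b := (b : ℂ)) (by simpa using hb) 1
  have h1 : ∀ x : ℝ, Complex.exp (Complex.I * 1 * x) * Complex.exp (-b * x ^ 2) =
      (Real.exp (-(b * x ^ 2)) : ℂ) * Complex.exp (x * Complex.I) := by
    intro x
    push_cast
    rw [mul_comm, mul_one, mul_comm Complex.I, neg_mul]
  have h2 : Integrable fun x : ℝ => (Real.exp (-(b * x ^ 2)) : ℂ) * Complex.exp (x * Complex.I) := by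
    have := integrable_pow_mul_gaussian hb 0
    simp only [pow_zero, one_mul] at this
    exact this.ofReal.mul_bdd (c := 1) (Continuous.aestronglyMeasurable (by fun_prop))
      (Eventually.of_forall fun x => by rw [Complex.norm_exp_ofReal_mul_I])
  simp only [h1] at h
  have h3 := congrArg Complex.re h
  rw [← RCLike.re_eq_complex_re, ← integral_re h2] at h3
  have h4 : ((Real.pi : ℂ) / b) ^ (1 / 2 : ℂ) * Complex.exp (-1 ^ 2 / (4 * b)) =
      ((√(Real.pi / b) * Real.exp (-(1 / (4 * b))) : ℝ) : ℂ) := by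
    rw [Real.sqrt_eq_rpow]
    push_cast
    rw [Complex.ofReal_cpow (by positivity)]
    push_cast
    congr 2
    ring
  rw [h4] at h3
  simp only [RCLike.re_eq_complex_re, Complex.re_ofReal_mul, Complex.exp_ofReal_mul_I_re,
    Complex.ofReal_re] at h3
  rw [← h3, cosMoment]
  congr with z
  ring

/-- `∫ |x|^{2m} cos z e^{-(a |x|² + c z²)} d³x`. -/
def radialMoment (m : ℕ) (a c : ℝ) : ℝ :=
  ∫ x : E3, ‖x‖ ^ (2 * m) * Real.cos (x 2) * Real.exp (-(a * ‖x‖ ^ 2 + c * x 2 ^ 2))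

theorem integrable_radialMoment (m : ℕ) {a c : ℝ} (ha : 0 < a) (hc : 0 ≤ c) :
    Integrable fun x : E3 =>
      ‖x‖ ^ (2 * m) * Real.cos (x 2) * Real.exp (-(a * ‖x‖ ^ 2 + c * x 2 ^ 2)) := by
  refine (integrable_envelope ha m).mono' (Continuous.aestronglyMeasurable (by fun_prop))
    (Eventually.of_forall fun x => ?_)
  rw [norm_mul, Real.norm_eq_abs, Real.norm_of_nonneg (Real.exp_pos _).le, envelope]
  refine mul_le_mul (abs_norm_pow_mul_cos_le m x) ?_ (Real.exp_pos _).le (by positivity)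
  rw [Real.exp_le_exp]
  nlinarith [mul_nonneg hc (sq_nonneg (x 2))]

theorem hasDerivAt_radialMoment (m : ℕ) {a c : ℝ} (ha : 0 < a) (hc : 0 ≤ c) :
    HasDerivAt (fun a => radialMoment m a c) (-radialMoment (m + 1) a c) a := by
  have h : ∀ (m : ℕ) (a : ℝ) (x : E3),
      ‖x‖ ^ (2 * m) * Real.cos (x 2) * Real.exp (-(a * ‖x‖ ^ 2 + c * x 2 ^ 2)) =
      ‖x‖ ^ (2 * m) * Real.cos (x 2) * Real.exp (-(c * x 2 ^ 2)) * Real.exp (-(a * ‖x‖ ^ 2)) := by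
    intro m a x
    rw [neg_add, Real.exp_add]
    ring
  have h' : ∀ (a : ℝ) (x : E3),
      ‖x‖ ^ (2 * (m + 1)) * Real.cos (x 2) * Real.exp (-(a * ‖x‖ ^ 2 + c * x 2 ^ 2)) =
      ‖x‖ ^ (2 * m) * Real.cos (x 2) * Real.exp (-(c * x 2 ^ 2)) * ‖x‖ ^ 2 *
        Real.exp (-(a * ‖x‖ ^ 2)) := by
    intro a x
    rw [neg_add, Real.exp_add]
    ring
  have h2 := hasDerivAt_integral_mul_exp_neg (μ := (volume : Measure E3))
    (w := fun x => ‖x‖ ^ (2 * m) * Real.cos (x 2) * Real.exp (-(c * x 2 ^ 2)))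
    (s := fun x => ‖x‖ ^ 2) (fun x => sq_nonneg _)
    (fun a ha => by simpa only [h] using integrable_radialMoment m ha hc)
    (fun a ha => by simpa only [h'] using integrable_radialMoment (m + 1) ha hc) ha
  simp only [← h, ← h'] at h2
  exact h2

/-- The integral factorises over the coordinates: two plain Gaussians of parameter `a`, and one
cosine integral of parameter `a + c`. -/
theorem radialMoment_zero {a c : ℝ} (ha : 0 < a) (hc : 0 ≤ c) : radialMoment 0 a c =
    Real.pi / a * (√(Real.pi / (a + c)) * Real.exp (-(1 / (4 * (a + c))))) := by
  have h := integral_coord_prod (fun x => Real.exp (-a * x ^ 2)) (fun x => Real.exp (-a * x ^ 2))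
    (fun z => z ^ (2 * 0) * Real.cos z * Real.exp (-((a + c) * z ^ 2)))
  rw [integral_gaussian, Real.mul_self_sqrt (by positivity)] at h
  rw [← cosMoment_zero (by positivity)]
  refine Eq.trans ?_ h
  refine integral_congr_ae (Eventually.of_forall fun x => ?_)
  simp only [norm_sq_E3, mul_zero, pow_zero, one_mul]
  have h1 : Real.exp (-(a * (x 0 ^ 2 + x 1 ^ 2 + x 2 ^ 2) + c * x 2 ^ 2)) =
      Real.exp (-a * x 0 ^ 2) * Real.exp (-a * x 1 ^ 2) * Real.exp (-((a + c) * x 2 ^ 2)) := by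
    rw [← Real.exp_add, ← Real.exp_add]
    congr 1
    ring
  rw [h1]
  ring

end LaplaceDerivative

/-! ### Identification of the coefficients with Gaussian integrals -/

section CoefficientFunction

open scoped ContDiff

theorem iteratedDeriv_id_mul {h : ℝ → ℝ} {y : ℝ} (n : ℕ) (hh : ContDiffAt ℝ (n + 1 : ℕ) h y) :
    iteratedDeriv (n + 1) (fun y => y * h y) y =
      y * iteratedDeriv (n + 1) h y + (n + 1) * iteratedDeriv n h y := by
  have h1 := iteratedDeriv_mul (contDiffAt_id (𝕜 := ℝ) (x := y) (n := (n + 1 : ℕ))) hh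
  have h2 : ∀ i, iteratedDeriv (i + 1 + 1) (id : ℝ → ℝ) y = 0 := by
    intro i
    rw [iteratedDeriv_succ', iteratedDeriv_succ']
    simp [deriv_id']
  refine Eq.trans h1 ?_
  rw [Finset.sum_range_succ', Finset.sum_range_succ', Finset.sum_eq_zero fun i _ => ?_]
  · simp [iteratedDeriv_one]
    ring
  · rw [h2]
    ring

/-- The function of `y` whose `m`-th derivative enters the coefficient of order `m`, for
`R(y) = c⁻¹ y / (1 + y)`. -/
def yFun (c : ℝ) (m : ℕ) (y : ℝ) : ℝ :=
  y ^ m * √(c⁻¹ * (y / (1 + y))) / Real.exp (c⁻¹ * (y / (1 + y)) / 4)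

theorem contDiffAt_yFun {c y : ℝ} (hc : 0 < c) (hy : 0 < y) (m : ℕ) :
    ContDiffAt ℝ ∞ (yFun c m) y := by
  have h1 : ContDiffAt ℝ ∞ (fun y : ℝ => c⁻¹ * (y / (1 + y))) y :=
    contDiffAt_const.mul (contDiffAt_id.div (contDiffAt_const.add contDiffAt_id)
      (by positivity))
  exact ((contDiffAt_id.pow m).mul (h1.sqrt (by positivity))).div (h1.div_const 4).exp
    (Real.exp_pos _).ne'

/-- For `m = 0`, `y = c/a` turns `c⁻¹ y/(1+y)` into `1/(a+c)`, and the formula is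
`radialMoment_zero`. For the step, Leibniz gives `y (d/dy) + (m+1)` acting on the previous formula.
Since `(c/y)' = -(c/y)/y`, differentiating the power `(c/y)^(m+1)` cancels the term `m+1`, and
differentiating the moment raises its index. -/
theorem iteratedDeriv_yFun {c : ℝ} (hc : 0 < c) (m : ℕ) {y : ℝ} (hy : 0 < y) :
    iteratedDeriv m (yFun c m) y =
      (Real.pi ^ (3 / 2 : ℝ))⁻¹ * ((c / y) ^ (m + 1) * radialMoment m (c / y) c) := by
  induction m generalizing y with
  | zero =>
    have hπ : Real.pi ^ (3 / 2 : ℝ) = Real.pi * √Real.pi := by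
      rw [Real.sqrt_eq_rpow, ← Real.rpow_one_add' Real.pi_pos.le (by norm_num)]
      norm_num
    have h1 : c⁻¹ * (y / (1 + y)) = 1 / (c / y + c) := by
      field_simp
    have hs : 0 < √Real.pi := Real.sqrt_pos.2 Real.pi_pos
    have hcy : 0 < c / y := by positivity
    rw [iteratedDeriv_zero, radialMoment_zero hcy hc.le, yFun, h1, hπ,
      Real.sqrt_div Real.pi_pos.le, Real.sqrt_div zero_le_one, Real.sqrt_one, pow_zero, one_mul,
      Real.exp_neg]
    have h2 : 1 / (c / y + c) / 4 = 1 / (4 * (c / y + c)) := by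
      field_simp
    rw [h2, zero_add, pow_one]
    field_simp
  | succ m ih =>
    have h1 : yFun c (m + 1) = fun y => y * yFun c m y := by
      funext y
      rw [yFun, yFun]
      ring
    rw [h1, iteratedDeriv_id_mul m ((contDiffAt_yFun hc hy m).of_le (by exact_mod_cast le_top)),
      ih hy, iteratedDeriv_succ]
    have h2 : iteratedDeriv m (yFun c m) =ᶠ[𝓝 y] fun y =>
        (Real.pi ^ (3 / 2 : ℝ))⁻¹ * ((c / y) ^ (m + 1) * radialMoment m (c / y) c) := by
      filter_upwards [Ioi_mem_nhds hy] with z hz using ih hz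
    have h3 : HasDerivAt (fun y => c / y) (-(c / y) / y) y :=
      ((hasDerivAt_inv hy.ne').const_mul c).congr_deriv (by field_simp)
    have h4 := ((h3.pow (m + 1)).mul ((hasDerivAt_radialMoment m (by positivity : 0 < c / y)
      hc.le).comp y h3)).const_mul (Real.pi ^ (3 / 2 : ℝ))⁻¹
    have h5 := HasDerivAt.deriv (f := fun y =>
      (Real.pi ^ (3 / 2 : ℝ))⁻¹ * ((c / y) ^ (m + 1) * radialMoment m (c / y) c)) h4
    rw [h2.deriv_eq, h5]
    simp only [Function.comp, Pi.pow_apply]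
    push_cast
    generalize (Real.pi ^ (3 / 2 : ℝ))⁻¹ = K
    generalize c / y = a
    field_simp
    ring

variable {P : ℝ → ℝ}

/-- Near `0` the values are close to `σ₂²/30` and `σ₂²/10`. This makes `a₂` and `y₀` positive there,
so that the square root is differentiable. -/
theorem IsInitialSpectrum.eventually_transProfile_lt (hP : IsInitialSpectrum P) :
    ∀ᶠ q in 𝓝 (0 : ℝ), transProfile P q < longProfile P q := by
  refine (hP.bddSmooth_transProfile.smooth.continuous.continuousAt).eventually_lt
    hP.bddSmooth_longProfile.smooth.continuous.continuousAt ?_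
  rw [hP.longProfile_zero, hP.transProfile_zero]
  linarith [hP.sigmaSq_two_pos]

/-- `iteratedDeriv_yFun` is applied with `c = g² (L - T)` and `a = c/y₀ = g² T`; the prefactor of
`coeffFun` cancels `a^(m+1)`. The right-hand side makes sense, and is smooth, also at `q = 0`. -/
theorem IsInitialSpectrum.coeffFun_eq (hP : IsInitialSpectrum P) {g : ℝ} (hg : g ≠ 0) (m : ℕ)
    {q : ℝ} (hq : q ≠ 0) (hlt : transProfile P q < longProfile P q) :
    coeffFun P g m q = (Real.pi ^ (3 / 2 : ℝ))⁻¹ * ∫ x : E3, ‖x‖ ^ (2 * m) * Real.cos (x 2) *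
      gaussFam (transCoeff P g) (longCoeff P g) x q := by
  have hT := hP.transProfile_pos q
  set T := transProfile P q with hTdef
  set L := longProfile P q with hLdef
  set c := g ^ 2 * (L - T) with hc
  have hg2 : 0 < g ^ 2 := by positivity
  have hc0 : 0 < c := mul_pos hg2 (sub_pos.2 hlt)
  have hLT : L - T ≠ 0 := (sub_pos.2 hlt).ne'
  have hy0 : y0 P q = (L - T) / T := by
    rw [y0, hP.a1_add hq, hP.a2_eq hq, ← hTdef, ← hLdef]
    field_simp
  have hy : 0 < y0 P q := by
    rw [hy0]
    exact div_pos (sub_pos.2 hlt) hT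
  have hcy : c / y0 P q = g ^ 2 * T := by
    rw [hy0, hc]
    field_simp
  have hR : ∀ y, Rfun P g q y = c⁻¹ * (y / (1 + y)) := by
    intro y
    rw [Rfun, hP.a2_eq hq, hc, ← hTdef, ← hLdef]
    congr 1
    field_simp
  have hpre : q ^ 2 / g ^ 2 / (a1 P q + sigmaSq P 1 / 3) = (g ^ 2 * T)⁻¹ := by
    rw [hP.a1_add hq, ← hTdef]
    field_simp
  rw [coeffFun, hpre]
  simp only [hR]
  have h := iteratedDeriv_yFun hc0 m hy
  unfold yFun at h
  rw [h, hcy]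
  have hne : (g ^ 2 * T) ^ (m + 1) ≠ 0 := by positivity
  rw [inv_pow, mul_left_comm, inv_mul_cancel_left₀ hne, radialMoment]
  congr 1
  refine integral_congr_ae (Eventually.of_forall fun x => ?_)
  simp only [gaussFam, phase, transCoeff, longCoeff, ← hTdef, ← hLdef, norm_sq_E3, hc]
  congr 2
  ring

theorem IsInitialSpectrum.tendsto_iteratedDeriv_coeffFun (hP : IsInitialSpectrum P) {g : ℝ}
    (hg : g ≠ 0) (m : ℕ) :
    Tendsto (iteratedDeriv (2 * m) (coeffFun P g m)) (𝓝[≠] (0 : ℝ))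
      (𝓝 ((Real.pi ^ (3 / 2 : ℝ))⁻¹ * ∫ x : E3, ‖x‖ ^ (2 * m) * Real.cos (x 2) *
        iteratedDeriv (2 * m) (gaussFam (transCoeff P g) (longCoeff P g) x) 0)) := by
  obtain ⟨c, hc0, hc⟩ := hP.exists_coeff_lower_bound hg
  have hA := hP.bddSmooth_transCoeff g
  have hB := hP.bddSmooth_longCoeff g
  have hW := continuous_norm_pow_mul_cos m
  have hWm := abs_norm_pow_mul_cos_le m
  have h1 := (hasDerivAt_integral_gaussFam hA hB hc0 hc hW hWm (2 * m)
    (q := 0) (by norm_num)).continuousAt.tendsto.const_mul (Real.pi ^ (3 / 2 : ℝ))⁻¹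
  refine (h1.mono_left nhdsWithin_le_nhds).congr' ?_
  have h2 : ∀ᶠ q in 𝓝[≠] (0 : ℝ), coeffFun P g m q = (Real.pi ^ (3 / 2 : ℝ))⁻¹ *
      ∫ x : E3, ‖x‖ ^ (2 * m) * Real.cos (x 2) *
        gaussFam (transCoeff P g) (longCoeff P g) x q := by
    filter_upwards [hP.eventually_transProfile_lt.filter_mono nhdsWithin_le_nhds,
      self_mem_nhdsWithin] with q hq hq0 using hP.coeffFun_eq hg m hq0 hq
  -- Equality of the derivatives at a punctured point requires equality on a neighbourhood of that
  -- point.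
  have h3 := eventually_eventually_nhdsWithin.2 h2
  filter_upwards [h3, self_mem_nhdsWithin,
    mem_nhdsWithin_of_mem_nhds (Ioo_mem_nhds (by norm_num : (-1 : ℝ) < 0) one_pos)] with q hq hq0 hq1
  rw [IsOpen.nhdsWithin_eq isOpen_compl_singleton hq0] at hq
  rw [Filter.EventuallyEq.iteratedDeriv_eq (2 * m) hq, iteratedDeriv_const_mul_field,
    iteratedDeriv_integral_gaussFam hA hB hc0 hc hW hWm (2 * m) hq1]

theorem IsInitialSpectrum.coeff_eq (hP : IsInitialSpectrum P) {g : ℝ} (hg : g ≠ 0) (m : ℕ) :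
    coeff P g m = coeffIntegral (transCoeff P g) (longCoeff P g) m := by
  rw [coeff, (hP.tendsto_iteratedDeriv_coeffFun hg m).limUnder_eq, coeffIntegral]
  have hπ : Real.pi ^ (3 / 2 : ℝ) ≠ 0 := (Real.rpow_pos_of_pos Real.pi_pos _).ne'
  field_simp

end CoefficientFunction

/-! ### Polynomial Gaussian moments at zero separation -/

section GaussianMoments

open scoped Polynomial

open Polynomial in
/-- The polynomials with `∫ z^{2l} cos z e^{-b z²} dz = √π b^{-(l+1/2)} p_l(1/(4b)) e^{-1/(4b)}`. -/
def cosPoly : ℕ → ℝ[X]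
  | 0 => 1
  | l + 1 => C (l + 1 / 2 : ℝ) * cosPoly l + X * (derivative (cosPoly l) - cosPoly l)

/-- The constant term is multiplied by `l + 1/2` at each step; this is the source of the
nonvanishing of the polynomials `c_m`. -/
theorem cosPoly_eval_zero_pos (l : ℕ) : 0 < (cosPoly l).eval 0 := by
  induction l with
  | zero => simp [cosPoly]
  | succ l ih =>
    simp only [cosPoly, Polynomial.eval_add, Polynomial.eval_mul, Polynomial.eval_C,
      Polynomial.eval_X, zero_mul, add_zero]
    positivity

/-- The recursion for `cosPoly` is `-d/db` of the formula: the power of `b` gives `l + 1/2`, the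
polynomial gives `X p'`, and the exponential gives `-X p`. -/
theorem cosMoment_eq (l : ℕ) {b : ℝ} (hb : 0 < b) :
    cosMoment l b = √Real.pi * b ^ (-(l + 1 / 2 : ℝ)) * (cosPoly l).eval (1 / (4 * b)) *
      Real.exp (-(1 / (4 * b))) := by
  induction l generalizing b with
  | zero =>
    rw [cosMoment_zero hb, Real.sqrt_div Real.pi_pos.le, Real.sqrt_eq_rpow b, Real.rpow_neg hb.le]
    simp [cosPoly, div_eq_mul_inv]
  | succ l ih =>
    have hs : HasDerivAt (fun b : ℝ => 1 / (4 * b)) (-(1 / (4 * b)) / b) b := by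
      have := ((hasDerivAt_id b).const_mul 4).inv (by simpa using hb.ne')
      refine (this.congr_deriv ?_).congr_of_eventuallyEq (Eventually.of_forall fun y => ?_)
      · simp only [id]
        field_simp
      · simp
    have hp := ((cosPoly l).hasDerivAt (1 / (4 * b))).comp b hs
    have h2 := (((Real.hasDerivAt_rpow_const (p := (-(l + 1 / 2 : ℝ))) (Or.inl hb.ne')).const_mul
      √Real.pi).mul hp).mul hs.neg.exp
    have h3 := (hasDerivAt_cosMoment l hb).unique (h2.congr_of_eventuallyEq (by
      filter_upwards [Ioi_mem_nhds hb] with y hy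
      exact ih hy))
    have h4 : b ^ (-(l + 1 / 2 : ℝ) - 1) = b ^ (-((l + 1 : ℕ) + 1 / 2 : ℝ)) := by
      congr 1
      push_cast
      ring
    have h5 : b ^ (-(l + 1 / 2 : ℝ)) = b ^ (-((l + 1 : ℕ) + 1 / 2 : ℝ)) * b := by
      rw [← h4, Real.rpow_sub_one hb.ne']
      field_simp
    rw [neg_eq_iff_eq_neg.1 h3]
    simp only [cosPoly, Polynomial.eval_add, Polynomial.eval_mul, Polynomial.eval_C,
      Polynomial.eval_X, Polynomial.eval_sub, Function.comp, Pi.mul_apply, Pi.neg_apply]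
    rw [h4, h5]
    generalize b ^ (-((l + 1 : ℕ) + 1 / 2 : ℝ)) = B
    generalize Real.exp (-(1 / (4 * b))) = E
    generalize (Polynomial.derivative (cosPoly l)).eval (1 / (4 * b)) = p'
    generalize (cosPoly l).eval (1 / (4 * b)) = p
    field_simp
    ring

/-- The weight of the Gaussian integrals at zero separation. -/
def axialWeight (a : ℝ) (x : E3) : ℝ :=
  Real.cos (x 2) * Real.exp (-(a * (x 0 ^ 2 + x 1 ^ 2) + 3 * a * x 2 ^ 2))

theorem axialWeight_mul_eq (a : ℝ) (i j l : ℕ) (x : E3) :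
    x 0 ^ (2 * i) * x 1 ^ (2 * j) * x 2 ^ (2 * l) * axialWeight a x =
      x 0 ^ (2 * i) * Real.exp (-(a * x 0 ^ 2)) * (x 1 ^ (2 * j) * Real.exp (-(a * x 1 ^ 2))) *
        (x 2 ^ (2 * l) * Real.cos (x 2) * Real.exp (-(3 * a * x 2 ^ 2))) := by
  have h : Real.exp (-(a * (x 0 ^ 2 + x 1 ^ 2) + 3 * a * x 2 ^ 2)) = Real.exp (-(a * x 0 ^ 2)) *
      Real.exp (-(a * x 1 ^ 2)) * Real.exp (-(3 * a * x 2 ^ 2)) := by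
    rw [← Real.exp_add, ← Real.exp_add]
    congr 1
    ring
  rw [axialWeight, h]
  ring

theorem integrable_monomial_axialWeight {a : ℝ} (ha : 0 < a) (i j l : ℕ) :
    Integrable fun x : E3 =>
      x 0 ^ (2 * i) * x 1 ^ (2 * j) * x 2 ^ (2 * l) * axialWeight a x := by
  simp only [axialWeight_mul_eq]
  exact integrable_coord_prod (integrable_pow_mul_gaussian ha (2 * i))
    (integrable_pow_mul_gaussian ha (2 * j)) (integrable_cosMoment l (by positivity))

theorem integral_monomial_axialWeight {a : ℝ} (ha : 0 < a) (i j l : ℕ) :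
    ∫ x : E3, x 0 ^ (2 * i) * x 1 ^ (2 * j) * x 2 ^ (2 * l) * axialWeight a x =
      Real.Gamma (i + 1 / 2) * Real.Gamma (j + 1 / 2) * √Real.pi * 3 ^ (-(l + 1 / 2 : ℝ)) *
        a ^ (-((i + j + l : ℕ) + 3 / 2 : ℝ)) * Real.exp (-(1 / (12 * a))) *
        (cosPoly l).eval (1 / (12 * a)) := by
  simp only [axialWeight_mul_eq]
  have h := integral_coord_prod (fun x => x ^ (2 * i) * Real.exp (-(a * x ^ 2)))
    (fun x => x ^ (2 * j) * Real.exp (-(a * x ^ 2)))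
    (fun x => x ^ (2 * l) * Real.cos x * Real.exp (-(3 * a * x ^ 2)))
  rw [integral_pow_mul_gaussian ha, integral_pow_mul_gaussian ha] at h
  have h3 := cosMoment_eq l (by positivity : 0 < 3 * a)
  rw [cosMoment] at h3
  rw [h3, Real.mul_rpow (by norm_num) ha.le] at h
  have h4 : a ^ (-((i + j + l : ℕ) + 3 / 2 : ℝ)) = a ^ (-(i + 1 / 2 : ℝ)) *
      a ^ (-(j + 1 / 2 : ℝ)) * a ^ (-(l + 1 / 2 : ℝ)) := by
    rw [← Real.rpow_add ha, ← Real.rpow_add ha]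
    congr 1
    push_cast
    ring
  have h5 : 4 * (3 * a) = 12 * a := by ring
  rw [h5] at h
  rw [h4]
  refine Eq.trans h ?_
  ring

/-- `W` is a weight whose integrals against `axialWeight a` are
`a^{-(d+3/2)} e^{-1/(12a)}` times a polynomial in `1/(12a)` with positive constant term. -/
def HasPolyMoment (W : E3 → ℝ) (d : ℕ) : Prop :=
  ∃ p : Polynomial ℝ, 0 < p.eval 0 ∧ ∀ a : ℝ, 0 < a →
    Integrable (fun x => W x * axialWeight a x) ∧
    ∫ x, W x * axialWeight a x =
      a ^ (-(d + 3 / 2 : ℝ)) * Real.exp (-(1 / (12 * a))) * p.eval (1 / (12 * a))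

theorem hasPolyMoment_monomial (i j l : ℕ) :
    HasPolyMoment (fun x => x 0 ^ (2 * i) * x 1 ^ (2 * j) * x 2 ^ (2 * l)) (i + j + l) := by
  refine ⟨Polynomial.C (Real.Gamma (i + 1 / 2) * Real.Gamma (j + 1 / 2) * √Real.pi *
    3 ^ (-(l + 1 / 2 : ℝ))) * cosPoly l, ?_, fun a ha =>
    ⟨integrable_monomial_axialWeight ha i j l, ?_⟩⟩
  · rw [Polynomial.eval_mul, Polynomial.eval_C]
    have h1 : 0 < Real.Gamma (i + 1 / 2) := Real.Gamma_pos_of_pos (by positivity)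
    have h2 : 0 < Real.Gamma (j + 1 / 2) := Real.Gamma_pos_of_pos (by positivity)
    have h3 := cosPoly_eval_zero_pos l
    have h4 : 0 < √Real.pi := Real.sqrt_pos.2 Real.pi_pos
    positivity
  · rw [integral_monomial_axialWeight ha, Polynomial.eval_mul, Polynomial.eval_C]
    ring

theorem HasPolyMoment.add {V W : E3 → ℝ} {d : ℕ} (hV : HasPolyMoment V d)
    (hW : HasPolyMoment W d) : HasPolyMoment (fun x => V x + W x) d := by
  obtain ⟨p, hp0, hp⟩ := hV
  obtain ⟨r, hr0, hr⟩ := hW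
  refine ⟨p + r, by rw [Polynomial.eval_add]; positivity, fun a ha => ?_⟩
  simp only [add_mul]
  refine ⟨(hp a ha).1.add (hr a ha).1, ?_⟩
  rw [integral_add (hp a ha).1 (hr a ha).1, (hp a ha).2, (hr a ha).2, Polynomial.eval_add]
  ring

theorem HasPolyMoment.const_mul {W : E3 → ℝ} {d : ℕ} (hW : HasPolyMoment W d) {t : ℝ}
    (ht : 0 < t) : HasPolyMoment (fun x => t * W x) d := by
  obtain ⟨r, hr0, hr⟩ := hW
  refine ⟨Polynomial.C t * r, by rw [Polynomial.eval_mul, Polynomial.eval_C]; positivity,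
    fun a ha => ?_⟩
  simp only [mul_assoc t]
  refine ⟨(hr a ha).1.const_mul t, ?_⟩
  rw [integral_const_mul, (hr a ha).2, Polynomial.eval_mul, Polynomial.eval_C]
  ring

/-- One factor `‖x‖²` at a time is expanded into the three squares. Only positive combinations
occur, so the constant terms cannot cancel. -/
theorem hasPolyMoment_norm_pow_mul_monomial (n i j l : ℕ) :
    HasPolyMoment (fun x => ‖x‖ ^ (2 * n) * (x 0 ^ (2 * i) * x 1 ^ (2 * j) * x 2 ^ (2 * l)))
      (n + i + j + l) := by
  induction n generalizing i j l with
  | zero => simpa using hasPolyMoment_monomial i j l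
  | succ n ih =>
    have h1 := ih (i + 1) j l
    have h2 := ih i (j + 1) l
    have h3 := ih i j (l + 1)
    rw [show n + (i + 1) + j + l = n + 1 + i + j + l by ring] at h1
    rw [show n + i + (j + 1) + l = n + 1 + i + j + l by ring] at h2
    rw [show n + i + j + (l + 1) = n + 1 + i + j + l by ring] at h3
    convert (h1.add h2).add h3 using 1
    funext x
    rw [mul_add, pow_add, mul_one, norm_sq_E3]
    ring

/-- The weight multiplying the highest moment in the coefficient of order `n`. -/
def topWeight (n : ℕ) (x : E3) : ℝ :=
  ‖x‖ ^ (2 * n) * (x 0 ^ 2 + x 1 ^ 2 + (2 * n + 3) * x 2 ^ 2)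

theorem hasPolyMoment_topWeight (n : ℕ) : HasPolyMoment (topWeight n) (n + 1) := by
  have h := ((hasPolyMoment_norm_pow_mul_monomial n 1 0 0).add
    (hasPolyMoment_norm_pow_mul_monomial n 0 1 0)).add
    ((hasPolyMoment_norm_pow_mul_monomial n 0 0 1).const_mul (t := 2 * n + 3) (by positivity))
  convert h using 1
  funext x
  rw [topWeight]
  ring

theorem integral_topWeight_one {a : ℝ} (ha : 0 < a) :
    ∫ x, topWeight 1 x * axialWeight a x = Real.pi ^ (3 / 2 : ℝ) * 3 ^ (-(1 / 2 : ℝ)) *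
      a ^ (-(7 / 2 : ℝ)) * Real.exp (-(1 / (12 * a))) *
      ((123 - 132 * (1 / (12 * a)) + 20 * (1 / (12 * a)) ^ 2) / 36) := by
  have hI := fun i j l => integrable_monomial_axialWeight ha i j l
  -- Expansion of `(x₀² + x₁² + x₂²)(x₀² + x₁² + 5x₂²)` into monomials.
  have h : ∀ x, topWeight 1 x * axialWeight a x =
      x 0 ^ (2 * 2) * x 1 ^ (2 * 0) * x 2 ^ (2 * 0) * axialWeight a x +
      2 * (x 0 ^ (2 * 1) * x 1 ^ (2 * 1) * x 2 ^ (2 * 0) * axialWeight a x) +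
      x 0 ^ (2 * 0) * x 1 ^ (2 * 2) * x 2 ^ (2 * 0) * axialWeight a x +
      6 * (x 0 ^ (2 * 1) * x 1 ^ (2 * 0) * x 2 ^ (2 * 1) * axialWeight a x) +
      6 * (x 0 ^ (2 * 0) * x 1 ^ (2 * 1) * x 2 ^ (2 * 1) * axialWeight a x) +
      5 * (x 0 ^ (2 * 0) * x 1 ^ (2 * 0) * x 2 ^ (2 * 2) * axialWeight a x) := by
    intro x
    rw [topWeight, mul_one, norm_sq_E3]
    push_cast
    ring
  simp only [h]
  rw [integral_add (by fun_prop) (by fun_prop), integral_add (by fun_prop) (by fun_prop),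
    integral_add (by fun_prop) (by fun_prop), integral_add (by fun_prop) (by fun_prop),
    integral_add (by fun_prop) (by fun_prop)]
  simp only [integral_const_mul, integral_monomial_axialWeight ha]
  have hG1 : Real.Gamma (1 + 1 / 2) = √Real.pi / 2 := by
    rw [add_comm, Real.Gamma_add_one (by norm_num), Real.Gamma_one_half_eq]
    ring
  have hG2 : Real.Gamma (2 + 1 / 2) = 3 * √Real.pi / 4 := by
    rw [show (2 + 1 / 2 : ℝ) = 1 + 1 / 2 + 1 by norm_num, Real.Gamma_add_one (by norm_num), hG1]
    ring
  have h31 : (3 : ℝ) ^ (-(1 + 1 / 2 : ℝ)) = 3 ^ (-(1 / 2 : ℝ)) / 3 := by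
    rw [← Real.rpow_sub_one (by norm_num)]
    norm_num
  have h32 : (3 : ℝ) ^ (-(2 + 1 / 2 : ℝ)) = 3 ^ (-(1 / 2 : ℝ)) / 9 := by
    rw [show (-(2 + 1 / 2 : ℝ)) = -(1 + 1 / 2) - 1 by norm_num, Real.rpow_sub_one (by norm_num), h31]
    ring
  have hπ : Real.pi ^ (3 / 2 : ℝ) = √Real.pi * √Real.pi * √Real.pi := by
    rw [Real.mul_self_sqrt Real.pi_pos.le, Real.sqrt_eq_rpow,
      ← Real.rpow_one_add' Real.pi_pos.le (by norm_num)]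
    norm_num
  have ha7 : (2 : ℝ) + 3 / 2 = 7 / 2 := by norm_num
  simp only [Nat.cast_zero, Nat.cast_one, Nat.cast_ofNat, zero_add, add_zero, hG1, hG2,
    Real.Gamma_one_half_eq, h31, h32, hπ, Nat.reduceAdd, ha7, cosPoly, Polynomial.eval_add,
    Polynomial.eval_mul, Polynomial.eval_C, Polynomial.eval_X, Polynomial.eval_sub,
    Polynomial.eval_one, Polynomial.derivative_one, Polynomial.derivative_mul,
    Polynomial.derivative_add, Polynomial.derivative_C, Polynomial.derivative_X,
    Polynomial.derivative_sub, Polynomial.derivative_zero, Polynomial.eval_zero]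
  ring

end GaussianMoments

/-! ### The coefficients in terms of the moments -/

section Coefficients

variable {P : ℝ → ℝ}

/-- The derivatives at zero of the longitudinal coefficient of order at most `2m + 1`, as a
function of the moments, continued by zero to higher orders. -/
def lowDeriv {m : ℕ} (g2 : ℝ) (s : Fin (m + 1) → ℝ) (j : ℕ) : ℝ :=
  if h : Even j ∧ j / 2 < m + 1 then
    g2 * ((-1) ^ (j / 2) * s ⟨j / 2, h.2⟩ / ((j + 1) * (j + 2) * (j + 5)))
  else 0

/-- The derivatives of the exponent determined by the moments in `lowDeriv`. -/
def lowPhase {m : ℕ} (g2 : ℝ) (s : Fin (m + 1) → ℝ) (x : E3) (j : ℕ) : ℝ :=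
  -(lowDeriv g2 s j / (j + 3) * (x 0 ^ 2 + x 1 ^ 2) + lowDeriv g2 s j * x 2 ^ 2)

/-- The part of the coefficient of order `m + 1` which does not involve the highest moment. -/
def lowerPart (m : ℕ) (g2 : ℝ) (s : Fin (m + 1) → ℝ) : ℝ :=
  1 / ((2 * (m + 1)) ! : ℝ) * ∫ x : E3, ‖x‖ ^ (2 * (m + 1)) * Real.cos (x 2) *
    expCoeff (lowPhase g2 s x) (2 * (m + 1))

theorem lowDeriv_two_mul {m : ℕ} (g2 : ℝ) (s : Fin (m + 1) → ℝ) {i : ℕ} (hi : i < m + 1) :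
    lowDeriv g2 s (2 * i) =
      g2 * ((-1) ^ i * s ⟨i, hi⟩ / ((2 * i + 1) * (2 * i + 2) * (2 * i + 5))) := by
  have h : 2 * i / 2 = i := by omega
  rw [lowDeriv, dif_pos ⟨even_two_mul i, by omega⟩]
  simp only [h]
  push_cast
  rfl

theorem lowDeriv_two_mul_add_one {m : ℕ} (g2 : ℝ) (s : Fin (m + 1) → ℝ) (i : ℕ) :
    lowDeriv g2 s (2 * i + 1) = 0 :=
  dif_neg fun h => Nat.not_even_iff_odd.2 (odd_two_mul_add_one i) h.1

theorem lowDeriv_of_lt {m : ℕ} (g2 : ℝ) (s : Fin (m + 1) → ℝ) {j : ℕ} (hj : 2 * m + 1 < j) :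
    lowDeriv g2 s j = 0 :=
  dif_neg fun h => by omega

theorem IsInitialSpectrum.iteratedDeriv_longCoeff (hP : IsInitialSpectrum P) (g : ℝ) (i : ℕ) :
    iteratedDeriv (2 * i) (longCoeff P g) 0 =
      g ^ 2 * ((-1) ^ i * sigmaSq P (i + 2) / ((2 * i + 1) * (2 * i + 2) * (2 * i + 5))) := by
  unfold longCoeff
  rw [iteratedDeriv_const_mul_field, hP.iteratedDeriv_longProfile]

theorem IsInitialSpectrum.iteratedDeriv_transCoeff (hP : IsInitialSpectrum P) (g : ℝ) (j : ℕ) :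
    iteratedDeriv j (transCoeff P g) 0 = iteratedDeriv j (longCoeff P g) 0 / (j + 3) := by
  obtain ⟨i, rfl | rfl⟩ := j.even_or_odd'
  · unfold longCoeff transCoeff
    rw [iteratedDeriv_const_mul_field, iteratedDeriv_const_mul_field, hP.iteratedDeriv_transProfile]
    push_cast
    ring
  · rw [iteratedDeriv_odd_of_even (transCoeff_neg g), iteratedDeriv_odd_of_even (longCoeff_neg g),
      zero_div]

theorem IsInitialSpectrum.lowDeriv_eq (hP : IsInitialSpectrum P) (g : ℝ) {m j : ℕ}
    (hj : j ≤ 2 * m + 1) :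
    lowDeriv (g ^ 2) (fun i : Fin (m + 1) => sigmaSq P (2 + i)) j =
      iteratedDeriv j (longCoeff P g) 0 := by
  obtain ⟨i, rfl | rfl⟩ := j.even_or_odd'
  · rw [lowDeriv_two_mul _ _ (by omega : i < m + 1), hP.iteratedDeriv_longCoeff]
    simp only [add_comm 2 i]
  · rw [lowDeriv_two_mul_add_one, iteratedDeriv_odd_of_even (longCoeff_neg g)]

/-- The weight of the highest moment in the coefficient of order `m + 1`. -/
def topFactor (m : ℕ) : ℝ :=
  (-1) ^ m / (((2 * (m + 1)) ! : ℝ) * ((2 * m + 3) * (2 * m + 4) * (2 * m + 5) * (2 * m + 7)))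

/-- Derivatives of the exponent up to order `2m + 1` involve moments up to `σ²_{m+2}`. That of order
`2m + 2` carries `σ²_{m+3}` and enters the derivative of the exponential linearly, multiplied by the
Gaussian at zero separation. -/
theorem IsInitialSpectrum.coeffIntegral_succ (hP : IsInitialSpectrum P) {g : ℝ} (hg : g ≠ 0)
    (m : ℕ) : coeffIntegral (transCoeff P g) (longCoeff P g) (m + 1) =
      topFactor m * (g ^ 2 * sigmaSq P (m + 3)) *
        (∫ x, topWeight (m + 1) x * axialWeight (g ^ 2 * sigmaSq P 2 / 30) x) +
      lowerPart m (g ^ 2) (fun i => sigmaSq P (2 + i)) := by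
  obtain ⟨c, hc0, hc⟩ := hP.exists_coeff_lower_bound hg
  have hA := hP.bddSmooth_transCoeff g
  have hB := hP.bddSmooth_longCoeff g
  set a := g ^ 2 * sigmaSq P 2 / 30 with ha
  set s : Fin (m + 1) → ℝ := fun i => sigmaSq P (2 + i) with hs
  -- `K` comes from the derivative of order `2m + 2` of the exponent, whose minus sign turns
  -- `(-1)^(m+1)` into `(-1)^m`. Factoring out the transverse ratio `1/(2m+5)` leaves the weight `ρ²
  -- + (2m+5) z²`.
  set K : ℝ := (-1) ^ m * (g ^ 2 * sigmaSq P (m + 3)) /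
    ((2 * m + 3) * (2 * m + 4) * (2 * m + 5) * (2 * m + 7)) with hK
  have ha0 : 0 < a := by
    have := hP.sigmaSq_two_pos
    positivity
  have hT : transCoeff P g 0 = a := by
    rw [transCoeff, hP.transProfile_zero, ha]
    ring
  have hL : longCoeff P g 0 = 3 * a := by
    rw [longCoeff, hP.longProfile_zero, ha]
    ring
  have hpt : ∀ x : E3, ‖x‖ ^ (2 * (m + 1)) * Real.cos (x 2) *
      iteratedDeriv (2 * (m + 1)) (gaussFam (transCoeff P g) (longCoeff P g) x) 0 =
      K * (topWeight (m + 1) x * axialWeight a x) +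
      ‖x‖ ^ (2 * (m + 1)) * Real.cos (x 2) * expCoeff (lowPhase (g ^ 2) s x) (2 * (m + 1)) := by
    intro x
    have h := expCoeff_sub (n := 2 * m + 1) (d := fun j =>
      -(iteratedDeriv j (transCoeff P g) 0 * (x 0 ^ 2 + x 1 ^ 2) +
        iteratedDeriv j (longCoeff P g) 0 * x 2 ^ 2)) (e := lowPhase (g ^ 2) s x) fun j hj => by
      simp only [lowPhase, hs]
      rw [hP.lowDeriv_eq g hj, hP.iteratedDeriv_transCoeff]
    have h2 : 2 * m + 1 + 1 = 2 * (m + 1) := by ring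
    rw [h2] at h
    rw [iteratedDeriv_gaussFam hA hB, eq_add_of_sub_eq h, mul_add]
    congr 1
    simp only [lowPhase, iteratedDeriv_zero, hT, hL]
    rw [lowDeriv_of_lt _ _ (by omega), hP.iteratedDeriv_transCoeff, hP.iteratedDeriv_longCoeff,
      topWeight, axialWeight, hK, show m + 1 + 2 = m + 3 from rfl]
    push_cast
    have h1 : (2 * (m + 1) + 1 : ℝ) = 2 * m + 3 := by ring
    have h2 : (2 * (m + 1) + 2 : ℝ) = 2 * m + 4 := by ring
    have h3 : (2 * (m + 1) + 3 : ℝ) = 2 * m + 5 := by ring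
    have h5 : (2 * (m + 1) + 5 : ℝ) = 2 * m + 7 := by ring
    rw [h1, h2, h3, h5]
    have h3' : (2 * m + 3 : ℝ) ≠ 0 := by positivity
    have h4' : (2 * m + 4 : ℝ) ≠ 0 := by positivity
    have h5' : (2 * m + 5 : ℝ) ≠ 0 := by positivity
    have h7' : (2 * m + 7 : ℝ) ≠ 0 := by positivity
    generalize Real.exp _ = E
    field_simp
    ring
  obtain ⟨p, -, hp⟩ := hasPolyMoment_topWeight (m + 1)
  have hi1 := (hp a ha0).1.const_mul K
  have hi2 := integrable_mul_iteratedDeriv_gaussFam hA hB hc0 hc (continuous_norm_pow_mul_cos (m + 1))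
    (abs_norm_pow_mul_cos_le (m + 1)) (2 * (m + 1)) (q := 0) (by simp)
  -- Integrability of the lower part follows by subtraction, without an estimate of `expCoeff`.
  have hi3 : Integrable fun x : E3 => ‖x‖ ^ (2 * (m + 1)) * Real.cos (x 2) *
      expCoeff (lowPhase (g ^ 2) s x) (2 * (m + 1)) := by
    refine (hi2.sub hi1).congr (Eventually.of_forall fun x => ?_)
    simp only [Pi.sub_apply, hpt x, add_sub_cancel_left]
  rw [coeffIntegral, lowerPart, topFactor]
  simp only [hpt]
  rw [integral_add hi1 hi3, integral_const_mul, hK]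
  field_simp

theorem IsInitialSpectrum.bigSigma_pos (hP : IsInitialSpectrum P) {g : ℝ} (hg : g ≠ 0) :
    0 < bigSigma P g := by
  have := hP.sigmaSq_two_pos
  rw [bigSigma, tauSq]
  positivity

theorem IsInitialSpectrum.one_div_bigSigma (hP : IsInitialSpectrum P) {g : ℝ} (hg : g ≠ 0) :
    1 / (12 * (g ^ 2 * sigmaSq P 2 / 30)) = bigSigma P g := by
  have := hP.sigmaSq_two_pos
  rw [bigSigma, tauSq]
  field_simp
  norm_num

theorem IsInitialSpectrum.rpow_neg_eq (hP : IsInitialSpectrum P) {g : ℝ} (hg : g ≠ 0) (r : ℝ) :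
    (g ^ 2 * sigmaSq P 2 / 30) ^ (-r) = 12 ^ r * bigSigma P g ^ r := by
  have h0 := hP.bigSigma_pos hg
  have h := hP.sigmaSq_two_pos
  have h1 : g ^ 2 * sigmaSq P 2 / 30 = (12 * bigSigma P g)⁻¹ := by
    rw [← hP.one_div_bigSigma hg]
    field_simp
  rw [h1, Real.inv_rpow (by positivity), Real.rpow_neg (by positivity), inv_inv,
    Real.mul_rpow (by norm_num) h0.le]

/-- The factor `1/Σ` lowers the exponent `m + 7/2` of the Gaussian moment to the `m + 5/2` of the
final formula. -/
theorem IsInitialSpectrum.sq_mul_sigmaSq (hP : IsInitialSpectrum P) {g : ℝ} (hg : g ≠ 0) (n : ℕ) :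
    g ^ 2 * sigmaSq P n = 5 / 2 * (sigmaSq P n / sigmaSq P 2) / bigSigma P g := by
  have := hP.sigmaSq_two_pos
  rw [bigSigma, tauSq]
  field_simp

theorem IsInitialSpectrum.coeff_zero (hP : IsInitialSpectrum P) {g : ℝ} (hg : g ≠ 0) :
    coeff P g 0 = 3 * (4 * Real.pi) ^ (3 / 2 : ℝ) * bigSigma P g ^ (3 / 2 : ℝ) *
      Real.exp (-bigSigma P g) := by
  have hS := hP.bigSigma_pos hg
  have h2 := hP.sigmaSq_two_pos
  have hi := integral_monomial_axialWeight
    (by positivity : 0 < g ^ 2 * sigmaSq P 2 / 30) 0 0 0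
  have h32 : ((0 + 0 + 0 : ℕ) + 3 / 2 : ℝ) = 3 / 2 := by norm_num
  rw [h32, hP.rpow_neg_eq hg, hP.one_div_bigSigma hg] at hi
  rw [hP.coeff_eq hg, coeffIntegral]
  have hw : ∀ x : E3, ‖x‖ ^ (2 * 0) * Real.cos (x 2) *
      iteratedDeriv (2 * 0) (gaussFam (transCoeff P g) (longCoeff P g) x) 0 =
      x 0 ^ (2 * 0) * x 1 ^ (2 * 0) * x 2 ^ (2 * 0) * axialWeight (g ^ 2 * sigmaSq P 2 / 30) x := by
    intro x
    simp only [mul_zero, pow_zero, one_mul, iteratedDeriv_zero, gaussFam, phase, axialWeight,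
      transCoeff, longCoeff, hP.transProfile_zero, hP.longProfile_zero]
    congr 2
    ring
  simp only [hw]
  rw [hi]
  have h12 : (12 : ℝ) ^ (3 / 2 : ℝ) = 4 ^ (3 / 2 : ℝ) * 3 * 3 ^ (1 / 2 : ℝ) := by
    rw [show (12 : ℝ) = 4 * 3 by norm_num, Real.mul_rpow (by norm_num) (by norm_num), mul_assoc,
      ← Real.rpow_one_add' (by norm_num) (by norm_num)]
    norm_num
  have h3 : (3 : ℝ) ^ (-((0 : ℕ) + 1 / 2 : ℝ)) = (3 ^ (1 / 2 : ℝ))⁻¹ := by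
    rw [← Real.rpow_neg (by norm_num)]
    norm_num
  have hπ : Real.pi ^ (3 / 2 : ℝ) = √Real.pi * √Real.pi * √Real.pi := by
    rw [Real.mul_self_sqrt Real.pi_pos.le, Real.sqrt_eq_rpow,
      ← Real.rpow_one_add' Real.pi_pos.le (by norm_num)]
    norm_num
  have h30 : (3 : ℝ) ^ (1 / 2 : ℝ) ≠ 0 := by positivity
  rw [h12, h3, Real.mul_rpow (by norm_num) Real.pi_pos.le, hπ]
  simp only [Nat.cast_zero, zero_add, Real.Gamma_one_half_eq, cosPoly, Polynomial.eval_one,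
    mul_zero, Nat.factorial_zero, Nat.cast_one]
  field_simp

/-- The second derivative of an exponential involves the first two derivatives of the exponent. Here
the first vanishes by parity and the second belongs to the top moment, so the coefficient of order
one has no lower part. -/
theorem lowerPart_zero (g2 : ℝ) (s : Fin 1 → ℝ) : lowerPart 0 g2 s = 0 := by
  have h : ∀ x, expCoeff (lowPhase g2 s x) (2 * (0 + 1)) = 0 := by
    intro x
    rw [show 2 * (0 + 1) = 1 + 1 from rfl, expCoeff_succ]
    refine Finset.sum_eq_zero fun i _ => ?_
    have h1 : lowDeriv g2 s (i + 1) = 0 := by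
      cases i with
      | zero => exact lowDeriv_two_mul_add_one g2 s 0
      | succ i => exact lowDeriv_of_lt g2 s (by omega)
    simp [lowPhase, h1]
  simp [lowerPart, h]

theorem IsInitialSpectrum.coeff_one (hP : IsInitialSpectrum P) {g : ℝ} (hg : g ≠ 0) :
    coeff P g 1 = (4 * Real.pi) ^ (3 / 2 : ℝ) / 28 * (sigmaSq P 3 / sigmaSq P 2) *
      bigSigma P g ^ (5 / 2 : ℝ) * Real.exp (-bigSigma P g) *
      (123 - 132 * bigSigma P g + 20 * bigSigma P g ^ 2) := by
  have hS := hP.bigSigma_pos hg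
  have h2 := hP.sigmaSq_two_pos
  have h := hP.coeffIntegral_succ hg 0
  rw [lowerPart_zero, zero_add,
    integral_topWeight_one (by positivity : 0 < g ^ 2 * sigmaSq P 2 / 30), hP.rpow_neg_eq hg,
    hP.one_div_bigSigma hg, hP.sq_mul_sigmaSq hg] at h
  rw [hP.coeff_eq hg, h]
  have h12 : (12 : ℝ) ^ (7 / 2 : ℝ) = 432 * 4 ^ (3 / 2 : ℝ) * 3 ^ (1 / 2 : ℝ) := by
    have h1 : (12 : ℝ) ^ (7 / 2 : ℝ) = 12 ^ (2 : ℝ) * 12 ^ (3 / 2 : ℝ) := by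
      rw [← Real.rpow_add (by norm_num)]
      norm_num
    have h2 : (3 : ℝ) ^ (3 / 2 : ℝ) = 3 * 3 ^ (1 / 2 : ℝ) := by
      rw [← Real.rpow_one_add' (by norm_num) (by norm_num)]
      norm_num
    rw [h1, show (12 : ℝ) ^ (3 / 2 : ℝ) = (4 * 3) ^ (3 / 2 : ℝ) by norm_num,
      Real.mul_rpow (by norm_num) (by norm_num), h2]
    norm_num
    ring
  have hS7 : bigSigma P g ^ (7 / 2 : ℝ) = bigSigma P g ^ (5 / 2 : ℝ) * bigSigma P g := by
    rw [← Real.rpow_add_one hS.ne']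
    norm_num
  have h30 : (3 : ℝ) ^ (1 / 2 : ℝ) ≠ 0 := by positivity
  rw [h12, hS7, Real.rpow_neg (by norm_num), Real.mul_rpow (by norm_num) Real.pi_pos.le, topFactor]
  simp only [Nat.factorial, pow_zero]
  push_cast
  field_simp
  ring

theorem exists_topPoly (m : ℕ) : ∃ c : Polynomial ℝ, c ≠ 0 ∧
    ∀ P : ℝ → ℝ, IsInitialSpectrum P → ∀ g : ℝ, g ≠ 0 →
      coeff P g (m + 1) = sigmaSq P (m + 3) / sigmaSq P 2 *
        bigSigma P g ^ ((m : ℝ) + 5 / 2) * Real.exp (-bigSigma P g) * c.eval (bigSigma P g) +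
        lowerPart m (g ^ 2) (fun j => sigmaSq P (2 + j)) := by
  obtain ⟨p, hp0, hp⟩ := hasPolyMoment_topWeight (m + 1)
  -- The constant collects the weight of the top moment, the `5/2` in `g² σₙ² = (5/2)(σₙ²/σ₂²)/Σ`,
  -- and the power of `12` in `a = 1/(12Σ)`.
  have hF : topFactor m * (5 / 2) * 12 ^ ((m : ℝ) + 7 / 2) ≠ 0 := by
    have : topFactor m ≠ 0 := by
      rw [topFactor]
      exact div_ne_zero (pow_ne_zero _ (by norm_num)) (by positivity)
    positivity
  refine ⟨Polynomial.C (topFactor m * (5 / 2) * 12 ^ ((m : ℝ) + 7 / 2)) * p,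
    mul_ne_zero (Polynomial.C_ne_zero.2 hF) fun h => by simp [h] at hp0, fun P hP g hg => ?_⟩
  have hS := hP.bigSigma_pos hg
  have h2 := hP.sigmaSq_two_pos
  have hd : ((m + 1 + 1 : ℕ) + 3 / 2 : ℝ) = m + 7 / 2 := by
    push_cast
    ring
  have hS7 : bigSigma P g ^ ((m : ℝ) + 7 / 2) = bigSigma P g ^ ((m : ℝ) + 5 / 2) * bigSigma P g := by
    rw [← Real.rpow_add_one hS.ne']
    congr 1
    ring
  rw [hP.coeff_eq hg, hP.coeffIntegral_succ hg,
    (hp (g ^ 2 * sigmaSq P 2 / 30) (by positivity)).2, hd, hP.rpow_neg_eq hg,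
    hP.one_div_bigSigma hg, hP.sq_mul_sigmaSq hg, hS7, Polynomial.eval_mul, Polynomial.eval_C]
  congr 1
  field_simp

end Coefficients

end FreePower

end

/-! ### The main theorem -/

theorem mainTheorem3 :
    ∃ (c : ℕ → Polynomial ℝ) (Ψ : (m : ℕ) → ℝ → (Fin (m + 1) → ℝ) → ℝ),
      (∀ m, c m ≠ 0) ∧
      ∀ (P : ℝ → ℝ), FreePower.IsInitialSpectrum P →
      ∀ (gqp : ℝ → ℝ → ℝ) (t : ℝ), gqp t 0 ≠ 0 →
        -- the integral defining the spectrum converges, to a real number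
        (∀ k : FreePower.E3, k ≠ 0 →
          Tendsto (FreePower.regularizedSpectrum P (gqp t 0) k) (𝓝[>] (0 : ℝ))
            (𝓝 (FreePower.freePowerSpectrum P (gqp t 0) k : ℂ))) ∧
        -- the limits defining the coefficients exist
        (∀ m : ℕ, Tendsto (iteratedDeriv (2 * m) (FreePower.coeffFun P (gqp t 0) m)) (𝓝[≠] (0 : ℝ))
          (𝓝 (limUnder (𝓝[≠] (0 : ℝ))
            (iteratedDeriv (2 * m) (FreePower.coeffFun P (gqp t 0) m))))) ∧
        -- the full asymptotic series as `|k| → ∞`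
        (∀ N : ℕ,
          (fun k : FreePower.E3 => FreePower.freePowerSpectrum P (gqp t 0) k -
              ∑ m ∈ Finset.range N, FreePower.coeff P (gqp t 0) m / ‖k‖ ^ (3 + 2 * m))
            =O[Bornology.cobounded FreePower.E3] (fun k => 1 / ‖k‖ ^ (3 + 2 * N))) ∧
        -- the first two coefficients
        FreePower.coeff P (gqp t 0) 0 =
          3 * (4 * Real.pi) ^ (3 / 2 : ℝ) * FreePower.bigSigma P (gqp t 0) ^ (3 / 2 : ℝ) *
            Real.exp (-FreePower.bigSigma P (gqp t 0)) ∧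
        FreePower.coeff P (gqp t 0) 1 =
          (4 * Real.pi) ^ (3 / 2 : ℝ) / 28 *
            (FreePower.sigmaSq P 3 / FreePower.sigmaSq P 2) *
            FreePower.bigSigma P (gqp t 0) ^ (5 / 2 : ℝ) *
            Real.exp (-FreePower.bigSigma P (gqp t 0)) *
            (123 - 132 * FreePower.bigSigma P (gqp t 0) +
              20 * FreePower.bigSigma P (gqp t 0) ^ 2) ∧
        -- `σ²_{m+3}` enters the coefficient of order `m + 1` linearly, next to lower moments only
        (∀ m : ℕ, FreePower.coeff P (gqp t 0) (m + 1) =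
          FreePower.sigmaSq P (m + 3) / FreePower.sigmaSq P 2 *
              FreePower.bigSigma P (gqp t 0) ^ ((m : ℝ) + 5 / 2) *
              Real.exp (-FreePower.bigSigma P (gqp t 0)) *
              (c m).eval (FreePower.bigSigma P (gqp t 0)) +
            Ψ m (gqp t 0 ^ 2) (fun j => FreePower.sigmaSq P (2 + (j : ℕ)))) := by
  choose c hc0 hc using FreePower.exists_topPoly
  refine ⟨c, FreePower.lowerPart, hc0, fun P hP gqp t hg => ⟨fun k hk => ?_, fun m => ?_, fun N => ?_,
    hP.coeff_zero hg, hP.coeff_one hg, fun m => hc m P hP _ hg⟩⟩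
  · rw [hP.freePowerSpectrum_eq _ hk]
    exact hP.tendsto_regularizedSpectrum _ hk
  · exact tendsto_nhds_limUnder ⟨_, hP.tendsto_iteratedDeriv_coeffFun hg m⟩
  · simp only [hP.coeff_eq hg]
    exact hP.freePowerSpectrum_isBigO hg N
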